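/- **Setting.** Let $(\Omega,\mathcal F,P)$ be a probability space, $\Sigma$ a finite set, $p_\sigma>0$ ($\sigma\in\Sigma$), $S\subseteq\Sigma\times\Sigma$, and let $\theta(t)$, $t\in\mathbb Z$, be a stationary $\Sigma$-valued Markov process such that, whenever $P(\theta(t)=a)>0$, $P(\theta(t+1)=b\mid\theta(t)=a)$ equals $p_b$ if $(a,b)\in S$ and $0$ otherwise. Put $u_\sigma(t)=\chi(\theta(t)=\sigma)$ and, for a word $w=\sigma_1\cdots\sigma_k$, $p_w=p_{\sigma_1}\cdots p_{\sigma_k}$, $u_w(t)=\prod_{i=1}^k u_{\sigma_i}(t-k+i)$ (with $p_\epsilon=u_\epsilon=1$). For a process $r$ put $z^r_w(t)=r(t-|w|)\,u_w(t-1)/\sqrt{p_w}$, $T^r_{w,v}=E[z^r_w(t)z^r_v(t)^T]$, $\Lambda^r_w=E[r(t)z^r_w(t)^T]$. Let $L$ be the set of nonempty words all of whose consecutive letter pairs lie in $S$. Say that $r$ is *jointly stationary* if $r(t)$ and $z_w^r(t)$ ($w\in\Sigma^+$) are square integrable with mean zero and $E[r(t)z^r_w(t)^T]$, $E[z_w^r(t)z_v^r(t)^T]$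 do not depend on $t$ for all $w,v\in\Sigma^+$. The Hilbert space generated by a family of random vectors is the closed span in $L^2$ of their entries, and $E_l[\cdot\mid\cdot]$ denotes the orthogonal projection onto it. Equalities of random variables are almost sure. **JMLSRS.** A generalized bilinear system (GBS) $B$ of dimension $n$ consists of matrices $A_\sigma\in\mathbb R^{n\times n}$, $K_\sigma\in\mathbb R^{n\times m}$, $C\in\mathbb{R}^{p\times n}$, $D\in\mathbb R^{p\times m}$ and processes $x(t)\in\mathbb R^n$, $v(t)\in\mathbb R^m$ with $x(t+1)=\sum_\sigma(A_\sigma x(t)+K_\sigma v(t))u_\sigma(t)$; it realizes $y$ if $y(t)=Cx(t)+Dv(t)$ for all $t$. It is a *jump-Markov linear system with restricted switching* (JMLSRS) if 1. $v$ is jointly stationary; 2. $E[v(t)v(l)^T\mid\sigma(\theta(s):l\le s<t)]=0$ for $l<t$; 3. for every $t$, $\sigma(v(t-l):l\ge0)$ and $\sigma(\theta(t+l):l\ge 0)$ are conditionally independent given $\mathcal D_t=\sigma(\theta(s):s<t)$; 4. $x(t)$ lies in the Hilbert space generated by $\{z^v_w(t): w\in\Sigma^+\}$; 5. all eigenvalues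 of $\sum_\sigma p_\sigma A_\sigma^T\otimes A_\sigma^T$ lie in the open unit disk; 6. if $(\sigma_1,\sigma_2)\notin S$, then $A_{\sigma_2}A_{\sigma_1}=0$ and $A_{\sigma_2}K_{\sigma_1}T^v_{\sigma_1,\sigma_1}=0$. A JMLSRS realization of $y$ is *minimal* if its dimension is least among all JMLSRS realizations of $y$. **Forward innovation form.** A process $r$ is *RC* if it is jointly stationary and, for all $w,v\in\Sigma^+$ and $\sigma,\sigma'\in\Sigma$: $T^r_{\sigma,\sigma'}=0$, $T^r_{w\sigma,v\sigma'}=0$ and $T^r_{w\sigma,\sigma'}=0$ if $\sigma\ne\sigma'$; $T^r_{w\sigma,v\sigma}=T^r_{w,v}$ if $w\sigma\in L$ or $v\sigma\in L$; $T^r_{w\sigma,\sigma}=(\Lambda^r_w)^T$ if $w\sigma\in L$; $T^r_{w,v}=0$ if $w\notin L$ or $v\notin L$; and $T^r_{v,w}=0$ if exactly one of $w\sigma,v\sigma$ is in $L$. With $z_w=z^y_w$, the forward innovation process of $y$ is $e(t)=y(t)-E_l[y(t)\mid\{z_w(t):w\in\Sigma^+\}]$. A GBS is in forward innovation form (for $y$)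 if $D=I_p$, $v=e$, $v$ is RC, $z^v_w(t)$ and $z^v_{w'}(t)$ are uncorrelated for all $w\neq w'$ in $\Sigma^+$, and 4–6 hold. **Power series.** $\Psi_y=\{S_{(j,\sigma)}: 1\le j\le p,\ \sigma\in\Sigma\}$, where $S_{(j,\sigma)}(w)$ is the $j$th column of $\Lambda^y_{\sigma w}$, $w\in\Sigma^*$. A representation of dimension $n$ of $\Psi_y$ is a tuple $R=(\mathbb R^n,\{A_\sigma\},\{B_{(j,\sigma)}\},C)$ with $S_{(j,\sigma)}(w)=CA_wB_{(j,\sigma)}$ for all $w$, where $A_w=A_{\sigma_k}\cdots A_{\sigma_1}$ for $w=\sigma_1\cdots\sigma_k$; it is minimal if $n$ is least possible. $\Psi_y$ is rational if it has a representation, and square summable if $\sum_{w}\|S_{(j,\sigma)}(w)\|^2<\infty$ for all $j,\sigma$. Two representations $R,\tilde R$ are isomorphic if $T\tilde A_\sigma=A_\sigma T$, $T\tilde B_{(j,\sigma)}=B_{(j,\sigma)}$ and $\tilde C=CT$ for some nonsingular $T$. For a GBS $B$ let $Q_\sigma=E[v(t)v(t)^Tu_\sigma(t)^2]$; the representation associated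 with $B$ is $R_B=(\mathbb R^n,\{\sqrt{p_\sigma}A_\sigma\},\{B_{(j,\sigma)}\},C)$, where $B_{(j,\sigma)}$ is the $j$th column of $\frac1{\sqrt{p_\sigma}}(A_\sigma P_\sigma C^T+K_\sigma Q_\sigma D^T)$ and $\{P_\sigma\}$ is the unique solution of $$P_\sigma=p_\sigma\sum_{\sigma_1:\ \sigma_1\sigma\in L}\bigl(A_{\sigma_1}P_{\sigma_1}A_{\sigma_1}^T+K_{\sigma_1}Q_{\sigma_1}K_{\sigma_1}^T\bigr),\qquad \sigma\in\Sigma.\tag{1}$$ **Assumption (A) on $y$.** (i) $y$ is jointly stationary; (ii) for every $t$, $\sigma(y(t-l):l\ge0)$ and $\sigma(\theta(t+l):l\ge0)$ are conditionally independent given $\mathcal D_t$; (iii) $\Psi_y$ is square summable and rational. **Theorem.** Let $y(t)\in\mathbb R^p$, $t\in\mathbb Z$, be a process. (a) $y$ has a JMLSRS realization if and only if it satisfies (A). (b) If $y$ satisfies (A), then it has a minimal JMLSRS realization in forward innovation form. More precisely, let $R=(\mathbb R^n,\{A_\sigma\},\{B_{(j,\sigma)}\},C)$ be any minimal representation of $\Psi_y$,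 let $O_R$ be the matrix with block rows $CA_w$, $|w|\le n-1$, and let $Y_n(t)$ be the correspondingly stacked vector of the variables $y(t+|w|)u_w(t+|w|-1)/\sqrt{p_w}$, $|w|\le n-1$. Then $O_R$ has a left inverse and, for any left inverse $O_R^{-1}$, put $x(t)=E_l[O_R^{-1}Y_n(t)\mid\{z_w(t):w\in\Sigma^+\}]$, $P_\sigma=E[x(t)x(t)^Tu_\sigma(t)^2]$ and $B_\sigma=[B_{(1,\sigma)},\dots,B_{(p,\sigma)}]$. The equations $$K_\sigma(p_\sigma T^y_{\sigma,\sigma}-CP_\sigma C^T)=\sqrt{p_\sigma}B_\sigma-\tfrac1{\sqrt{p_\sigma}}A_\sigma P_\sigma C^T,\qquad\sigma\in\Sigma,$$ are solvable and, for every solution $\{K_\sigma\}$, the system $x(t+1)=\sum_\sigma(\frac1{\sqrt{p_\sigma}}A_\sigma x(t)+K_\sigma e(t))u_\sigma(t)$, $y(t)=Cx(t)+e(t)$ is a minimal JMLSRS realization of $y$ in forward innovation form. If moreover $E[e(t)e(t)^Tu_\sigma(t)^2]$ is positive definite for all $\sigma$, then the matrices $p_\sigma T^y_{\sigma,\sigma}-CP_\sigma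 C^T$ are invertible, so that $K_\sigma=(\sqrt{p_\sigma}B_\sigma-\frac1{\sqrt{p_\sigma}}A_\sigma P_\sigma C^T)(p_\sigma T^y_{\sigma,\sigma}-CP_\sigma C^T)^{-1}$. (c) Let $B$ be a JMLSRS realization of $y$. Then (1) has a unique solution, and $B$ is a minimal JMLSRS realization of $y$ if and only if $R_B$ is a minimal representation of $\Psi_y$. If $B_1$ and $B_2$ are minimal JMLSRS realizations of $y$, then $R_{B_1}$ and $R_{B_2}$ are isomorphic. -/

import Mathlib

open MeasureTheory
open scoped Kronecker

namespace JMLSRS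

noncomputable section

/-! ### Formal power series and their representations -/

/-- A tuple `(ℝⁿ, {A_σ}, {B_j}, C)`. -/
structure Rep (α J : Type*) (n p : ℕ) where
  A : α → Matrix (Fin n) (Fin n) ℝ
  B : J → Fin n → ℝ
  C : Matrix (Fin p) (Fin n) ℝ

/-- `A_w = A_{σ_k} ⋯ A_{σ_1}` for `w = σ_1 ⋯ σ_k`, and the identity for the empty word. -/
def wordMat {α : Type*} {n : ℕ} (A : α → Matrix (Fin n) (Fin n) ℝ) :
    List α → Matrix (Fin n) (Fin n) ℝ
  | [] => 1
  | σ :: w => wordMat A w * A σ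

/-- `R` is a representation of the family of formal power series `Ψ`. -/
def Rep.Represents {α J : Type*} {n p : ℕ} (R : Rep α J n p)
    (Ψ : J → List α → Fin p → ℝ) : Prop :=
  ∀ j w, Ψ j w = (R.C * wordMat R.A w).mulVec (R.B j)

/-- The family `Ψ` is rational. -/
def IsRational {α J : Type*} {p : ℕ} (Ψ : J → List α → Fin p → ℝ) : Prop :=
  ∃ (n : ℕ) (R : Rep α J n p), R.Represents Ψ

/-- `R` is a minimal representation of `Ψ`. -/
def Rep.IsMinimal {α J : Type*} {n p : ℕ} (R : Rep α J n p)
    (Ψ : J → List α → Fin p → ℝ) : Prop :=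
  R.Represents Ψ ∧ ∀ (n' : ℕ) (R' : Rep α J n' p), R'.Represents Ψ → n ≤ n'

/-- Isomorphism of representations: a nonsingular `T` with
`T Ã_σ = A_σ T`, `T B̃_j = B_j`, `C̃ = C T` (existence of `T⁻¹` forces equal dimensions). -/
def Rep.Isomorphic {α J : Type*} {n n' p : ℕ} (R : Rep α J n p) (R' : Rep α J n' p) : Prop :=
  ∃ (T : Matrix (Fin n) (Fin n') ℝ) (Tinv : Matrix (Fin n') (Fin n) ℝ),
    T * Tinv = 1 ∧ Tinv * T = 1 ∧
    (∀ σ, T * R'.A σ = R.A σ * T) ∧ (∀ j, T.mulVec (R'.B j) = R.B j) ∧ R'.C = R.C * T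

/-- The family `Ψ` is square summable. -/
def IsSquareSummable {α J : Type*} {p : ℕ} (Ψ : J → List α → Fin p → ℝ) : Prop :=
  ∀ j, Summable fun w : List α => ∑ i, (Ψ j w i) ^ 2

/-- The words over `α` of length at most `n - 1` (for `n = 0` there are none). -/
abbrev ShortWord (α : Type*) (n : ℕ) := (k : Fin n) × (Fin k → α)

/-- The word underlying an element of `ShortWord`. -/
def ShortWord.toList {α : Type*} {n : ℕ} (s : ShortWord α n) : List α := List.ofFn s.2

/-- The observability matrix `O_R`: its block rows are `C A_w`, `|w| ≤ n - 1`. -/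
def Rep.obsMatrix {α J : Type*} {n p : ℕ} (R : Rep α J n p) :
    Matrix (ShortWord α n × Fin p) (Fin n) ℝ :=
  Matrix.of fun s i => (R.C * wordMat R.A s.1.toList) s.2 i

/-! ### Square integrable random variables -/

section Prob

variable {Ω : Type*} [MeasurableSpace Ω]

/-- `E[f gᵀ]` for vector valued random variables. -/
def cov (μ : Measure Ω) {k l : ℕ} (f : Ω → Fin k → ℝ) (g : Ω → Fin l → ℝ) :
    Matrix (Fin k) (Fin l) ℝ :=
  Matrix.of fun i j => ∫ ω, f ω i * g ω j ∂μ

/-- The closed subspace of `L²` generated by the (classes of the) random variables in `F`. -/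
abbrev hilbertSpan (μ : Measure Ω) (F : Set (Ω → ℝ)) : Submodule ℝ (Lp ℝ 2 μ) :=
  (Submodule.span ℝ {g : Lp ℝ 2 μ | ∃ f ∈ F, (g : Ω → ℝ) =ᵐ[μ] f}).topologicalClosure

/-- The random variable `f` belongs to the Hilbert space generated by `F`. -/
def InHilbertSpan (μ : Measure Ω) (F : Set (Ω → ℝ)) (f : Ω → ℝ) : Prop :=
  ∃ g ∈ hilbertSpan μ F, (g : Ω → ℝ) =ᵐ[μ] f

/-- `g = E_l[f ∣ F]`, the orthogonal projection of the square integrable variable `f` onto the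
Hilbert space generated by `F`. -/
def IsLinProj (μ : Measure Ω) (F : Set (Ω → ℝ)) (f g : Ω → ℝ) : Prop :=
  ∃ hf : MemLp f 2 μ, g =ᵐ[μ] ((hilbertSpan μ F).starProjection (hf.toLp f) : Lp ℝ 2 μ)

/-- Conditional independence of the σ-algebras `m₁` and `m₂` with respect to `m'`
(on an arbitrary probability space). -/
def CondIndepSigma (μ : Measure Ω) (m' m₁ m₂ : MeasurableSpace Ω) : Prop :=
  ∀ A B : Set Ω, MeasurableSet[m₁] A → MeasurableSet[m₂] B →
    μ[(A ∩ B).indicator (fun _ => (1 : ℝ)) | m'] =ᵐ[μ]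
      fun ω => (μ[A.indicator (fun _ => (1 : ℝ)) | m']) ω *
        (μ[B.indicator (fun _ => (1 : ℝ)) | m']) ω

/-- The σ-algebra generated by the variables `r(t)`, `t ∈ I`. -/
abbrev sigmaGen {X : Type*} [MeasurableSpace X] (r : ℤ → Ω → X) (I : Set ℤ) : MeasurableSpace Ω :=
  ⨆ t ∈ I, MeasurableSpace.comap (r t) inferInstance

/-! ### Inputs, the processes `z_w`, and the recursive covariance property -/

variable {α : Type*}

/-- `p_w`, the product of the `p_σ` over the letters of `w`. -/
def wordWeight (pr : α → ℝ) (w : List α) : ℝ := (w.map pr).prod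

/-- `u_w(t) = u_{σ_1}(t-k+1) u_{σ_2}(t-k+2) ⋯ u_{σ_k}(t)` for `w = σ_1 ⋯ σ_k`. -/
def wordInput (u : α → ℤ → Ω → ℝ) (w : List α) (t : ℤ) (ω : Ω) : ℝ :=
  ∏ i : Fin w.length, u (w.get i) (t - w.length + 1 + (i : ℕ)) ω

/-- `z^r_w(t) = r(t-|w|) u_w(t-1) / √p_w`. -/
def zProc (pr : α → ℝ) (u : α → ℤ → Ω → ℝ) {k : ℕ} (r : ℤ → Ω → Fin k → ℝ)
    (w : List α) (t : ℤ) (ω : Ω) : Fin k → ℝ :=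
  fun i => r (t - w.length) ω i * wordInput u w (t - 1) ω / √(wordWeight pr w)

/-- `z^f_w(t) = r(t+|w|) u_w(t+|w|-1) / √p_w`, and `z^f_ε(t) = r(t)`. -/
def zFuture (pr : α → ℝ) (u : α → ℤ → Ω → ℝ) {k : ℕ} (r : ℤ → Ω → Fin k → ℝ)
    (w : List α) (t : ℤ) (ω : Ω) : Fin k → ℝ :=
  fun i => r (t + w.length) ω i * wordInput u w (t + w.length - 1) ω / √(wordWeight pr w)

/-- The scalar entries of the variables `z^r_w(t)`, `w` a nonempty word. -/
def zEntries (pr : α → ℝ) (u : α → ℤ → Ω → ℝ) {k : ℕ} (r : ℤ → Ω → Fin k → ℝ)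
    (t : ℤ) : Set (Ω → ℝ) :=
  {f | ∃ (w : List α) (i : Fin k), w ≠ [] ∧ f = fun ω => zProc pr u r w t ω i}

/-- The set `L` of admissible words determined by the admissible transitions `S`. -/
def admissible (S : Set (α × α)) : Set (List α) :=
  {w | w ≠ [] ∧ w.IsChain fun a b => (a, b) ∈ S}

/-- `r(t)` and `z^r_w(t)`, `w` a nonempty word, are square integrable and jointly zero mean,
wide-sense stationary. -/
structure JointWSS (μ : Measure Ω) (pr : α → ℝ) (u : α → ℤ → Ω → ℝ) {k : ℕ}
    (r : ℤ → Ω → Fin k → ℝ) : Prop where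
  memLp : ∀ t i, MemLp (fun ω => r t ω i) 2 μ
  memLp_z : ∀ w : List α, w ≠ [] → ∀ t i, MemLp (fun ω => zProc pr u r w t ω i) 2 μ
  mean : ∀ t i, ∫ ω, r t ω i ∂μ = 0
  mean_z : ∀ w : List α, w ≠ [] → ∀ t i, ∫ ω, zProc pr u r w t ω i ∂μ = 0
  cov_z : ∀ w : List α, w ≠ [] → ∀ t s,
    cov μ (r (t + s)) (zProc pr u r w (t + s)) = cov μ (r t) (zProc pr u r w t)
  cov_zz : ∀ w v : List α, w ≠ [] → v ≠ [] → ∀ t s,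
    cov μ (zProc pr u r w (t + s)) (zProc pr u r v (t + s)) =
      cov μ (zProc pr u r w t) (zProc pr u r v t)

/-- `T^r_{w,v} = E[z^r_w(t) z^r_v(t)ᵀ]` (the value at `t = 0`, by stationarity). -/
def covT (μ : Measure Ω) (pr : α → ℝ) (u : α → ℤ → Ω → ℝ) {k : ℕ}
    (r : ℤ → Ω → Fin k → ℝ) (w v : List α) : Matrix (Fin k) (Fin k) ℝ :=
  cov μ (zProc pr u r w 0) (zProc pr u r v 0)

/-- `Λ^r_w = E[r(t) z^r_w(t)ᵀ]` (the value at `t = 0`, by stationarity). -/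
def covLam (μ : Measure Ω) (pr : α → ℝ) (u : α → ℤ → Ω → ℝ) {k : ℕ}
    (r : ℤ → Ω → Fin k → ℝ) (w : List α) : Matrix (Fin k) (Fin k) ℝ :=
  cov μ (r 0) (zProc pr u r w 0)

/-- `E[r(t) r(t)ᵀ u_σ(t)²]` (the value at `t = 0`, by stationarity). -/
def covU (μ : Measure Ω) (u : α → ℤ → Ω → ℝ) {k : ℕ}
    (r : ℤ → Ω → Fin k → ℝ) (σ : α) : Matrix (Fin k) (Fin k) ℝ :=
  Matrix.of fun i j => ∫ ω, r 0 ω i * r 0 ω j * (u σ 0 ω) ^ 2 ∂μ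

/-- The recursive covariance property (RC). -/
structure IsRC (μ : Measure Ω) (pr : α → ℝ) (S : Set (α × α)) (u : α → ℤ → Ω → ℝ) {k : ℕ}
    (r : ℤ → Ω → Fin k → ℝ) : Prop where
  joint : JointWSS μ pr u r
  letters : ∀ σ σ' : α, σ ≠ σ' → covT μ pr u r [σ] [σ'] = 0
  shift : ∀ (w v : List α) (σ : α), w ≠ [] → v ≠ [] →
    (w ++ [σ] ∈ admissible S ∨ v ++ [σ] ∈ admissible S) →
    covT μ pr u r (w ++ [σ]) (v ++ [σ]) = covT μ pr u r w v
  shift_ne : ∀ (w v : List α) (σ σ' : α), w ≠ [] → v ≠ [] → σ ≠ σ' →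
    covT μ pr u r (w ++ [σ]) (v ++ [σ']) = 0
  shift_lam : ∀ (w : List α) (σ : α), w ≠ [] → w ++ [σ] ∈ admissible S →
    covT μ pr u r (w ++ [σ]) [σ] = (covLam μ pr u r w).transpose
  shift_lam_ne : ∀ (w : List α) (σ σ' : α), w ≠ [] → σ ≠ σ' →
    covT μ pr u r (w ++ [σ]) [σ'] = 0
  not_adm : ∀ w v : List α, w ≠ [] → v ≠ [] → (w ∉ admissible S ∨ v ∉ admissible S) →
    covT μ pr u r w v = 0
  not_adm_left : ∀ (w v : List α) (σ : α), w ≠ [] → v ≠ [] →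
    w ++ [σ] ∈ admissible S → v ++ [σ] ∉ admissible S → covT μ pr u r v w = 0
  not_adm_right : ∀ (w v : List α) (σ : α), w ≠ [] → v ≠ [] →
    v ++ [σ] ∈ admissible S → w ++ [σ] ∉ admissible S → covT μ pr u r v w = 0

/-- The family `Ψ_y`: `S_{(j,σ)}(w)` is the `j`th column of `Λ^y_{σ w}`. -/
def PsiFamily (μ : Measure Ω) (pr : α → ℝ) (u : α → ℤ → Ω → ℝ) {p : ℕ}
    (y : ℤ → Ω → Fin p → ℝ) : (Fin p × α) → List α → Fin p → ℝ :=
  fun jσ w i => covLam μ pr u y (jσ.2 :: w) i jσ.1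

/-- `e` is the forward innovation process of `y`:
`e(t) = y(t) - E_l[y(t) ∣ {z_w(t) ∣ w ∈ Σ⁺}]`. -/
def IsForwardInnovation (μ : Measure Ω) (pr : α → ℝ) (u : α → ℤ → Ω → ℝ) {p : ℕ}
    (y e : ℤ → Ω → Fin p → ℝ) : Prop :=
  ∀ t i, IsLinProj μ (zEntries pr u y t) (fun ω => y t ω i) (fun ω => y t ω i - e t ω i)

/-! ### Generalized bilinear systems -/

/-- The data of a generalized bilinear system with state dimension `n`, noise dimension `m` and
output dimension `p`. -/
structure GBS (Ω α : Type*) (n m p : ℕ) where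
  A : α → Matrix (Fin n) (Fin n) ℝ
  K : α → Matrix (Fin n) (Fin m) ℝ
  C : Matrix (Fin p) (Fin n) ℝ
  D : Matrix (Fin p) (Fin m) ℝ
  /-- state process -/
  x : ℤ → Ω → Fin n → ℝ
  /-- noise process -/
  v : ℤ → Ω → Fin m → ℝ

variable [Fintype α] {n m p : ℕ}

/-- `x`, `v` are processes and `x(t+1) = ∑_σ (A_σ x(t) + K_σ v(t)) u_σ(t)`. -/
structure GBS.IsSystem (B : GBS Ω α n m p) (μ : Measure Ω) (u : α → ℤ → Ω → ℝ) : Prop where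
  meas_x : ∀ t, Measurable (B.x t)
  meas_v : ∀ t, Measurable (B.v t)
  state_eq : ∀ t, ∀ᵐ ω ∂μ, B.x (t + 1) ω =
    ∑ σ, u σ t ω • ((B.A σ).mulVec (B.x t ω) + (B.K σ).mulVec (B.v t ω))

/-- `y(t) = C x(t) + D v(t)` for all `t`. -/
def GBS.Realizes (B : GBS Ω α n m p) (μ : Measure Ω) (y : ℤ → Ω → Fin p → ℝ) : Prop :=
  ∀ t, ∀ᵐ ω ∂μ, y t ω = B.C.mulVec (B.x t ω) + B.D.mulVec (B.v t ω)

/-- The state belongs to the Hilbert space generated by `{z^v_w(t) ∣ w ∈ Σ⁺}`. -/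
def GBS.NoiseDriven (B : GBS Ω α n m p) (μ : Measure Ω) (pr : α → ℝ)
    (u : α → ℤ → Ω → ℝ) : Prop :=
  ∀ t i, InHilbertSpan μ (zEntries pr u B.v t) (fun ω => B.x t ω i)

/-- All eigenvalues of `∑_σ p_σ A_σᵀ ⊗ A_σᵀ` lie inside the unit disk. -/
def GBS.Stable (B : GBS Ω α n m p) (pr : α → ℝ) : Prop :=
  ∀ z ∈ spectrum ℂ
    ((∑ σ, pr σ • ((B.A σ).transpose ⊗ₖ (B.A σ).transpose)).map (fun a : ℝ => (a : ℂ))),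
    ‖z‖ < 1

/-- If `σ₁σ₂ ∉ L` then `A_{σ₂} A_{σ₁} = 0` and `A_{σ₂} K_{σ₁} T^v_{σ₁,σ₁} = 0`. -/
def GBS.SwitchCompatible (B : GBS Ω α n m p) (μ : Measure Ω) (pr : α → ℝ) (S : Set (α × α))
    (u : α → ℤ → Ω → ℝ) : Prop :=
  ∀ σ₁ σ₂ : α, [σ₁, σ₂] ∉ admissible S →
    B.A σ₂ * B.A σ₁ = 0 ∧ B.A σ₂ * B.K σ₁ * covT μ pr u B.v [σ₁] [σ₁] = 0

/-- The standing assumptions on generalized bilinear systems. -/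
structure GBS.StandingAssumption (B : GBS Ω α n m p) (μ : Measure Ω) (pr : α → ℝ)
    (S : Set (α × α)) (u : α → ℤ → Ω → ℝ) : Prop where
  system : B.IsSystem μ u
  noise_rc : IsRC μ pr S u B.v
  noise_orth : ∀ w v : List α, w ≠ [] → v ≠ [] → w ≠ v → ∀ t,
    cov μ (zProc pr u B.v w t) (zProc pr u B.v v t) = 0
  noise_driven : B.NoiseDriven μ pr u
  stable : B.Stable pr
  compatible : B.SwitchCompatible μ pr S u

/-- `B` is a generalized bilinear system in forward innovation form (relative to `y`):
`D = I`, the noise is the forward innovation process of `y`, and the standing assumptions hold. -/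
structure GBS.ForwardInnovationForm (B : GBS Ω α n p p) (μ : Measure Ω) (pr : α → ℝ)
    (S : Set (α × α)) (u : α → ℤ → Ω → ℝ) (y : ℤ → Ω → Fin p → ℝ) : Prop where
  D_eq : B.D = 1
  noise_eq : IsForwardInnovation μ pr u y B.v
  standing : B.StandingAssumption μ pr S u

/-- `P` solves `P_σ = p_σ ∑_{σ₁ : σ₁σ ∈ L} (A_{σ₁} P_{σ₁} A_{σ₁}ᵀ + K_{σ₁} Q_{σ₁} K_{σ₁}ᵀ)`,
where `Q_σ = E[v(t) v(t)ᵀ u_σ(t)²]`. -/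
def GBS.SolvesCovEq (B : GBS Ω α n m p) (μ : Measure Ω) (pr : α → ℝ) (S : Set (α × α))
    (u : α → ℤ → Ω → ℝ) (P : α → Matrix (Fin n) (Fin n) ℝ) : Prop :=
  open Classical in
  ∀ σ, P σ = pr σ • ∑ σ₁ with [σ₁, σ] ∈ admissible S,
    (B.A σ₁ * P σ₁ * (B.A σ₁).transpose + B.K σ₁ * covU μ u B.v σ₁ * (B.K σ₁).transpose)

/-- The representation associated with `B`, formed with the matrices `P_σ`:
`(ℝⁿ, {√p_σ A_σ}, B, C)`, where `B_{(j,σ)}` is the `j`th column of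
`(A_σ P_σ Cᵀ + K_σ Q_σ Dᵀ) / √p_σ`. -/
def GBS.assocRep (B : GBS Ω α n m p) (μ : Measure Ω) (pr : α → ℝ)
    (u : α → ℤ → Ω → ℝ) (P : α → Matrix (Fin n) (Fin n) ℝ) : Rep α (Fin p × α) n p where
  A := fun σ => √(pr σ) • B.A σ
  B := fun jσ i => ((√(pr jσ.2))⁻¹ • (B.A jσ.2 * P jσ.2 * B.C.transpose +
    B.K jσ.2 * covU μ u B.v jσ.2 * B.D.transpose)) i jσ.1
  C := B.C

/-! ### Restricted switching -/

variable [MeasurableSpace α]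

/-- `θ` is a stationary Markov process with values in the finite set `α` and transition
probabilities `P(θ(t+1) = b ∣ θ(t) = a) = p_b` if `(a, b) ∈ S`, and `0` if `(a, b) ∉ S`. -/
structure IsRestrictedSwitching (μ : Measure Ω) (pr : α → ℝ) (S : Set (α × α))
    (θ : ℤ → Ω → α) : Prop where
  pos : ∀ σ, 0 < pr σ
  meas : ∀ t, Measurable (θ t)
  stationary : ∀ s : ℤ, μ.map (fun ω (t : ℤ) => θ (t + s) ω) = μ.map (fun ω (t : ℤ) => θ t ω)
  markov : ∀ (t : ℤ) (b : α),
    μ[(θ (t + 1) ⁻¹' {b}).indicator (fun _ => (1 : ℝ)) | sigmaGen θ (Set.Iic t)] =ᵐ[μ]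
      μ[(θ (t + 1) ⁻¹' {b}).indicator (fun _ => (1 : ℝ)) | sigmaGen θ {t}]
  trans_mem : ∀ (t : ℤ) (a b : α), μ (θ t ⁻¹' {a}) ≠ 0 → (a, b) ∈ S →
    (ProbabilityTheory.cond μ (θ t ⁻¹' {a})).real (θ (t + 1) ⁻¹' {b}) = pr b
  trans_not_mem : ∀ (t : ℤ) (a b : α), μ (θ t ⁻¹' {a}) ≠ 0 → (a, b) ∉ S →
    (ProbabilityTheory.cond μ (θ t ⁻¹' {a})).real (θ (t + 1) ⁻¹' {b}) = 0

/-- The input process `u_σ(t) = χ(θ(t) = σ)`. -/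
def switchInput (θ : ℤ → Ω → α) (σ : α) (t : ℤ) : Ω → ℝ :=
  (θ t ⁻¹' {σ}).indicator (fun _ => 1)

/-- `B` is a jump-Markov linear system with restricted switching, with switching process `θ`. -/
structure GBS.IsJMLSRS (B : GBS Ω α n m p) (μ : Measure Ω) (pr : α → ℝ) (S : Set (α × α))
    (θ : ℤ → Ω → α) : Prop where
  system : B.IsSystem μ (switchInput θ)
  noise_wss : JointWSS μ pr (switchInput θ) B.v
  noise_uncorr : ∀ l t : ℤ, l < t → ∀ i j,
    μ[fun ω => B.v t ω i * B.v l ω j | sigmaGen θ (Set.Ico l t)] =ᵐ[μ] 0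
  noise_condIndep : ∀ t : ℤ, CondIndepSigma μ (sigmaGen θ (Set.Iio t))
    (sigmaGen θ (Set.Ici t)) (sigmaGen B.v (Set.Iic t))
  noise_driven : B.NoiseDriven μ pr (switchInput θ)
  stable : B.Stable pr
  compatible : B.SwitchCompatible μ pr S (switchInput θ)

/-- `B` is a minimal JMLSRS realization of `y`: it has the least state dimension among all
JMLSRS realizations of `y` (of any noise dimension). -/
def GBS.IsMinimalJMLSRS (B : GBS Ω α n m p) (μ : Measure Ω) (pr : α → ℝ) (S : Set (α × α))
    (θ : ℤ → Ω → α) (y : ℤ → Ω → Fin p → ℝ) : Prop :=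
  B.IsJMLSRS μ pr S θ ∧ B.Realizes μ y ∧
    ∀ (n' m' : ℕ) (B' : GBS Ω α n' m' p), B'.IsJMLSRS μ pr S θ → B'.Realizes μ y → n ≤ n'

/-- The assumption on the output process `y`. -/
structure OutputAssumption (μ : Measure Ω) (pr : α → ℝ) (θ : ℤ → Ω → α)
    (y : ℤ → Ω → Fin p → ℝ) : Prop where
  wss : JointWSS μ pr (switchInput θ) y
  condIndep : ∀ t : ℤ, CondIndepSigma μ (sigmaGen θ (Set.Iio t))
    (sigmaGen y (Set.Iic t)) (sigmaGen θ (Set.Ici t))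
  squareSummable : IsSquareSummable (PsiFamily μ pr (switchInput θ) y)
  rational : IsRational (PsiFamily μ pr (switchInput θ) y)

/-- The system built from a representation `R`, gains `K`, a state process `x` and a noise process
`e`: `x(t+1) = ∑_σ (A_σ x(t) / √p_σ + K_σ e(t)) u_σ(t)`, `y(t) = C x(t) + e(t)`. -/
def innovationSystem (pr : α → ℝ) (R : Rep α (Fin p × α) n p)
    (K : α → Matrix (Fin n) (Fin p) ℝ) (x : ℤ → Ω → Fin n → ℝ) (e : ℤ → Ω → Fin p → ℝ) :
    GBS Ω α n p p where
  A := fun σ => (√(pr σ))⁻¹ • R.A σ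
  K := K
  C := R.C
  D := 1
  x := x
  v := e

/-- `x(t) = E_l[G Y_n(t) ∣ {z_w(t) ∣ w ∈ Σ⁺}]`, where `Y_n(t)` stacks the variables `z^f_w(t)`,
`|w| ≤ n - 1`. -/
def IsInnovationState (μ : Measure Ω) (pr : α → ℝ) (u : α → ℤ → Ω → ℝ)
    (y : ℤ → Ω → Fin p → ℝ) (G : Matrix (Fin n) (ShortWord α n × Fin p) ℝ)
    (x : ℤ → Ω → Fin n → ℝ) : Prop :=
  ∀ t i, IsLinProj μ (zEntries pr u y t)
    (fun ω => G.mulVec (fun s => zFuture pr u y s.1.toList t ω s.2) i) (fun ω => x t ω i)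

/-- `p_σ T_{σ,σ} - C P_σ Cᵀ` with `P_σ = E[x(t) x(t)ᵀ u_σ(t)²]`. -/
def gainDenom (μ : Measure Ω) (pr : α → ℝ) (u : α → ℤ → Ω → ℝ)
    (y : ℤ → Ω → Fin p → ℝ) (R : Rep α (Fin p × α) n p) (x : ℤ → Ω → Fin n → ℝ) (σ : α) :
    Matrix (Fin p) (Fin p) ℝ :=
  pr σ • covT μ pr u y [σ] [σ] - R.C * covU μ u x σ * R.C.transpose

/-- `√p_σ B_σ - A_σ P_σ Cᵀ / √p_σ` with `P_σ = E[x(t) x(t)ᵀ u_σ(t)²]`, where `B_σ` has the columns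
`B_{(1,σ)}, …, B_{(p,σ)}`. -/
def gainNum (μ : Measure Ω) (pr : α → ℝ) (u : α → ℤ → Ω → ℝ)
    (R : Rep α (Fin p × α) n p) (x : ℤ → Ω → Fin n → ℝ) (σ : α) :
    Matrix (Fin n) (Fin p) ℝ :=
  √(pr σ) • Matrix.of (fun i j => R.B (j, σ) i)
    - (√(pr σ))⁻¹ • (R.A σ * covU μ u x σ * R.C.transpose)

end Prob

end

end JMLSRS

namespace JMLSRS

section Rep

variable {α J : Type*} {n n' p : ℕ}

theorem wordMat_append (A : α → Matrix (Fin n) (Fin n) ℝ) (v w : List α) :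
    wordMat A (v ++ w) = wordMat A w * wordMat A v := by
  induction v with
  | nil => simp [wordMat]
  | cons σ v ih => simp [wordMat, ih, Matrix.mul_assoc]

theorem wordMat_append_singleton (A : α → Matrix (Fin n) (Fin n) ℝ) (w : List α) (σ : α) :
    wordMat A (w ++ [σ]) = A σ * wordMat A w := by
  simp [wordMat_append, wordMat]

/-- The map sending a state to the function `w ↦ C A_w ξ`. -/
def Rep.obs (R : Rep α J n p) : (Fin n → ℝ) →ₗ[ℝ] (List α → Fin p → ℝ) :=
  LinearMap.pi fun w => (R.C * wordMat R.A w).mulVecLin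

theorem Rep.obs_apply (R : Rep α J n p) (ξ : Fin n → ℝ) (w : List α) :
    R.obs ξ w = (R.C * wordMat R.A w).mulVec ξ := rfl

/-- The span of the reachable states `A_w B_j`. -/
def Rep.reach (R : Rep α J n p) : Submodule ℝ (Fin n → ℝ) :=
  Submodule.span ℝ (Set.range fun q : J × List α => (wordMat R.A q.2).mulVec (R.B q.1))

/-- The span of all shifts of the power series in the family. -/
def shiftSpan (Ψ : J → List α → Fin p → ℝ) : Submodule ℝ (List α → Fin p → ℝ) :=
  Submodule.span ℝ (Set.range fun q : J × List α => fun w => Ψ q.1 (q.2 ++ w))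

/-- The shift of functions on words. -/
def shiftMap (p : ℕ) (σ : α) : (List α → Fin p → ℝ) →ₗ[ℝ] (List α → Fin p → ℝ) :=
  LinearMap.funLeft ℝ (Fin p → ℝ) fun w => σ :: w

theorem shiftMap_apply (σ : α) (f : List α → Fin p → ℝ) (w : List α) :
    shiftMap p σ f w = f (σ :: w) := rfl

theorem shiftMap_mem (Ψ : J → List α → Fin p → ℝ) (σ : α) {f : List α → Fin p → ℝ}
    (hf : f ∈ shiftSpan Ψ) : shiftMap p σ f ∈ shiftSpan Ψ := by
  have : shiftSpan Ψ ≤ (shiftSpan Ψ).comap (shiftMap p σ) := by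
    refine Submodule.span_le.2 ?_
    rintro _ ⟨⟨j, v⟩, rfl⟩
    refine Submodule.subset_span ⟨(j, v ++ [σ]), ?_⟩
    funext w
    simp [shiftMap_apply]
  exact this hf

theorem Rep.shiftMap_obs (R : Rep α J n p) (σ : α) (ξ : Fin n → ℝ) :
    shiftMap p σ (R.obs ξ) = R.obs ((R.A σ).mulVec ξ) := by
  funext w
  simp [shiftMap_apply, Rep.obs_apply, wordMat, Matrix.mul_assoc, Matrix.mulVec_mulVec]

theorem Rep.Represents.obs_reach {R : Rep α J n p} {Ψ : J → List α → Fin p → ℝ}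
    (h : R.Represents Ψ) (j : J) (v : List α) :
    R.obs ((wordMat R.A v).mulVec (R.B j)) = fun w => Ψ j (v ++ w) := by
  funext w
  rw [h j, Rep.obs_apply, wordMat_append, Matrix.mulVec_mulVec, Matrix.mul_assoc]

theorem Rep.Represents.map_reach {R : Rep α J n p} {Ψ : J → List α → Fin p → ℝ}
    (h : R.Represents Ψ) : R.reach.map R.obs = shiftSpan Ψ := by
  rw [Rep.reach, Submodule.map_span, ← Set.range_comp, shiftSpan]
  congr 2
  funext q
  exact h.obs_reach q.1 q.2

/-- A representation on an arbitrary finite dimensional space can be written in coordinates. -/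
theorem exists_rep_of_linear {Ψ : J → List α → Fin p → ℝ} (V : Type*) [AddCommGroup V]
    [Module ℝ V] [FiniteDimensional ℝ V] (a : α → V →ₗ[ℝ] V) (b : J → V)
    (c : V →ₗ[ℝ] (Fin p → ℝ))
    (h : ∀ j w, Ψ j w = c (w.foldl (fun x σ => a σ x) (b j))) :
    ∃ R : Rep α J (Module.finrank ℝ V) p, R.Represents Ψ := by
  let β := Module.finBasis ℝ V
  let R : Rep α J (Module.finrank ℝ V) p :=
    { A := fun σ => LinearMap.toMatrix β β (a σ)
      B := fun j => β.repr (b j)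
      C := LinearMap.toMatrix β (Pi.basisFun ℝ (Fin p)) c }
  have key : ∀ (w : List α) (x : V), (wordMat R.A w).mulVec (β.repr x) =
      β.repr (w.foldl (fun x σ => a σ x) x) := by
    intro w
    induction w with
    | nil => intro x; simp [wordMat]
    | cons σ w ih =>
      intro x
      rw [wordMat, ← Matrix.mulVec_mulVec]
      have : (R.A σ).mulVec (β.repr x) = β.repr (a σ x) := LinearMap.toMatrix_mulVec_repr β β _ _
      rw [this, ih]
      rfl
  refine ⟨R, fun j w => ?_⟩
  rw [h, ← Matrix.mulVec_mulVec]
  change _ = R.C.mulVec ((wordMat R.A w).mulVec (β.repr (b j)))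
  rw [key]
  have := LinearMap.toMatrix_mulVec_repr β (Pi.basisFun ℝ (Fin p)) c
    (w.foldl (fun x σ => a σ x) (b j))
  rw [this]
  rfl

theorem exists_rep_shiftSpan (Ψ : J → List α → Fin p → ℝ)
    [FiniteDimensional ℝ (shiftSpan Ψ)] :
    ∃ R : Rep α J (Module.finrank ℝ (shiftSpan Ψ)) p, R.Represents Ψ := by
  refine exists_rep_of_linear (shiftSpan Ψ)
    (fun σ => (shiftMap p σ).restrict fun f hf => shiftMap_mem Ψ σ hf)
    (fun j => ⟨Ψ j, Submodule.subset_span ⟨(j, []), by simp⟩⟩)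
    ((LinearMap.proj []).comp (shiftSpan Ψ).subtype) ?_
  have key : ∀ (w v : List α) (f : shiftSpan Ψ),
      ((w.foldl (fun x σ => ((shiftMap p σ).restrict fun f hf => shiftMap_mem Ψ σ hf) x) f :
        shiftSpan Ψ) : List α → Fin p → ℝ) v = (f : List α → Fin p → ℝ) (w ++ v) := by
    intro w
    induction w with
    | nil => intro v f; rfl
    | cons σ w ih =>
      intro v f
      rw [List.foldl_cons, ih]
      rfl
  intro j w
  have := key w [] ⟨Ψ j, Submodule.subset_span ⟨(j, []), by simp⟩⟩
  simp only [List.append_nil] at this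
  exact this.symm

theorem IsRational.exists_isMinimal {Ψ : J → List α → Fin p → ℝ} (h : IsRational Ψ) :
    ∃ (n : ℕ) (R : Rep α J n p), R.IsMinimal Ψ := by
  classical
  obtain ⟨R, hR⟩ := Nat.find_spec h
  exact ⟨Nat.find h, R, hR, fun n' R' hR' => Nat.find_min' h ⟨R', hR'⟩⟩

namespace Rep.IsMinimal

variable {R : Rep α J n p} {Ψ : J → List α → Fin p → ℝ}

theorem le_finrank_shiftSpan (h : R.IsMinimal Ψ) :
    n ≤ Module.finrank ℝ (R.reach.map R.obs) := by
  have hm := h.1.map_reach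
  have : FiniteDimensional ℝ (shiftSpan Ψ) := by rw [← hm]; infer_instance
  obtain ⟨R', hR'⟩ := exists_rep_shiftSpan Ψ
  rw [hm]
  exact h.2 _ R' hR'

theorem reach_eq_top (h : R.IsMinimal Ψ) : R.reach = ⊤ := by
  have h1 := h.le_finrank_shiftSpan.trans (Submodule.finrank_map_le R.obs R.reach)
  refine Submodule.eq_top_of_finrank_eq (le_antisymm (Submodule.finrank_le _) ?_)
  simpa using h1

theorem obs_injective (h : R.IsMinimal Ψ) : Function.Injective R.obs := by
  have h1 := h.le_finrank_shiftSpan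
  rw [h.reach_eq_top, Submodule.map_top] at h1
  have h2 := LinearMap.finrank_range_add_finrank_ker R.obs
  simp only [Module.finrank_fin_fun] at h2
  rw [← LinearMap.ker_eq_bot, ← Submodule.finrank_eq_zero (R := ℝ)]
  omega

theorem range_obs (h : R.IsMinimal Ψ) : LinearMap.range R.obs = shiftSpan Ψ := by
  rw [← h.1.map_reach, h.reach_eq_top, Submodule.map_top]

theorem obs_B (h : R.IsMinimal Ψ) (j : J) : R.obs (R.B j) = Ψ j := by
  simpa [wordMat] using h.1.obs_reach j []

/-- Two minimal representations of the same family are isomorphic. -/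
theorem isomorphic {R' : Rep α J n' p} (h : R.IsMinimal Ψ) (h' : R'.IsMinimal Ψ) :
    R.Isomorphic R' := by
  have hnn : n = n' := le_antisymm (h.2 _ _ h'.1) (h'.2 _ _ h.1)
  subst hnn
  have hex : ∀ ξ' : Fin n → ℝ, ∃ ξ, R.obs ξ = R'.obs ξ' := by
    intro ξ'
    have : R'.obs ξ' ∈ LinearMap.range R.obs := by
      rw [h.range_obs, ← h'.range_obs]; exact ⟨ξ', rfl⟩
    exact this
  choose T hT using hex
  let L : (Fin n → ℝ) →ₗ[ℝ] (Fin n → ℝ) :=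
    { toFun := T
      map_add' := fun a b => h.obs_injective (by simp [hT])
      map_smul' := fun c a => h.obs_injective (by simp [hT]) }
  have hL : ∀ ξ, R.obs (L ξ) = R'.obs ξ := hT
  have hLinj : Function.Injective L := fun a b hab => h'.obs_injective (by rw [← hL, ← hL, hab])
  let M := LinearMap.toMatrix' L
  have hM : ∀ ξ, M.mulVec ξ = L ξ := fun ξ => by
    rw [← Matrix.toLin'_apply, Matrix.toLin'_toMatrix']
  have hunit : IsUnit M := Matrix.mulVec_injective_iff_isUnit.1 fun a b hab => hLinj (by
    rw [← hM, ← hM]; exact hab)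
  have hdet : IsUnit M.det := (Matrix.isUnit_iff_isUnit_det M).1 hunit
  refine ⟨M, M⁻¹, Matrix.mul_nonsing_inv M hdet, Matrix.nonsing_inv_mul M hdet, fun σ => ?_,
    fun j => ?_, ?_⟩
  · refine Matrix.ext_of_mulVec_single fun i => ?_
    rw [← Matrix.mulVec_mulVec, ← Matrix.mulVec_mulVec]
    refine h.obs_injective ?_
    rw [hM, hM, hL, ← R.shiftMap_obs, hL, R'.shiftMap_obs]
  · refine h.obs_injective ?_
    rw [hM, hL, h.obs_B, h'.obs_B]
  · refine Matrix.ext_of_mulVec_single fun i => ?_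
    have := congrFun (hL (Pi.single i 1)) []
    rw [R.obs_apply, R'.obs_apply] at this
    simp only [wordMat, Matrix.mul_one] at this
    rw [← Matrix.mulVec_mulVec, hM, this]

end Rep.IsMinimal

/-- The states which are not observed by words of length less than `k`. -/
def Rep.unobs (R : Rep α J n p) (k : ℕ) : Submodule ℝ (Fin n → ℝ) :=
  ⨅ (w : List α) (_ : w.length < k), LinearMap.ker (R.C * wordMat R.A w).mulVecLin

theorem Rep.mem_unobs {R : Rep α J n p} {k : ℕ} {ξ : Fin n → ℝ} :
    ξ ∈ R.unobs k ↔ ∀ w : List α, w.length < k → R.obs ξ w = 0 := by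
  simp [Rep.unobs, Submodule.mem_iInf, Rep.obs_apply]

theorem Rep.unobs_antitone (R : Rep α J n p) : Antitone R.unobs := by
  intro k l hkl ξ hξ
  rw [Rep.mem_unobs] at hξ ⊢
  exact fun w hw => hξ w (hw.trans_le hkl)

theorem Rep.mem_unobs_succ_succ {R : Rep α J n p} {k : ℕ} {ξ : Fin n → ℝ} :
    ξ ∈ R.unobs (k + 1) ↔ R.obs ξ [] = 0 ∧ ∀ σ, (R.A σ).mulVec ξ ∈ R.unobs k := by
  simp only [Rep.mem_unobs]
  constructor
  · intro h
    refine ⟨h [] (by simp), fun σ w hw => ?_⟩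
    rw [← R.shiftMap_obs, shiftMap_apply]
    exact h _ (by simpa using hw)
  · rintro ⟨h0, h1⟩ w hw
    cases w with
    | nil => exact h0
    | cons σ w =>
      have := h1 σ w (by simpa using hw)
      rwa [← R.shiftMap_obs, shiftMap_apply] at this

theorem Rep.unobs_eq_bot_of_eq_succ {R : Rep α J n p} (hR : Function.Injective R.obs) {k : ℕ}
    (h : R.unobs (k + 1) = R.unobs k) : R.unobs k = ⊥ := by
  have hstep : ∀ d, R.unobs (k + d) = R.unobs k := by
    intro d
    induction d with
    | zero => rfl
    | succ d ih =>
      rw [← h, ← add_assoc]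
      ext ξ
      rw [Rep.mem_unobs_succ_succ, Rep.mem_unobs_succ_succ, ih]
  refine (Submodule.eq_bot_iff _).2 fun ξ hξ => hR ?_
  rw [map_zero]
  funext w
  rw [← hstep (w.length + 1), Rep.mem_unobs] at hξ
  exact hξ w (by omega)

theorem Rep.unobs_eq_bot {R : Rep α J n p} (hR : Function.Injective R.obs) : R.unobs n = ⊥ := by
  have key : ∀ k, R.unobs k = ⊥ ∨ Module.finrank ℝ (R.unobs k) + k ≤ n := by
    intro k
    induction k with
    | zero => right; simpa using Submodule.finrank_le (R.unobs 0)
    | succ k ih =>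
      by_cases hk : R.unobs k = ⊥
      · left
        exact le_bot_iff.1 (hk ▸ R.unobs_antitone (Nat.le_succ k))
      · right
        have hle := ih.resolve_left hk
        have hlt : R.unobs (k + 1) < R.unobs k :=
          lt_of_le_of_ne (R.unobs_antitone (Nat.le_succ k))
            fun h => hk (Rep.unobs_eq_bot_of_eq_succ hR h)
        have := Submodule.finrank_lt_finrank_of_lt hlt
        omega
  rcases key n with h | h
  · exact h
  · exact Submodule.finrank_eq_zero.1 (by omega)

/-- The observability matrix of an observable representation has a left inverse. -/
theorem Rep.exists_leftInverse_obsMatrix [Fintype α] {R : Rep α J n p}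
    (hR : Function.Injective R.obs) :
    ∃ G : Matrix (Fin n) (ShortWord α n × Fin p) ℝ, G * R.obsMatrix = 1 := by
  classical
  have hker : LinearMap.ker R.obsMatrix.mulVecLin = ⊥ := by
    refine (Submodule.eq_bot_iff _).2 fun ξ hξ => ?_
    have : ξ ∈ R.unobs n := by
      rw [Rep.mem_unobs]
      intro w hw
      funext i
      have h1 := congrFun (LinearMap.mem_ker.1 hξ) (⟨⟨w.length, hw⟩, fun i => w.get i⟩, i)
      have h2 : ShortWord.toList (n := n) ⟨⟨w.length, hw⟩, fun i => w.get i⟩ = w :=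
        List.ofFn_get w
      simp only [Matrix.mulVecLin_apply, Matrix.mulVec, dotProduct, Rep.obsMatrix, Matrix.of_apply,
        h2] at h1
      exact h1
    rwa [Rep.unobs_eq_bot hR] at this
  obtain ⟨g, hg⟩ := LinearMap.exists_leftInverse_of_injective _ hker
  refine ⟨LinearMap.toMatrix' g, ?_⟩
  have := congrArg LinearMap.toMatrix' hg
  rw [LinearMap.toMatrix'_comp, LinearMap.toMatrix'_id] at this
  rwa [← Matrix.toLin'_apply', LinearMap.toMatrix'_toLin'] at this

end Rep
end JMLSRS

namespace JMLSRS

section WordSum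

variable {α : Type*} [Fintype α]

/-- The sum of `f w` over the words `w` of length `k`. -/
def wordSum {β : Type*} [AddCommMonoid β] (k : ℕ) (f : List α → β) : β :=
  ∑ g : Fin k → α, f (List.ofFn g)

theorem wordSum_zero {β : Type*} [AddCommMonoid β] (f : List α → β) : wordSum 0 f = f [] := by
  simp [wordSum]

theorem wordSum_succ {β : Type*} [AddCommMonoid β] (k : ℕ) (f : List α → β) :
    wordSum (k + 1) f = ∑ σ, wordSum k fun w => f (σ :: w) := by
  unfold wordSum
  rw [← (Fin.consEquiv fun _ : Fin (k + 1) => α).sum_comp, Fintype.sum_prod_type]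
  simp [Fin.consEquiv]

theorem summable_iff_summable_wordSum {f : List α → ℝ} (hf : ∀ w, 0 ≤ f w) :
    Summable f ↔ Summable fun k => wordSum k f := by
  have h1 := summable_sigma_of_nonneg (f := f ∘ List.equivSigmaTuple.symm) fun _ => hf _
  rw [List.equivSigmaTuple.symm.summable_iff] at h1
  simp only [tsum_fintype] at h1
  exact h1.trans ⟨fun h => h.2, fun h => ⟨fun k => Summable.of_finite, h⟩⟩

theorem tendsto_wordSum {f : List α → ℝ} (hf : ∀ w, 0 ≤ f w) (h : Summable f) :
    Filter.Tendsto (fun k => wordSum k f) Filter.atTop (nhds 0) :=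
  ((summable_iff_summable_wordSum hf).1 h).tendsto_atTop_zero

end WordSum

section Stability

variable {α : Type*} [Fintype α] {n : ℕ}

/-- The matrix `∑_σ F_σᵀ ⊗ F_σᵀ`. -/
def kronSum (F : α → Matrix (Fin n) (Fin n) ℝ) : Matrix (Fin n × Fin n) (Fin n × Fin n) ℝ :=
  ∑ σ, (F σ).transpose ⊗ₖ (F σ).transpose

theorem kronSum_pow (F : α → Matrix (Fin n) (Fin n) ℝ) (k : ℕ) :
    kronSum F ^ k = wordSum k fun w => (wordMat F w).transpose ⊗ₖ (wordMat F w).transpose := by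
  induction k with
  | zero => simp [wordSum_zero, wordMat]
  | succ k ih =>
    rw [pow_succ', ih, wordSum_succ, kronSum, Finset.sum_mul]
    refine Finset.sum_congr rfl fun σ _ => ?_
    simp only [wordSum, Finset.mul_sum, wordMat, Matrix.transpose_mul, Matrix.mul_kronecker_mul]

theorem kronSum_pow_apply (F : α → Matrix (Fin n) (Fin n) ℝ) (k : ℕ) (i i' j j' : Fin n) :
    (kronSum F ^ k) (i, i') (j, j') = wordSum k fun w => wordMat F w j i * wordMat F w j' i' := by
  rw [kronSum_pow, wordSum, Matrix.sum_apply]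
  rfl

/-- All eigenvalues of `∑_σ F_σᵀ ⊗ F_σᵀ` lie in the open unit disk. -/
def KronStable (F : α → Matrix (Fin n) (Fin n) ℝ) : Prop :=
  ∀ z ∈ spectrum ℂ ((kronSum F).map (fun a : ℝ => (a : ℂ))), ‖z‖ < 1

theorem map_pow_apply {ι : Type*} [Fintype ι] [DecidableEq ι] (M : Matrix ι ι ℝ) (k : ℕ) (a b : ι) :
    ((M.map (fun a : ℝ => (a : ℂ))) ^ k) a b = ((M ^ k) a b : ℝ) := by
  have := map_pow (Complex.ofRealHom.mapMatrix (m := ι)) M k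
  exact (congrFun (congrFun this a) b).symm

open Filter in
theorem summable_norm_pow_of_spectrum {A : Type*} [NormedRing A] [NormedAlgebra ℂ A]
    [CompleteSpace A] [Nontrivial A] (a : A) (h : ∀ z ∈ spectrum ℂ a, ‖z‖ < 1) :
    Summable fun k : ℕ => ‖a ^ k‖ := by
  have h1 : spectralRadius ℂ a < 1 := by
    exact_mod_cast spectrum.spectralRadius_lt_of_forall_lt_of_nonempty
      (spectrum.nonempty a) (r := 1) fun z hz => by exact_mod_cast h z hz
  obtain ⟨r, hr1, hr2⟩ := ENNReal.lt_iff_exists_nnreal_btwn.1 h1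
  have hr2' : (r : ℝ) < 1 := by exact_mod_cast hr2
  have hev := (spectrum.pow_nnnorm_pow_one_div_tendsto_nhds_spectralRadius a).eventually_lt_const hr1
  have hg := summable_geometric_of_lt_one r.2 hr2'
  refine summable_of_isBigO_nat hg (Asymptotics.IsBigO.of_bound 1 ?_)
  filter_upwards [hev, eventually_gt_atTop 0] with k hk hk0
  have h2 : (‖a ^ k‖₊ : ENNReal) ≤ (r : ENNReal) ^ k := by
    have := ENNReal.rpow_le_rpow hk.le (Nat.cast_nonneg k : (0 : ℝ) ≤ k)
    rwa [← ENNReal.rpow_mul, one_div, inv_mul_cancel₀ (by positivity), ENNReal.rpow_one,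
      ENNReal.rpow_natCast] at this
  have h3 : ‖a ^ k‖₊ ≤ r ^ k := by exact_mod_cast h2
  have h4 : ‖a ^ k‖ ≤ (r : ℝ) ^ k := by exact_mod_cast h3
  simpa using h4

attribute [local instance] Matrix.linftyOpNormedRing Matrix.linftyOpNormedAlgebra
  Matrix.linftyOpNormedAddCommGroup Matrix.linftyOpNormedSpace in
theorem norm_apply_le_linfty {ι : Type*} [Fintype ι] [DecidableEq ι] (M : Matrix ι ι ℂ) (a b : ι) :
    ‖M a b‖ ≤ ‖M‖ := by
  rw [Matrix.linfty_opNorm_def]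
  have h1 : ‖M a b‖₊ ≤ ∑ j, ‖M a j‖₊ :=
    Finset.single_le_sum (f := fun j => ‖M a j‖₊) (fun _ _ => zero_le) (Finset.mem_univ b)
  have h2 := Finset.le_sup (f := fun i => ∑ j, ‖M i j‖₊) (Finset.mem_univ a)
  exact_mod_cast h1.trans h2

attribute [local instance] Matrix.linftyOpNormedRing Matrix.linftyOpNormedAlgebra
  Matrix.linftyOpNormedAddCommGroup Matrix.linftyOpNormedSpace in
theorem KronStable.summable_pow_apply {F : α → Matrix (Fin n) (Fin n) ℝ} (h : KronStable F)
    (a b : Fin n × Fin n) : Summable fun k : ℕ => |(kronSum F ^ k) a b| := by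
  have : Nonempty (Fin n × Fin n) := ⟨a⟩
  have := summable_norm_pow_of_spectrum _ h
  refine this.of_nonneg_of_le (fun _ => abs_nonneg _) fun k => ?_
  have h1 := norm_apply_le_linfty ((kronSum F).map (fun a : ℝ => (a : ℂ)) ^ k) a b
  rw [map_pow_apply, Complex.norm_real] at h1
  exact h1

theorem KronStable.summable_wordMat {F : α → Matrix (Fin n) (Fin n) ℝ} (h : KronStable F)
    (i j : Fin n) : Summable fun w : List α => wordMat F w i j ^ 2 := by
  rw [summable_iff_summable_wordSum fun w => sq_nonneg _]
  have := (h.summable_pow_apply (j, j) (i, i)).of_abs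
  simpa only [kronSum_pow_apply, ← sq] using this

theorem tendsto_kronSum_pow_apply {F : α → Matrix (Fin n) (Fin n) ℝ}
    (h : ∀ i j, Summable fun w : List α => wordMat F w i j ^ 2) (a b : Fin n × Fin n) :
    Filter.Tendsto (fun k : ℕ => (kronSum F ^ k) a b) Filter.atTop (nhds 0) := by
  obtain ⟨i, i'⟩ := a
  obtain ⟨j, j'⟩ := b
  refine squeeze_zero_norm (fun k => ?_)
    ((tendsto_wordSum (fun w => sq_nonneg _) (h j i)).add
      (tendsto_wordSum (fun w => sq_nonneg _) (h j' i')) |>.trans (by simp))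
  rw [kronSum_pow_apply, wordSum, wordSum, wordSum, ← Finset.sum_add_distrib]
  refine (norm_sum_le _ _).trans (Finset.sum_le_sum fun w _ => ?_)
  rw [Real.norm_eq_abs, abs_le]
  constructor <;> nlinarith [sq_nonneg (wordMat F (List.ofFn w) j i + wordMat F (List.ofFn w) j' i'),
    sq_nonneg (wordMat F (List.ofFn w) j i - wordMat F (List.ofFn w) j' i')]

theorem kronStable_of_summable {F : α → Matrix (Fin n) (Fin n) ℝ}
    (h : ∀ i j, Summable fun w : List α => wordMat F w i j ^ 2) : KronStable F := by
  intro z hz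
  rw [← Matrix.spectrum_toLin', ← Module.End.hasEigenvalue_iff_mem_spectrum] at hz
  obtain ⟨v, hv⟩ := hz.exists_hasEigenvector
  obtain ⟨a, ha⟩ : ∃ a, v a ≠ 0 := Function.ne_iff.1 hv.2
  have h1 : ∀ k : ℕ, z ^ k * v a =
      ∑ b, (((kronSum F ^ k) a b : ℝ) : ℂ) * v b := by
    intro k
    have := congrFun (hv.pow_apply k) a
    rw [← Matrix.toLin'_pow, Matrix.toLin'_apply] at this
    simp only [Matrix.mulVec, dotProduct, map_pow_apply] at this
    simpa using this.symm
  have h2 : Filter.Tendsto (fun k : ℕ => z ^ k * v a) Filter.atTop (nhds 0) := by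
    simp only [h1]
    have : Filter.Tendsto (fun k : ℕ => ∑ b, (((kronSum F ^ k) a b : ℝ) : ℂ) * v b)
        Filter.atTop (nhds (∑ b, ((0 : ℝ) : ℂ) * v b)) :=
      tendsto_finsetSum _ fun b _ => Filter.Tendsto.mul_const _
        ((Complex.continuous_ofReal.tendsto 0).comp (tendsto_kronSum_pow_apply h a b))
    simpa using this
  have h3 : Filter.Tendsto (fun k : ℕ => z ^ k) Filter.atTop (nhds 0) := by
    have := h2.mul_const (v a)⁻¹
    simpa [mul_assoc, mul_inv_cancel₀ ha] using this
  exact tendsto_pow_atTop_nhds_zero_iff_norm_lt_one.1 h3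

/-- Under stability, the only fixed point of `X ↦ ∑_σ F_σ X F_σᵀ` is zero. -/
theorem KronStable.eq_zero_of_fixed {F : α → Matrix (Fin n) (Fin n) ℝ} (h : KronStable F)
    {X : Matrix (Fin n) (Fin n) ℝ} (hX : X = ∑ σ, F σ * X * (F σ).transpose) : X = 0 := by
  let x : Fin n × Fin n → ℝ := fun a => X a.1 a.2
  have h1 : Matrix.vecMul x (kronSum F) = x := by
    funext b
    obtain ⟨j, j'⟩ := b
    change _ = X j j'
    rw [hX, Matrix.sum_apply]
    simp only [Matrix.vecMul, dotProduct, kronSum, Matrix.sum_apply, Finset.mul_sum]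
    rw [Finset.sum_comm]
    refine Finset.sum_congr rfl fun σ _ => ?_
    rw [Fintype.sum_prod_type, Finset.sum_comm, Matrix.mul_apply]
    refine Finset.sum_congr rfl fun i' _ => ?_
    rw [Matrix.mul_apply, Finset.sum_mul]
    refine Finset.sum_congr rfl fun i _ => ?_
    simp only [Matrix.kroneckerMap_apply, Matrix.transpose_apply, x]
    ring
  have h2 : ∀ k : ℕ, Matrix.vecMul x (kronSum F ^ k) = x := by
    intro k
    induction k with
    | zero => simp
    | succ k ih => rw [pow_succ, ← Matrix.vecMul_vecMul, ih, h1]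
  ext j j'
  have h3 : Filter.Tendsto (fun k : ℕ => Matrix.vecMul x (kronSum F ^ k) (j, j'))
      Filter.atTop (nhds (∑ a, x a * 0)) :=
    tendsto_finsetSum _ fun a _ => Filter.Tendsto.const_mul _
      (tendsto_kronSum_pow_apply h.summable_wordMat a (j, j'))
  simp only [h2, mul_zero, Finset.sum_const_zero] at h3
  exact tendsto_nhds_unique tendsto_const_nhds h3

end Stability

section RepStability

variable {α J : Type*} {n p : ℕ} {R : Rep α J n p} {Ψ : J → List α → Fin p → ℝ}

namespace Rep.IsMinimal

theorem mul_eq_zero (h : R.IsMinimal Ψ) {σ τ : α}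
    (h0 : ∀ j v w, Ψ j (v ++ σ :: τ :: w) = 0) : R.A τ * R.A σ = 0 := by
  have key : ∀ ξ ∈ R.reach, (R.A τ * R.A σ).mulVec ξ = 0 := by
    intro ξ hξ
    have hle : R.reach ≤ LinearMap.ker (R.A τ * R.A σ).mulVecLin := by
      refine Submodule.span_le.2 ?_
      rintro _ ⟨⟨j, v⟩, rfl⟩
      refine LinearMap.mem_ker.2 (h.obs_injective ?_)
      rw [map_zero, Matrix.mulVecLin_apply, Matrix.mulVec_mulVec]
      have : R.A τ * R.A σ * wordMat R.A v = wordMat R.A (v ++ [σ, τ]) := by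
        rw [wordMat_append]; simp [wordMat]
      rw [this, h.1.obs_reach]
      funext w
      simpa using h0 j v w
    exact hle hξ
  refine Matrix.ext_of_mulVec_single fun i => ?_
  rw [key _ (by rw [h.reach_eq_top]; trivial), Matrix.zero_mulVec]

theorem mulVec_eq_zero (h : R.IsMinimal Ψ) {τ : α} {j : J}
    (h0 : ∀ w, Ψ j (τ :: w) = 0) : (R.A τ).mulVec (R.B j) = 0 := by
  refine h.obs_injective ?_
  rw [map_zero, ← R.shiftMap_obs, h.obs_B]
  funext w
  exact h0 w

theorem summable_wordMat [Fintype α] (h : R.IsMinimal Ψ) (hΨ : IsSquareSummable Ψ) (i j : Fin n) :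
    Summable fun w : List α => wordMat R.A w i j ^ 2 := by
  obtain ⟨G, hG⟩ := Rep.exists_leftInverse_obsMatrix h.obs_injective
  let V : Submodule ℝ (Fin n → ℝ) :=
    { carrier := {ξ | ∀ i, Summable fun w : List α => (wordMat R.A w).mulVec ξ i ^ 2}
      zero_mem' := fun i => by simp
      add_mem' := by
        intro a b ha hb i
        refine (((ha i).add (hb i)).mul_left 2).of_nonneg_of_le (fun w => sq_nonneg _) fun w => ?_
        rw [Matrix.mulVec_add, Pi.add_apply]
        nlinarith [sq_nonneg ((wordMat R.A w).mulVec a i - (wordMat R.A w).mulVec b i)]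
      smul_mem' := by
        intro c a ha i
        simpa [Matrix.mulVec_smul, mul_pow] using (ha i).mul_left (c ^ 2) }
  have hV : R.reach ≤ V := by
    refine Submodule.span_le.2 ?_
    rintro _ ⟨⟨q, v⟩, rfl⟩ i
    set ξ := (wordMat R.A v).mulVec (R.B q)
    have h1 : ∀ w, (wordMat R.A w).mulVec ξ i = ∑ s, G i s * Ψ q (v ++ w ++ s.1.toList) s.2 := by
      intro w
      have h2 : (wordMat R.A w).mulVec ξ = (G * R.obsMatrix).mulVec ((wordMat R.A w).mulVec ξ) := by
        rw [hG, Matrix.one_mulVec]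
      rw [h2, ← Matrix.mulVec_mulVec]
      refine Finset.sum_congr rfl fun s _ => ?_
      congr 1
      change (R.C * wordMat R.A s.1.toList).mulVec ((wordMat R.A w).mulVec ξ) s.2 = _
      have h3 := h.1.obs_reach q (v ++ w)
      rw [wordMat_append, ← Matrix.mulVec_mulVec] at h3
      exact congrFun (congrFun h3 s.1.toList) s.2
    have h4 : ∀ s : ShortWord α n × Fin p,
        Summable fun w : List α => Ψ q (v ++ w ++ s.1.toList) s.2 ^ 2 := by
      intro s
      have hinj : Function.Injective fun w : List α => v ++ w ++ s.1.toList := fun a b hab => by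
        simpa using hab
      refine ((hΨ q).comp_injective hinj).of_nonneg_of_le (fun w => sq_nonneg _) fun w => ?_
      exact Finset.single_le_sum (f := fun i => Ψ q (v ++ w ++ s.1.toList) i ^ 2)
        (fun i _ => sq_nonneg _) (Finset.mem_univ s.2)
    have h5 : Summable fun w : List α => ∑ s : ShortWord α n × Fin p,
        (Ψ q (v ++ w ++ s.1.toList) s.2 ^ 2) := summable_sum fun s _ => h4 s
    refine (h5.mul_left (∑ s, G i s ^ 2)).of_nonneg_of_le (fun w => sq_nonneg _) fun w => ?_
    rw [h1]
    exact Finset.sum_mul_sq_le_sq_mul_sq _ _ _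
  have hmem : Pi.single j 1 ∈ V := hV (by rw [h.reach_eq_top]; trivial)
  simpa using hmem i

theorem kronStable [Fintype α] (h : R.IsMinimal Ψ) (hΨ : IsSquareSummable Ψ) : KronStable R.A :=
  kronStable_of_summable fun i j => h.summable_wordMat hΨ i j

end Rep.IsMinimal

theorem Rep.Represents.isSquareSummable [Fintype α] (h : R.Represents Ψ) (hR : KronStable R.A) :
    IsSquareSummable Ψ := by
  intro q
  refine summable_sum fun i _ => ?_
  have h1 : ∀ w, Ψ q w i = ∑ a : Fin n × Fin n, (R.C i a.1 * R.B q a.2) * wordMat R.A w a.1 a.2 := by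
    intro w
    rw [h, ← Matrix.mulVec_mulVec, Fintype.sum_prod_type]
    simp only [Matrix.mulVec, dotProduct, Finset.mul_sum]
    exact Finset.sum_congr rfl fun _ _ => Finset.sum_congr rfl fun _ _ => by ring
  have h2 : Summable fun w : List α => ∑ a : Fin n × Fin n, wordMat R.A w a.1 a.2 ^ 2 :=
    summable_sum fun a _ => hR.summable_wordMat _ _
  refine (h2.mul_left (∑ a : Fin n × Fin n, (R.C i a.1 * R.B q a.2) ^ 2)).of_nonneg_of_le
    (fun w => sq_nonneg _) fun w => ?_
  rw [h1]
  exact Finset.sum_mul_sq_le_sq_mul_sq _ _ _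

end RepStability

section CovEq

variable {α : Type*} [Fintype α] {n : ℕ}

/-- The stationary covariance equation has at most one solution. -/
theorem covEq_unique (pr : α → ℝ) (hpr : ∀ σ, 0 < pr σ) (A : α → Matrix (Fin n) (Fin n) ℝ)
    (adm : α → α → Prop) [∀ σ, DecidablePred fun a => adm a σ]
    (hA : ∀ a σ, ¬ adm a σ → A σ * A a = 0)
    (hst : KronStable fun σ => √(pr σ) • A σ) (N : α → Matrix (Fin n) (Fin n) ℝ)
    {P P' : α → Matrix (Fin n) (Fin n) ℝ}
    (hP : ∀ σ, P σ = pr σ • ∑ a with adm a σ, (A a * P a * (A a).transpose + N a))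
    (hP' : ∀ σ, P' σ = pr σ • ∑ a with adm a σ, (A a * P' a * (A a).transpose + N a)) :
    P = P' := by
  let D := fun σ => P σ - P' σ
  let Y := fun a => A a * D a * (A a).transpose
  have hD : ∀ σ, D σ = pr σ • ∑ a with adm a σ, Y a := by
    intro σ
    simp only [D, Y]
    rw [hP σ, hP' σ, ← smul_sub, ← Finset.sum_sub_distrib]
    congr 1
    refine Finset.sum_congr rfl fun a _ => ?_
    rw [add_sub_add_right_eq_sub, Matrix.mul_sub, Matrix.sub_mul]
  have hY : ∀ σ, Y σ = (√(pr σ) • A σ) * (∑ a, Y a) * (√(pr σ) • A σ).transpose := by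
    intro σ
    have h1 : A σ * ∑ a with adm a σ, Y a = A σ * ∑ a, Y a := by
      rw [Finset.mul_sum, Finset.mul_sum, Finset.sum_filter]
      refine Finset.sum_congr rfl fun a _ => ?_
      split_ifs with h
      · rfl
      · simp only [Y]
        rw [← Matrix.mul_assoc, ← Matrix.mul_assoc, hA a σ h, Matrix.zero_mul, Matrix.zero_mul]
    change A σ * D σ * (A σ).transpose = _
    rw [hD, Matrix.mul_smul, h1]
    simp only [Matrix.smul_mul, Matrix.mul_smul, Matrix.transpose_smul, smul_smul,
      Real.mul_self_sqrt (hpr σ).le]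
  have hX : ∑ a, Y a = 0 := hst.eq_zero_of_fixed (Finset.sum_congr rfl fun σ _ => hY σ)
  have hY0 : ∀ σ, Y σ = 0 := fun σ => by rw [hY, hX]; simp
  funext σ
  have : D σ = 0 := by rw [hD]; simp [hY0]
  exact sub_eq_zero.1 this

end CovEq
end JMLSRS

namespace JMLSRS

section Vectors

variable {E : Type*} [NormedAddCommGroup E] [InnerProductSpace ℝ E] {k l m n : ℕ}

/-- The matrix of inner products of two families of vectors. -/
def gram (f : Fin k → E) (g : Fin l → E) : Matrix (Fin k) (Fin l) ℝ :=
  Matrix.of fun i j => inner ℝ (f i) (g j)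

/-- A matrix acting on a family of vectors. -/
def matAct (A : Matrix (Fin k) (Fin l) ℝ) (f : Fin l → E) : Fin k → E :=
  fun i => ∑ j, A i j • f j

/-- An operator acting entrywise on a family of vectors. -/
def vmap (T : E →L[ℝ] E) (f : Fin k → E) : Fin k → E := fun i => T (f i)

theorem gram_apply (f : Fin k → E) (g : Fin l → E) (i j) : gram f g i j = inner ℝ (f i) (g j) := rfl

theorem gram_transpose (f : Fin k → E) (g : Fin l → E) : (gram f g).transpose = gram g f := by
  ext i j
  exact real_inner_comm _ _

theorem gram_matAct_left (A : Matrix (Fin m) (Fin k) ℝ) (f : Fin k → E) (g : Fin l → E) :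
    gram (matAct A f) g = A * gram f g := by
  ext i j
  simp [gram, matAct, Matrix.mul_apply, sum_inner, real_inner_smul_left]

theorem gram_matAct_right (A : Matrix (Fin m) (Fin l) ℝ) (f : Fin k → E) (g : Fin l → E) :
    gram f (matAct A g) = gram f g * A.transpose := by
  rw [← gram_transpose, gram_matAct_left, Matrix.transpose_mul, gram_transpose]

theorem gram_add_left (f f' : Fin k → E) (g : Fin l → E) :
    gram (f + f') g = gram f g + gram f' g := by
  ext i j
  simp [gram, inner_add_left]

theorem gram_add_right (f : Fin k → E) (g g' : Fin l → E) :
    gram f (g + g') = gram f g + gram f g' := by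
  ext i j
  simp [gram, inner_add_right]

theorem gram_sub_left (f f' : Fin k → E) (g : Fin l → E) :
    gram (f - f') g = gram f g - gram f' g := by
  ext i j
  simp [gram, inner_sub_left]

theorem gram_sub_right (f : Fin k → E) (g g' : Fin l → E) :
    gram f (g - g') = gram f g - gram f g' := by
  ext i j
  simp [gram, inner_sub_right]

theorem gram_smul_left (c : ℝ) (f : Fin k → E) (g : Fin l → E) :
    gram (c • f) g = c • gram f g := by
  ext i j
  simp [gram, real_inner_smul_left]

theorem gram_smul_right (c : ℝ) (f : Fin k → E) (g : Fin l → E) :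
    gram f (c • g) = c • gram f g := by
  ext i j
  simp [gram, real_inner_smul_right]

theorem gram_zero_left (g : Fin l → E) : gram (0 : Fin k → E) g = 0 := by
  ext i j
  simp [gram]

theorem gram_zero_right (f : Fin k → E) : gram f (0 : Fin l → E) = 0 := by
  ext i j
  simp [gram]

theorem gram_sum_left {ι : Type*} (s : Finset ι) (f : ι → Fin k → E) (g : Fin l → E) :
    gram (∑ a ∈ s, f a) g = ∑ a ∈ s, gram (f a) g := by
  ext i j
  simp [gram, sum_inner, Matrix.sum_apply]

theorem vmap_add (T : E →L[ℝ] E) (f g : Fin k → E) : vmap T (f + g) = vmap T f + vmap T g := by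
  funext i
  simp [vmap]

theorem vmap_sub (T : E →L[ℝ] E) (f g : Fin k → E) : vmap T (f - g) = vmap T f - vmap T g := by
  funext i
  simp [vmap]

theorem vmap_matAct (T : E →L[ℝ] E) (A : Matrix (Fin m) (Fin k) ℝ) (f : Fin k → E) :
    vmap T (matAct A f) = matAct A (vmap T f) := by
  funext i
  simp [vmap, matAct]

theorem matAct_mem {K : Submodule ℝ E} (A : Matrix (Fin m) (Fin k) ℝ) {f : Fin k → E}
    (hf : ∀ i, f i ∈ K) (i : Fin m) : matAct A f i ∈ K :=
  Submodule.sum_mem _ fun j _ => Submodule.smul_mem _ _ (hf j)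

theorem matAct_matAct (A : Matrix (Fin m) (Fin k) ℝ) (B : Matrix (Fin k) (Fin l) ℝ)
    (f : Fin l → E) : matAct A (matAct B f) = matAct (A * B) f := by
  funext i
  simp only [matAct, Finset.smul_sum, Matrix.mul_apply, Finset.sum_smul, smul_smul]
  exact Finset.sum_comm

theorem matAct_smul_mat (c : ℝ) (A : Matrix (Fin m) (Fin k) ℝ) (f : Fin k → E) :
    matAct (c • A) f = c • matAct A f := by
  funext i
  simp [matAct, Finset.smul_sum, smul_smul]

theorem matAct_add (A : Matrix (Fin m) (Fin k) ℝ) (f g : Fin k → E) :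
    matAct A (f + g) = matAct A f + matAct A g := by
  funext i
  simp [matAct, Finset.sum_add_distrib]

theorem matAct_one (f : Fin k → E) : matAct 1 f = f := by
  funext i
  simp [matAct, Matrix.one_apply]

/-- Two elements of a closed span with prescribed inner products against the spanning vectors have
a norm which depends only on these inner products and on the Gram matrix of the spanning vectors. -/
theorem norm_le_of_gram_eq {ι : Type*} {z z' : ι → E}
    (hz : ∀ a b, inner ℝ (z a) (z b) = (inner ℝ (z' a) (z' b) : ℝ)) {f f' : E}
    (hf : f ∈ (Submodule.span ℝ (Set.range z)).topologicalClosure)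
    (hff : ∀ a, inner ℝ f (z a) = (inner ℝ f' (z' a) : ℝ)) : ‖f‖ ≤ ‖f'‖ := by
  have key : ∀ c : ι →₀ ℝ, ‖f‖ ^ 2 - ‖Finsupp.linearCombination ℝ z c - f‖ ^ 2 ≤ ‖f'‖ ^ 2 := by
    intro c
    have h1 : ∀ (w : ι → E) (g : E), (inner ℝ g (Finsupp.linearCombination ℝ w c) : ℝ) =
        c.sum fun a r => r * inner ℝ g (w a) := by
      intro w g
      rw [Finsupp.linearCombination_apply, Finsupp.inner_sum]
      simp [real_inner_smul_right]
    have h2 : (inner ℝ f (Finsupp.linearCombination ℝ z c) : ℝ) =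
        inner ℝ f' (Finsupp.linearCombination ℝ z' c) := by
      rw [h1, h1]; simp only [hff]
    have h3 : ‖Finsupp.linearCombination ℝ z c‖ ^ 2 = ‖Finsupp.linearCombination ℝ z' c‖ ^ 2 := by
      rw [← real_inner_self_eq_norm_sq, ← real_inner_self_eq_norm_sq, h1, h1]
      refine Finsupp.sum_congr fun a _ => ?_
      rw [real_inner_comm, real_inner_comm (z' a), h1, h1]
      simp only [hz]
    have h4 := norm_sub_sq_real (Finsupp.linearCombination ℝ z c) f
    have h5 := norm_sub_sq_real (Finsupp.linearCombination ℝ z' c) f'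
    rw [real_inner_comm] at h4 h5
    nlinarith [sq_nonneg ‖Finsupp.linearCombination ℝ z' c - f'‖]
  have hle : ‖f‖ ^ 2 ≤ ‖f'‖ ^ 2 := by
    refine le_of_forall_pos_sub_le fun ε hε => ?_
    have hcl : f ∈ closure (Submodule.span ℝ (Set.range z) : Set E) := hf
    obtain ⟨g, hg, hgd⟩ := Metric.mem_closure_iff.1 hcl (√ε) (Real.sqrt_pos.2 hε)
    obtain ⟨c, rfl⟩ := (Finsupp.mem_span_range_iff_exists_finsupp).1 hg
    have := key c
    rw [dist_comm, dist_eq_norm] at hgd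
    have h6 : ‖Finsupp.linearCombination ℝ z c - f‖ ^ 2 ≤ ε := by
      rw [Finsupp.linearCombination_apply]
      have := Real.sq_sqrt hε.le
      nlinarith [norm_nonneg ((c.sum fun i a => a • z i) - f)]
    linarith
  exact le_of_sq_le_sq hle (norm_nonneg _)

theorem inner_eq_of_gram_eq {ι : Type*} {z z' : ι → E}
    (hz : ∀ a b, inner ℝ (z a) (z b) = (inner ℝ (z' a) (z' b) : ℝ)) {f f' g g' : E}
    (hf : f ∈ (Submodule.span ℝ (Set.range z)).topologicalClosure)
    (hf' : f' ∈ (Submodule.span ℝ (Set.range z')).topologicalClosure)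
    (hg : g ∈ (Submodule.span ℝ (Set.range z)).topologicalClosure)
    (hg' : g' ∈ (Submodule.span ℝ (Set.range z')).topologicalClosure)
    (hff : ∀ a, inner ℝ f (z a) = (inner ℝ f' (z' a) : ℝ))
    (hgg : ∀ a, inner ℝ g (z a) = (inner ℝ g' (z' a) : ℝ)) :
    (inner ℝ f g : ℝ) = inner ℝ f' g' := by
  have hnorm : ∀ {a a' : E}, a ∈ (Submodule.span ℝ (Set.range z)).topologicalClosure →
      a' ∈ (Submodule.span ℝ (Set.range z')).topologicalClosure →
      (∀ b, inner ℝ a (z b) = (inner ℝ a' (z' b) : ℝ)) → ‖a‖ = ‖a'‖ := fun ha ha' h =>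
    le_antisymm (norm_le_of_gram_eq hz ha h)
      (norm_le_of_gram_eq (fun a b => (hz a b).symm) ha' fun b => (h b).symm)
  have h1 := hnorm hf hf' hff
  have h2 := hnorm hg hg' hgg
  have h3 := hnorm (Submodule.add_mem _ hf hg) (Submodule.add_mem _ hf' hg') fun b => by
    rw [inner_add_left, inner_add_left, hff, hgg]
  have h4 := norm_add_sq_real f g
  have h5 := norm_add_sq_real f' g'
  rw [h1, h2, h3] at h4
  linarith

end Vectors

section Switched

variable {E : Type*} [NormedAddCommGroup E] [InnerProductSpace ℝ E] {α : Type*} {k l m n : ℕ}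

/-- The operators `z_w`: successive application of the scaled operators `U_σ(s) / √p_σ` along the
letters of `w`, the last one at time `t - 1`. -/
noncomputable def wordOp (pr : α → ℝ) (U : α → ℤ → E →L[ℝ] E) : List α → ℤ → E →L[ℝ] E
  | [], _ => ContinuousLinearMap.id ℝ E
  | σ :: w, t => (wordOp pr U w t).comp ((√(pr σ))⁻¹ • U σ (t - w.length - 1))

/-- The vectors `z^r_w(t)`. -/
noncomputable def zvec (pr : α → ℝ) (U : α → ℤ → E →L[ℝ] E) (r : ℤ → Fin k → E) (w : List α) (t : ℤ) :
    Fin k → E :=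
  vmap (wordOp pr U w t) (r (t - w.length))

/-- The closed span of the vectors `z^r_w(t)`, `w` a nonempty word. -/
def lagSpan (pr : α → ℝ) (U : α → ℤ → E →L[ℝ] E) (r : ℤ → Fin k → E) (t : ℤ) : Submodule ℝ E :=
  (Submodule.span ℝ (Set.range fun q : {w : List α // w ≠ []} × Fin k =>
    zvec pr U r q.1 t q.2)).topologicalClosure

theorem wordOp_append_singleton (pr : α → ℝ) (U : α → ℤ → E →L[ℝ] E) (w : List α) (σ : α) (t : ℤ)
    (f : E) : wordOp pr U (w ++ [σ]) (t + 1) f = (√(pr σ))⁻¹ • U σ t (wordOp pr U w t f) := by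
  induction w generalizing f with
  | nil => simp [wordOp]
  | cons τ w ih =>
    simp only [List.cons_append, wordOp, ContinuousLinearMap.comp_apply, ih]
    have : t + 1 - ((w ++ [σ]).length : ℤ) - 1 = t - w.length - 1 := by simp
    rw [this]

theorem zvec_nil (pr : α → ℝ) (U : α → ℤ → E →L[ℝ] E) (r : ℤ → Fin k → E) (t : ℤ) :
    zvec pr U r [] t = r t := by
  funext i
  simp [zvec, wordOp, vmap]

theorem zvec_append_singleton (pr : α → ℝ) (U : α → ℤ → E →L[ℝ] E) (r : ℤ → Fin k → E)
    (w : List α) (σ : α) (t : ℤ) :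
    zvec pr U r (w ++ [σ]) (t + 1) = (√(pr σ))⁻¹ • vmap (U σ t) (zvec pr U r w t) := by
  have : t + 1 - ((w ++ [σ]).length : ℤ) = t - w.length := by simp
  funext i
  simp only [zvec, vmap, this, wordOp_append_singleton, Pi.smul_apply]

theorem zvec_mem_lagSpan (pr : α → ℝ) (U : α → ℤ → E →L[ℝ] E) (r : ℤ → Fin k → E) (t : ℤ)
    {w : List α} (hw : w ≠ []) (i : Fin k) : zvec pr U r w t i ∈ lagSpan pr U r t :=
  Submodule.le_topologicalClosure _ (Submodule.subset_span ⟨(⟨w, hw⟩, i), rfl⟩)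

theorem lagSpan_le {pr : α → ℝ} {U : α → ℤ → E →L[ℝ] E} {r : ℤ → Fin k → E} {t : ℤ}
    {K : Submodule ℝ E} (hK : IsClosed (K : Set E))
    (h : ∀ w, w ≠ [] → ∀ i, zvec pr U r w t i ∈ K) : lagSpan pr U r t ≤ K := by
  refine Submodule.topologicalClosure_minimal _ (Submodule.span_le.2 ?_) hK
  rintro _ ⟨q, rfl⟩
  exact h q.1 q.1.2 q.2

theorem isClosed_lagSpan (pr : α → ℝ) (U : α → ℤ → E →L[ℝ] E) (r : ℤ → Fin k → E) (t : ℤ) :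
    IsClosed (lagSpan pr U r t : Set E) :=
  Submodule.isClosed_topologicalClosure _

theorem map_lagSpan {pr : α → ℝ} {U : α → ℤ → E →L[ℝ] E} {r : ℤ → Fin k → E} {t : ℤ}
    {K : Submodule ℝ E} (hK : IsClosed (K : Set E)) (T : E →L[ℝ] E)
    (h : ∀ w, w ≠ [] → ∀ i, T (zvec pr U r w t i) ∈ K) {f : E} (hf : f ∈ lagSpan pr U r t) :
    T f ∈ K :=
  lagSpan_le (K := K.comap T.toLinearMap) (hK.preimage T.continuous) h hf

theorem inner_lagSpan_eq_zero {pr : α → ℝ} {U : α → ℤ → E →L[ℝ] E} {r : ℤ → Fin k → E} {t : ℤ}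
    {g : E} (h : ∀ w, w ≠ [] → ∀ i, inner ℝ g (zvec pr U r w t i) = (0 : ℝ)) {f : E}
    (hf : f ∈ lagSpan pr U r t) : (inner ℝ g f : ℝ) = 0 :=
  lagSpan_le (K := LinearMap.ker (innerSL ℝ g).toLinearMap) (innerSL ℝ g).isClosed_ker h hf

/-- Two elements of the closed span with the same inner products against the generators agree. -/
theorem eq_of_inner_zvec {pr : α → ℝ} {U : α → ℤ → E →L[ℝ] E} {r : ℤ → Fin k → E} {t : ℤ}
    {f g : E} (hf : f ∈ lagSpan pr U r t) (hg : g ∈ lagSpan pr U r t)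
    (h : ∀ w, w ≠ [] → ∀ i, inner ℝ f (zvec pr U r w t i) = (inner ℝ g (zvec pr U r w t i) : ℝ)) :
    f = g := by
  have := inner_lagSpan_eq_zero (g := f - g) (fun w hw i => by
    rw [inner_sub_left, h w hw, sub_self]) (Submodule.sub_mem _ hf hg)
  exact sub_eq_zero.1 (inner_self_eq_zero.1 this)

variable [Fintype α]

open Classical in
/-- Operators `U_σ(t)` (multiplication by the inputs) and subspaces `G(t)` (variables depending on
the past) for an input process with restricted switching. -/
structure SwitchedSpace (pr : α → ℝ) (S : Set (α × α)) (U : α → ℤ → E →L[ℝ] E)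
    (G : ℤ → Submodule ℝ E) : Prop where
  pos : ∀ σ, 0 < pr σ
  idem : ∀ σ t f, U σ t (U σ t f) = U σ t f
  orth : ∀ σ τ t f, σ ≠ τ → U σ t (U τ t f) = 0
  sum : ∀ t f, ∑ σ, U σ t f = f
  symm : ∀ σ t f g, (inner ℝ (U σ t f) g : ℝ) = inner ℝ f (U σ t g)
  comm : ∀ σ τ s t f, U σ s (U τ t f) = U τ t (U σ s f)
  mono : Monotone G
  closed : ∀ t, IsClosed (G t : Set E)
  mem : ∀ σ s t f, s < t → f ∈ G t → U σ s f ∈ G t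
  key : ∀ σ t f g, f ∈ G (t + 1) → g ∈ G (t + 1) →
    (inner ℝ f (U σ (t + 1) g) : ℝ) = pr σ * ∑ a with (a, σ) ∈ S, inner ℝ f (U a t g)

namespace SwitchedSpace

variable {pr : α → ℝ} {S : Set (α × α)} {U : α → ℤ → E →L[ℝ] E} {G : ℤ → Submodule ℝ E}
  (H : SwitchedSpace pr S U G)

include H

theorem sqrt_ne_zero (σ : α) : √(pr σ) ≠ 0 := (Real.sqrt_pos.2 (H.pos σ)).ne'

theorem sqrt_inv_mul_self (σ : α) : (√(pr σ))⁻¹ * (√(pr σ))⁻¹ = (pr σ)⁻¹ := by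
  rw [← mul_inv, Real.mul_self_sqrt (H.pos σ).le]

theorem gram_vmap (σ : α) (t : ℤ) (f : Fin k → E) (g : Fin l → E) :
    gram (vmap (U σ t) f) g = gram f (vmap (U σ t) g) := by
  ext i j
  exact H.symm _ _ _ _

theorem gram_vmap_self (σ : α) (t : ℤ) (f : Fin k → E) (g : Fin l → E) :
    gram (vmap (U σ t) f) (vmap (U σ t) g) = gram f (vmap (U σ t) g) := by
  rw [H.gram_vmap]
  congr 1
  funext i
  exact H.idem _ _ _

theorem gram_vmap_ne {σ τ : α} (h : σ ≠ τ) (t : ℤ) (f : Fin k → E) (g : Fin l → E) :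
    gram (vmap (U σ t) f) (vmap (U τ t) g) = 0 := by
  rw [H.gram_vmap]
  ext i j
  simp [gram, vmap, H.orth _ _ _ _ h]

theorem key_fixed {a : α} {t : ℤ} {f g : E} (hf : f ∈ G (t + 1)) (hg : g ∈ G (t + 1))
    (hfa : U a t f = f) (σ : α) :
    (inner ℝ f (U σ (t + 1) g) : ℝ) = open Classical in
      if (a, σ) ∈ S then pr σ * inner ℝ f g else 0 := by
  classical
  rw [H.key σ t f g hf hg]
  have h1 : ∀ b, (inner ℝ f (U b t g) : ℝ) = if b = a then inner ℝ f g else 0 := by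
    intro b
    rw [← H.symm]
    split_ifs with h
    · rw [h, hfa]
    · rw [← hfa, H.orth _ _ _ _ h, inner_zero_left]
  simp only [h1, Finset.sum_filter]
  split_ifs with h
  · rw [Finset.sum_eq_single a]
    · simp [h]
    · intro b _ hb; simp [hb]
    · simp
  · rw [Finset.sum_eq_zero, mul_zero]
    intro b _
    by_cases hb : b = a
    · simp [hb, h]
    · simp [hb]

theorem gram_key_fixed {a : α} {t : ℤ} {f : Fin k → E} {g : Fin l → E}
    (hf : ∀ i, f i ∈ G (t + 1)) (hg : ∀ i, g i ∈ G (t + 1))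
    (hfa : ∀ i, U a t (f i) = f i) (σ : α) :
    gram f (vmap (U σ (t + 1)) g) = open Classical in
      if (a, σ) ∈ S then pr σ • gram f g else 0 := by
  ext i j
  rw [gram_apply, vmap, H.key_fixed (hf i) (hg j) (hfa i)]
  split_ifs <;> simp [gram]

theorem gram_key {t : ℤ} {f : Fin k → E} {g : Fin l → E}
    (hf : ∀ i, f i ∈ G (t + 1)) (hg : ∀ i, g i ∈ G (t + 1)) (σ : α) :
    gram f (vmap (U σ (t + 1)) g) = open Classical in
      pr σ • ∑ a with (a, σ) ∈ S, gram f (vmap (U a t) g) := by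
  classical
  ext i j
  rw [gram_apply, vmap, H.key σ t _ _ (hf i) (hg j)]
  simp [Matrix.sum_apply, gram, vmap]

section Proc

variable {r : ℤ → Fin k → E} {r' : ℤ → Fin l → E}

theorem zvec_mem (hr : ∀ t i, r t i ∈ G t) (w : List α) (t : ℤ) (i : Fin k) :
    zvec pr U r w t i ∈ G t := by
  induction w using List.reverseRecOn generalizing t with
  | nil => rw [zvec_nil]; exact hr t i
  | append_singleton w σ ih =>
    obtain ⟨t, rfl⟩ : ∃ s, t = s + 1 := ⟨t - 1, by ring⟩
    rw [zvec_append_singleton]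
    exact Submodule.smul_mem _ _ (H.mem _ _ _ _ (by omega) (H.mono (by omega) (ih t)))

theorem lagSpan_le_G (hr : ∀ t i, r t i ∈ G t) (t : ℤ) : lagSpan pr U r t ≤ G t :=
  lagSpan_le (H.closed t) fun w _ i => H.zvec_mem hr w t i

theorem U_zvec_append_singleton (w : List α) (σ : α) (t : ℤ) (i : Fin k) :
    U σ t (zvec pr U r (w ++ [σ]) (t + 1) i) = zvec pr U r (w ++ [σ]) (t + 1) i := by
  rw [zvec_append_singleton]
  simp only [Pi.smul_apply, vmap, map_smul, H.idem]

theorem U_zvec_append_singleton_ne (w : List α) {σ τ : α} (h : τ ≠ σ) (t : ℤ) (i : Fin k) :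
    U τ t (zvec pr U r (w ++ [σ]) (t + 1) i) = 0 := by
  rw [zvec_append_singleton]
  simp only [Pi.smul_apply, vmap, map_smul, H.orth _ _ _ _ h, smul_zero]

theorem U_mem_lagSpan_self (σ : α) {t : ℤ} {f : E} (hf : f ∈ lagSpan pr U r (t + 1)) :
    U σ t f ∈ lagSpan pr U r (t + 1) := by
  refine map_lagSpan (isClosed_lagSpan _ _ _ _) _ (fun w hw i => ?_) hf
  obtain rfl | ⟨w, τ, rfl⟩ := List.eq_nil_or_concat' w
  · exact absurd rfl hw
  · by_cases h : σ = τ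
    · rw [h, H.U_zvec_append_singleton]
      exact zvec_mem_lagSpan _ _ _ _ hw i
    · rw [H.U_zvec_append_singleton_ne _ h]
      exact Submodule.zero_mem _

theorem U_zvec_mem_lagSpan (σ : α) (w : List α) (t : ℤ) (i : Fin k) :
    U σ t (zvec pr U r w t i) ∈ lagSpan pr U r (t + 1) := by
  have h1 := zvec_mem_lagSpan pr U r (t + 1) (w := w ++ [σ]) (by simp) i
  rw [zvec_append_singleton] at h1
  have h2 := Submodule.smul_mem _ (√(pr σ)) h1
  rwa [Pi.smul_apply, smul_smul, mul_inv_cancel₀ (H.sqrt_ne_zero σ), one_smul] at h2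

theorem U_mem_lagSpan_succ (σ : α) {t : ℤ} {f : E} (hf : f ∈ lagSpan pr U r t) :
    U σ t f ∈ lagSpan pr U r (t + 1) :=
  map_lagSpan (isClosed_lagSpan _ _ _ _) _ (fun w _ i => H.U_zvec_mem_lagSpan σ w t i) hf

theorem U_proc_mem_lagSpan (σ : α) (t : ℤ) (i : Fin k) :
    U σ t (r t i) ∈ lagSpan pr U r (t + 1) := by
  have := H.U_zvec_mem_lagSpan (r := r) σ [] t i
  rwa [zvec_nil] at this

/-- If `r(t)` is obtained from the past of `q` and from `q(t)`, then `z^r_w(t)` belongs to the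
Hilbert space generated by the past of `q`. -/
theorem zvec_mem_lagSpan_of {q : ℤ → Fin l → E}
    (h : ∀ σ t i, U σ t (r t i) ∈ lagSpan pr U q (t + 1)) {w : List α} (hw : w ≠ []) (t : ℤ)
    (i : Fin k) : zvec pr U r w t i ∈ lagSpan pr U q t := by
  induction w using List.reverseRecOn generalizing t with
  | nil => exact absurd rfl hw
  | append_singleton w σ ih =>
    obtain ⟨t, rfl⟩ : ∃ s, t = s + 1 := ⟨t - 1, by ring⟩
    rw [zvec_append_singleton]
    refine Submodule.smul_mem _ _ ?_
    by_cases hw' : w = []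
    · subst hw'
      rw [zvec_nil]
      exact h σ t i
    · exact H.U_mem_lagSpan_succ σ (ih hw' t)

theorem gram_zvec_singleton (σ : α) (t : ℤ) :
    gram (zvec pr U r [σ] (t + 1)) (zvec pr U r' [σ] (t + 1)) =
      (pr σ)⁻¹ • gram (r t) (vmap (U σ t) (r' t)) := by
  have h1 := zvec_append_singleton pr U r [] σ t
  have h2 := zvec_append_singleton pr U r' [] σ t
  rw [List.nil_append, zvec_nil] at h1 h2
  rw [h1, h2, gram_smul_left, gram_smul_right, smul_smul, H.sqrt_inv_mul_self, H.gram_vmap_self]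

theorem gram_zvec_ne (w w' : List α) {σ τ : α} (h : σ ≠ τ) (t : ℤ) :
    gram (zvec pr U r (w ++ [σ]) t) (zvec pr U r' (w' ++ [τ]) t) = 0 := by
  obtain ⟨t, rfl⟩ : ∃ s, t = s + 1 := ⟨t - 1, by ring⟩
  rw [zvec_append_singleton, zvec_append_singleton, gram_smul_left, gram_smul_right,
    H.gram_vmap_ne h, smul_zero, smul_zero]

theorem gram_zvec_append (hr : ∀ t i, r t i ∈ G t) (hr' : ∀ t i, r' t i ∈ G t) (w w' : List α)
    (a σ : α) (t : ℤ) :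
    gram (zvec pr U r (w ++ [a] ++ [σ]) (t + 1)) (zvec pr U r' (w' ++ [σ]) (t + 1)) =
      open Classical in
      if (a, σ) ∈ S then gram (zvec pr U r (w ++ [a]) t) (zvec pr U r' w' t) else 0 := by
  obtain ⟨t, rfl⟩ : ∃ s, t = s + 1 := ⟨t - 1, by ring⟩
  rw [zvec_append_singleton, zvec_append_singleton _ _ r', gram_smul_left, gram_smul_right,
    smul_smul, H.sqrt_inv_mul_self, H.gram_vmap_self,
    H.gram_key_fixed (a := a) (fun i => H.zvec_mem hr _ _ i) (fun i => H.zvec_mem hr' _ _ i)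
      (fun i => H.U_zvec_append_singleton _ _ _ _)]
  split_ifs
  · rw [smul_smul, inv_mul_cancel₀ (H.pos σ).ne', one_smul]
  · simp

theorem zvec_eq_zero (hr : ∀ t i, r t i ∈ G t) {w : List α} (hw : w ≠ []) (hS : w ∉ admissible S)
    (t : ℤ) : zvec pr U r w t = 0 := by
  induction w using List.reverseRecOn generalizing t with
  | nil => exact absurd rfl hw
  | append_singleton w σ ih =>
    obtain ⟨t, rfl⟩ : ∃ s, t = s + 1 := ⟨t - 1, by ring⟩
    obtain rfl | ⟨w, a, rfl⟩ := List.eq_nil_or_concat' w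
    · exact absurd ⟨by simp, by simp⟩ hS
    · by_cases h : (w ++ [a]) ∈ admissible S
      · have haσ : (a, σ) ∉ S := fun ha => hS ⟨by simp, by
          have := h.2
          rw [List.isChain_append]
          refine ⟨this, by simp, ?_⟩
          simpa using ha⟩
        funext i
        have := congrFun (congrFun (H.gram_zvec_append hr hr w (w ++ [a]) a σ t) i) i
        rw [if_neg haσ] at this
        exact inner_self_eq_zero.1 this
      · rw [zvec_append_singleton, ih (by simp) h]
        funext i
        simp [vmap]

/-- Stationarity of the second order moments of `r(t)` and of the first lag yields that of all the
`z^r_w(t)`. -/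
theorem gram_zvec_stationary (hr : ∀ t i, r t i ∈ G t)
    (h1 : ∀ w, w ≠ [] → ∀ t s, gram (r t) (zvec pr U r w t) = gram (r s) (zvec pr U r w s))
    (h2 : ∀ σ t s, gram (r t) (vmap (U σ t) (r t)) = gram (r s) (vmap (U σ s) (r s)))
    {w w' : List α} (hw : w ≠ []) (hw' : w' ≠ []) (t s : ℤ) :
    gram (zvec pr U r w t) (zvec pr U r w' t) = gram (zvec pr U r w s) (zvec pr U r w' s) := by
  induction w using List.reverseRecOn generalizing t s w' with
  | nil => exact absurd rfl hw
  | append_singleton w σ ih =>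
    obtain ⟨t, rfl⟩ : ∃ s, t = s + 1 := ⟨t - 1, by ring⟩
    obtain ⟨s, rfl⟩ : ∃ t, s = t + 1 := ⟨s - 1, by ring⟩
    obtain rfl | ⟨w', τ, rfl⟩ := List.eq_nil_or_concat' w'
    · exact absurd rfl hw'
    by_cases hστ : σ = τ
    · subst hστ
      obtain rfl | ⟨w, a, rfl⟩ := List.eq_nil_or_concat' w
      · obtain rfl | ⟨w', b, rfl⟩ := List.eq_nil_or_concat' w'
        · simp only [List.nil_append]
          rw [H.gram_zvec_singleton, H.gram_zvec_singleton, h2 σ t s]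
        · rw [← gram_transpose, H.gram_zvec_append hr hr, ← gram_transpose (zvec pr U r _ (s + 1)),
            H.gram_zvec_append hr hr]
          split_ifs
          · rw [gram_transpose, gram_transpose, zvec_nil, zvec_nil, h1 _ (by simp) t s]
          · rfl
      · rw [H.gram_zvec_append hr hr, H.gram_zvec_append hr hr]
        split_ifs
        · by_cases hw'' : w' = []
          · subst hw''
            rw [zvec_nil, zvec_nil, ← gram_transpose, h1 _ (by simp) t s, gram_transpose]
          · exact ih (by simp) hw'' t s
        · rfl
    · rw [H.gram_zvec_ne _ _ hστ, H.gram_zvec_ne _ _ hστ]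

/-- If `r(t)` is orthogonal to its own past, then the `z^r_w(t)` are pairwise orthogonal. -/
theorem gram_zvec_eq_zero (hr : ∀ t i, r t i ∈ G t)
    (h1 : ∀ w, w ≠ [] → ∀ t, gram (r t) (zvec pr U r w t) = 0)
    {w w' : List α} (hww : w ≠ w') (t : ℤ) :
    gram (zvec pr U r w t) (zvec pr U r w' t) = 0 := by
  induction w using List.reverseRecOn generalizing t w' with
  | nil => rw [zvec_nil]; exact h1 _ hww.symm t
  | append_singleton w σ ih =>
    obtain ⟨t, rfl⟩ : ∃ s, t = s + 1 := ⟨t - 1, by ring⟩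
    obtain rfl | ⟨w', τ, rfl⟩ := List.eq_nil_or_concat' w'
    · rw [zvec_nil _ _ _ (t + 1), ← gram_transpose, h1 _ (by simp), Matrix.transpose_zero]
    by_cases hστ : σ = τ
    · subst hστ
      have hne : w ≠ w' := fun h => hww (by rw [h])
      obtain rfl | ⟨w, a, rfl⟩ := List.eq_nil_or_concat' w
      · obtain rfl | ⟨w', b, rfl⟩ := List.eq_nil_or_concat' w'
        · exact absurd rfl hne
        · rw [← gram_transpose, H.gram_zvec_append hr hr]
          split_ifs
          · rw [gram_transpose, ih hne]
          · simp
      · rw [H.gram_zvec_append hr hr]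
        split_ifs
        · exact ih hne t
        · rfl
    · rw [H.gram_zvec_ne _ _ hστ]

/-- Stationarity of `⟪f(t), U_σ(t) g(t)⟫` for elements with stationary moments. -/
theorem gram_U_stationary (hr : ∀ t i, r t i ∈ G t)
    (hzz : ∀ w w', w ≠ [] → w' ≠ [] → ∀ t s,
      gram (zvec pr U r w t) (zvec pr U r w' t) = gram (zvec pr U r w s) (zvec pr U r w' s))
    {f : ℤ → Fin m → E} {g : ℤ → Fin n → E} (hf : ∀ t i, f t i ∈ lagSpan pr U r t)
    (hg : ∀ t i, g t i ∈ lagSpan pr U r t)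
    (hfz : ∀ w, w ≠ [] → ∀ t s, gram (f t) (zvec pr U r w t) = gram (f s) (zvec pr U r w s))
    (hgz : ∀ w, w ≠ [] → ∀ t s, gram (g t) (zvec pr U r w t) = gram (g s) (zvec pr U r w s))
    (σ : α) (t s : ℤ) :
    gram (f t) (vmap (U σ t) (g t)) = gram (f s) (vmap (U σ s) (g s)) := by
  classical
  obtain ⟨t, rfl⟩ : ∃ s, t = s + 1 := ⟨t - 1, by ring⟩
  obtain ⟨s, rfl⟩ : ∃ t, s = t + 1 := ⟨s - 1, by ring⟩
  have hle := H.lagSpan_le_G hr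
  rw [H.gram_key (fun i => hle _ (hf _ i)) (fun i => hle _ (hg _ i)),
    H.gram_key (fun i => hle _ (hf _ i)) (fun i => hle _ (hg _ i))]
  congr 1
  refine Finset.sum_congr rfl fun a _ => ?_
  ext i j
  refine inner_eq_of_gram_eq (z := fun q : {w : List α // w ≠ []} × Fin k =>
    zvec pr U r q.1 (t + 1) q.2) (z' := fun q : {w : List α // w ≠ []} × Fin k =>
    zvec pr U r q.1 (s + 1) q.2) ?_ (hf _ i) (hf _ i) (H.U_mem_lagSpan_self a (hg _ j))
    (H.U_mem_lagSpan_self a (hg _ j)) ?_ ?_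
  · intro q q'
    exact congrFun (congrFun (hzz _ _ q.1.2 q'.1.2 (t + 1) (s + 1)) q.2) q'.2
  · intro q
    exact congrFun (congrFun (hfz _ q.1.2 (t + 1) (s + 1)) i) q.2
  · rintro ⟨⟨w, hw⟩, q⟩
    simp only [vmap, H.symm]
    obtain rfl | ⟨w, τ, rfl⟩ := List.eq_nil_or_concat' w
    · exact absurd rfl hw
    · by_cases h : a = τ
      · rw [h, H.U_zvec_append_singleton, H.U_zvec_append_singleton]
        exact congrFun (congrFun (hgz _ hw (t + 1) (s + 1)) j) q
      · rw [H.U_zvec_append_singleton_ne _ h, H.U_zvec_append_singleton_ne _ h, inner_zero_right,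
          inner_zero_right]

end Proc

end SwitchedSpace

end Switched
end JMLSRS

namespace JMLSRS

section Switched

variable {E : Type*} [NormedAddCommGroup E] [InnerProductSpace ℝ E] {α : Type*} {k l m n p : ℕ}

theorem exists_mul_gram_eq (f : Fin l → E) (g : Fin k → E) :
    ∃ K : Matrix (Fin k) (Fin l) ℝ, K * gram f f = gram g f := by
  let W := Submodule.span ℝ (Set.range f)
  have : FiniteDimensional ℝ W := FiniteDimensional.span_of_finite ℝ (Set.finite_range f)
  have h : ∀ i, ∃ c : Fin l → ℝ, ∑ j, c j • f j = W.starProjection (g i) := fun i =>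
    (Submodule.mem_span_range_iff_exists_fun ℝ).1 (W.starProjection_apply_mem (g i))
  choose c hc using h
  refine ⟨Matrix.of c, ?_⟩
  rw [← gram_matAct_left]
  ext i j
  have h1 : matAct (Matrix.of c) f i = W.starProjection (g i) := hc i
  have h2 : (inner ℝ (g i - W.starProjection (g i)) (f j) : ℝ) = 0 :=
    Submodule.starProjection_inner_eq_zero (g i) (f j) (Submodule.subset_span ⟨j, rfl⟩)
  rw [gram_apply, gram_apply, h1]
  rw [inner_sub_left] at h2
  linarith

variable [Fintype α]

namespace SwitchedSpace

variable {pr : α → ℝ} {S : Set (α × α)} {U : α → ℤ → E →L[ℝ] E} {G : ℤ → Submodule ℝ E}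
  (H : SwitchedSpace pr S U G)

include H

theorem gram_vmap_zvec {r : ℤ → Fin k → E} (hr : ∀ t i, r t i ∈ G t) {t : ℤ} {f : Fin l → E}
    (hf : ∀ i, f i ∈ G t) (w : List α) (a σ : α) :
    gram f (vmap (U σ t) (zvec pr U r (w ++ [a]) t)) = open Classical in
      if (a, σ) ∈ S then pr σ • gram f (zvec pr U r (w ++ [a]) t) else 0 := by
  obtain ⟨t, rfl⟩ : ∃ s, t = s + 1 := ⟨t - 1, by ring⟩
  rw [← gram_transpose, H.gram_vmap, H.gram_key_fixed (a := a) (fun i => H.zvec_mem hr _ _ i) hf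
    (fun i => H.U_zvec_append_singleton _ _ _ _)]
  split_ifs
  · rw [Matrix.transpose_smul, gram_transpose]
  · simp

/-- A variable orthogonal to the past of `q` stays orthogonal to it after multiplication by the
current input. -/
theorem gram_U_eq_zero {q : ℤ → Fin k → E} (hq : ∀ t i, q t i ∈ G t) {t : ℤ} {e : Fin l → E}
    (he : ∀ i, e i ∈ G t) (he0 : ∀ w, w ≠ [] → gram e (zvec pr U q w t) = 0) {h : Fin n → E}
    (hh : ∀ i, h i ∈ lagSpan pr U q t) (σ : α) : gram h (vmap (U σ t) e) = 0 := by
  classical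
  obtain ⟨t, rfl⟩ : ∃ s, t = s + 1 := ⟨t - 1, by ring⟩
  rw [H.gram_key (fun i => H.lagSpan_le_G hq _ (hh i)) he, Finset.sum_eq_zero, smul_zero]
  intro a _
  rw [← H.gram_vmap]
  ext i j
  rw [gram_apply, real_inner_comm]
  exact inner_lagSpan_eq_zero (fun w hw i => congrFun (congrFun (he0 w hw) j) i)
    (H.U_mem_lagSpan_self a (hh i))

theorem gram_step_zvec (X V : α → Fin n → E) {r : ℤ → Fin k → E} (w : List α) (σ : α) (t : ℤ) :
    gram (∑ τ, vmap (U τ t) (X τ + V τ)) (zvec pr U r (w ++ [σ]) (t + 1)) =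
      (√(pr σ))⁻¹ • (gram (X σ) (vmap (U σ t) (zvec pr U r w t)) +
        gram (V σ) (vmap (U σ t) (zvec pr U r w t))) := by
  rw [zvec_append_singleton, gram_smul_right, gram_sum_left]
  congr 1
  rw [Finset.sum_eq_single σ, H.gram_vmap_self, gram_add_left]
  · intro τ _ hτ
    exact H.gram_vmap_ne hτ _ _ _
  · simp

theorem gram_step_U (X V : α → Fin n → E) (σ : α) (t : ℤ) :
    gram (∑ τ, vmap (U τ t) (X τ + V τ)) (vmap (U σ t) (∑ τ, vmap (U τ t) (X τ + V τ))) =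
      gram (X σ + V σ) (vmap (U σ t) (X σ + V σ)) := by
  have : vmap (U σ t) (∑ τ, vmap (U τ t) (X τ + V τ)) = vmap (U σ t) (X σ + V σ) := by
    funext i
    simp only [vmap, Finset.sum_apply, map_sum]
    rw [Finset.sum_eq_single σ, H.idem]
    · intro τ _ hτ
      exact H.orth _ _ _ _ hτ.symm
    · simp
  rw [this, gram_sum_left, Finset.sum_eq_single σ, H.gram_vmap_self]
  · intro τ _ hτ
    exact H.gram_vmap_ne hτ _ _ _
  · simp

section Driven

variable {A : α → Matrix (Fin n) (Fin n) ℝ} {K : α → Matrix (Fin n) (Fin m) ℝ}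
  {x : ℤ → Fin n → E} {v : ℤ → Fin m → E}

theorem gram_state_zvec {r : ℤ → Fin k → E} (hr : ∀ t i, r t i ∈ G t) (hx : ∀ t i, x t i ∈ G t)
    (hv : ∀ t i, v t i ∈ G t)
    (hst : ∀ t, x (t + 1) = ∑ σ, vmap (U σ t) (matAct (A σ) (x t) + matAct (K σ) (v t)))
    (hvr : ∀ w, w ≠ [] → ∀ t, gram (v t) (zvec pr U r w t) = 0)
    {b : α → Matrix (Fin n) (Fin k) ℝ}
    (hb : ∀ σ t, (√(pr σ))⁻¹ • (A σ * gram (x t) (vmap (U σ t) (r t)) +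
      K σ * gram (v t) (vmap (U σ t) (r t))) = b σ)
    (hA : ∀ a σ, (a, σ) ∉ S → A σ * A a = 0) (hAb : ∀ a σ, (a, σ) ∉ S → A σ * b a = 0)
    (σ : α) (w : List α) (t : ℤ) :
    gram (x t) (zvec pr U r (σ :: w) t) = wordMat (fun σ => √(pr σ) • A σ) w * b σ := by
  induction w using List.reverseRecOn generalizing t with
  | nil =>
    obtain ⟨t, rfl⟩ : ∃ s, t = s + 1 := ⟨t - 1, by ring⟩
    rw [← List.nil_append [σ], hst, H.gram_step_zvec, zvec_nil, gram_matAct_left,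
      gram_matAct_left, hb]
    simp [wordMat]
  | append_singleton w τ ih =>
    obtain ⟨t, rfl⟩ : ∃ s, t = s + 1 := ⟨t - 1, by ring⟩
    obtain ⟨w', a, hwa⟩ : ∃ w' a, σ :: w = w' ++ [a] :=
      (List.eq_nil_or_concat' (σ :: w)).resolve_left (by simp)
    have h1 : A τ * gram (x t) (vmap (U τ t) (zvec pr U r (σ :: w) t)) =
        pr τ • (A τ * gram (x t) (zvec pr U r (σ :: w) t)) := by
      rw [hwa, H.gram_vmap_zvec hr (hx t)]
      split_ifs with h
      · rw [Matrix.mul_smul]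
      · rw [← hwa, ih]
        obtain rfl | ⟨w'', c, rfl⟩ := List.eq_nil_or_concat' w
        · have : a = σ := by
            have := congrArg List.getLast? hwa
            simpa using this.symm
          subst this
          simp [wordMat, hAb _ _ h]
        · have : a = c := by
            have := congrArg List.getLast? hwa
            rw [← List.cons_append, List.getLast?_concat, List.getLast?_concat] at this
            simpa using this.symm
          subst this
          rw [wordMat_append_singleton, Matrix.mul_assoc, ← Matrix.mul_assoc (A τ),
            Matrix.mul_smul, hA _ _ h]
          simp
    have h2 : gram (v t) (vmap (U τ t) (zvec pr U r (σ :: w) t)) = 0 := by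
      rw [hwa, H.gram_vmap_zvec hr (hv t), ← hwa, hvr _ (by simp)]
      simp
    rw [← List.cons_append, hst, H.gram_step_zvec, gram_matAct_left, gram_matAct_left, h2, h1,
      Matrix.mul_zero, add_zero, wordMat_append_singleton, ih, smul_smul, Matrix.smul_mul,
      Matrix.smul_mul, Matrix.mul_assoc]
    congr 1
    rw [inv_mul_eq_div, Real.div_sqrt]

variable (hv : ∀ t i, v t i ∈ G t)
  (hv0 : ∀ w, w ≠ [] → ∀ t, gram (v t) (zvec pr U v w t) = 0)
  {Q : α → Matrix (Fin m) (Fin m) ℝ} (hQ : ∀ σ t, gram (v t) (vmap (U σ t) (v t)) = Q σ)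
  (hxv : ∀ t i, x t i ∈ lagSpan pr U v t)
  (hst : ∀ t, x (t + 1) = ∑ σ, vmap (U σ t) (matAct (A σ) (x t) + matAct (K σ) (v t)))
  (hA : ∀ a σ, (a, σ) ∉ S → A σ * A a = 0)
  (hAK : ∀ a σ, (a, σ) ∉ S → A σ * K a * Q a = 0)

include hv hv0 hxv

theorem gram_state_U_noise (σ : α) (t : ℤ) : gram (x t) (vmap (U σ t) (v t)) = 0 :=
  H.gram_U_eq_zero hv (hv t) (fun w hw => hv0 w hw t) (hxv t) σ

theorem gram_noise_U_state (σ : α) (t : ℤ) : gram (v t) (vmap (U σ t) (x t)) = 0 := by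
  rw [← H.gram_vmap, ← gram_transpose, H.gram_state_U_noise hv hv0 hxv, Matrix.transpose_zero]

include hQ hst hA hAK

theorem gram_state_U_stationary (σ : α) (t s : ℤ) :
    gram (x t) (vmap (U σ t) (x t)) = gram (x s) (vmap (U σ s) (x s)) := by
  have hx : ∀ t i, x t i ∈ G t := fun t i => H.lagSpan_le_G hv t (hxv t i)
  have h1 : ∀ w, w ≠ [] → ∀ t s,
      gram (x t) (zvec pr U v w t) = gram (x s) (zvec pr U v w s) := by
    intro w hw t s
    obtain ⟨σ, w, rfl⟩ := List.exists_cons_of_ne_nil hw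
    have key := H.gram_state_zvec (A := A) (K := K) (b := fun σ => (√(pr σ))⁻¹ • (K σ * Q σ))
      hv hx hv hst hv0
      (fun σ t => by rw [H.gram_state_U_noise hv hv0 hxv, hQ, Matrix.mul_zero, zero_add]) hA
      (fun a σ h => by rw [Matrix.mul_smul, ← Matrix.mul_assoc, hAK a σ h, smul_zero])
    rw [key, key]
  refine H.gram_U_stationary hv (fun w w' hw hw' => H.gram_zvec_stationary hv
    (fun w hw t s => by rw [hv0 w hw, hv0 w hw]) (fun σ t s => by rw [hQ, hQ]) hw hw')
    hxv hxv h1 h1 σ t s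

theorem gram_state_U_eq (σ : α) (t : ℤ) :
    gram (x t) (vmap (U σ t) (x t)) = open Classical in
      pr σ • ∑ a with (a, σ) ∈ S, (A a * gram (x t) (vmap (U a t) (x t)) * (A a).transpose +
        K a * Q a * (K a).transpose) := by
  classical
  have hx : ∀ t i, x t i ∈ G t := fun t i => H.lagSpan_le_G hv t (hxv t i)
  rw [H.gram_state_U_stationary hv hv0 hQ hxv hst hA hAK σ t (t + 1),
    H.gram_key (hx _) (hx _)]
  congr 1
  refine Finset.sum_congr rfl fun a _ => ?_
  rw [hst, H.gram_step_U, vmap_add, gram_add_left, gram_add_right, gram_add_right,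
    vmap_matAct, vmap_matAct]
  simp only [gram_matAct_left, gram_matAct_right, H.gram_state_U_noise hv hv0 hxv,
    H.gram_noise_U_state hv hv0 hxv, hQ]
  simp [Matrix.mul_assoc]

variable {P : α → Matrix (Fin n) (Fin n) ℝ} (hP : ∀ σ t, gram (x t) (vmap (U σ t) (x t)) = P σ)
  {C : Matrix (Fin p) (Fin n) ℝ} {D : Matrix (Fin p) (Fin m) ℝ} {y : ℤ → Fin p → E}
  (hy : ∀ t, y t = matAct C (x t) + matAct D (v t))

omit hst hA hAK in
include hP hy in
theorem gram_output_U (σ : α) (t : ℤ) :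
    gram (y t) (vmap (U σ t) (y t)) = C * P σ * C.transpose + D * Q σ * D.transpose := by
  rw [hy, vmap_add, gram_add_left, gram_add_right, gram_add_right, vmap_matAct, vmap_matAct]
  simp only [gram_matAct_left, gram_matAct_right, H.gram_state_U_noise hv hv0 hxv,
    H.gram_noise_U_state hv hv0 hxv, hQ, hP]
  simp [Matrix.mul_assoc]

omit hv0 hQ hst hA hAK in
include hy in
theorem output_mem (t : ℤ) (i : Fin p) : y t i ∈ G t := by
  rw [hy]
  exact Submodule.add_mem _
    (matAct_mem C (fun i => H.lagSpan_le_G hv t (hxv t i)) i) (matAct_mem D (hv t) i)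

omit hv hv0 hQ hst hA hAK in
include hy in
theorem zvec_output_mem {w : List α} (hw : w ≠ []) (t : ℤ) (i : Fin p) :
    zvec pr U y w t i ∈ lagSpan pr U v t := by
  refine H.zvec_mem_lagSpan_of (fun σ t i => ?_) hw t i
  have : U σ t (y t i) = vmap (U σ t) (y t) i := rfl
  rw [this, hy, vmap_add, vmap_matAct, vmap_matAct]
  exact Submodule.add_mem _ (matAct_mem C (fun i => H.U_mem_lagSpan_succ σ (hxv t i)) i)
    (matAct_mem D (fun i => H.U_proc_mem_lagSpan σ t i) i)

include hP hy in
theorem gram_output_zvec (σ : α) (w : List α) (t : ℤ) :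
    gram (y t) (zvec pr U y (σ :: w) t) = C * wordMat (fun σ => √(pr σ) • A σ) w *
      ((√(pr σ))⁻¹ • (A σ * P σ * C.transpose + K σ * Q σ * D.transpose)) := by
  have hx : ∀ t i, x t i ∈ G t := fun t i => H.lagSpan_le_G hv t (hxv t i)
  have hvy : ∀ w, w ≠ [] → ∀ t, gram (v t) (zvec pr U y w t) = 0 := by
    intro w hw t
    ext i j
    exact inner_lagSpan_eq_zero (fun w hw j => congrFun (congrFun (hv0 w hw t) i) j)
      (H.zvec_output_mem hxv hy hw t j)
  have key := H.gram_state_zvec (A := A) (K := K)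
    (b := fun σ => (√(pr σ))⁻¹ • (A σ * P σ * C.transpose + K σ * Q σ * D.transpose))
    (H.output_mem hv hxv hy) hx hv hst hvy (fun σ t => by
      rw [hy, vmap_add, gram_add_right, gram_add_right, vmap_matAct, vmap_matAct]
      simp only [gram_matAct_right, H.gram_state_U_noise hv hv0 hxv,
        H.gram_noise_U_state hv hv0 hxv, hQ, hP]
      simp [Matrix.mul_assoc]) hA
    (fun a σ h => by
      rw [Matrix.mul_smul, Matrix.mul_add, ← Matrix.mul_assoc, ← Matrix.mul_assoc,
        ← Matrix.mul_assoc, ← Matrix.mul_assoc, hA a σ h, hAK a σ h]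
      simp)
  rw [hy t, gram_add_left, gram_matAct_left, gram_matAct_left, hvy _ (by simp), Matrix.mul_zero,
    add_zero, key, Matrix.mul_assoc C]

end Driven

end SwitchedSpace
end Switched
end JMLSRS

namespace JMLSRS

section Innovation

variable {E : Type*} [NormedAddCommGroup E] [InnerProductSpace ℝ E] {α : Type*} {k l m n p : ℕ}

theorem norm_sq_sum_of_pairwise_inner_eq_zero {ι : Type*} (s : Finset ι) (f : ι → E)
    (h : ∀ a b, a ≠ b → (inner ℝ (f a) (f b) : ℝ) = 0) :
    ‖∑ a ∈ s, f a‖ ^ 2 = ∑ a ∈ s, ‖f a‖ ^ 2 := by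
  rw [← real_inner_self_eq_norm_sq, sum_inner]
  refine Finset.sum_congr rfl fun a ha => ?_
  rw [inner_sum, Finset.sum_eq_single a, real_inner_self_eq_norm_sq]
  · exact fun b _ hb => h a b hb.symm
  · exact fun h => absurd ha h

theorem norm_matAct_sq_le (A : Matrix (Fin k) (Fin l) ℝ) (f : Fin l → E) (i : Fin k) :
    ‖matAct A f i‖ ^ 2 ≤ (∑ j, A i j ^ 2) * ∑ j, ‖f j‖ ^ 2 := by
  have h1 : ‖matAct A f i‖ ≤ ∑ j, |A i j| * ‖f j‖ :=
    (norm_sum_le _ _).trans (Finset.sum_le_sum fun j _ => by rw [norm_smul, Real.norm_eq_abs])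
  have h2 := Finset.sum_mul_sq_le_sq_mul_sq Finset.univ (fun j => |A i j|) (fun j => ‖f j‖)
  simp only [sq_abs] at h2
  exact (pow_le_pow_left₀ (norm_nonneg _) h1 2).trans h2

variable [Fintype α]

namespace SwitchedSpace

variable {pr : α → ℝ} {S : Set (α × α)} {U : α → ℤ → E →L[ℝ] E} {G : ℤ → Submodule ℝ E}
  (H : SwitchedSpace pr S U G)

include H

theorem norm_U_sq (σ : α) (t : ℤ) (f : E) : ‖U σ t f‖ ^ 2 = inner ℝ f (U σ t f) := by
  rw [← real_inner_self_eq_norm_sq, H.symm, H.idem]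

theorem norm_U_le (σ : α) (t : ℤ) (f : E) : ‖U σ t f‖ ≤ ‖f‖ := by
  by_contra! h
  have h1 := H.norm_U_sq σ t f
  have h2 := real_inner_le_norm f (U σ t f)
  nlinarith [norm_nonneg f]

theorem norm_zvec_sq_le {r : ℤ → Fin k → E} (hr : ∀ t i, r t i ∈ G t) (w : List α) (t : ℤ)
    (i : Fin k) :
    ‖zvec pr U r w t i‖ ^ 2 ≤ (1 + ∑ σ, (pr σ)⁻¹) * ‖r (t - w.length) i‖ ^ 2 := by
  have hc : ∀ σ, (pr σ)⁻¹ ≤ 1 + ∑ σ, (pr σ)⁻¹ := fun σ => by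
    have := Finset.single_le_sum (f := fun σ => (pr σ)⁻¹)
      (fun σ _ => inv_nonneg.2 (H.pos σ).le) (Finset.mem_univ σ)
    linarith
  induction w using List.reverseRecOn generalizing t with
  | nil =>
    rw [zvec_nil]
    have : 0 ≤ ∑ σ, (pr σ)⁻¹ := Finset.sum_nonneg fun σ _ => inv_nonneg.2 (H.pos σ).le
    simp only [List.length_nil, Nat.cast_zero, sub_zero]
    nlinarith [sq_nonneg ‖r t i‖]
  | append_singleton w σ ih =>
    obtain ⟨t, rfl⟩ : ∃ s, t = s + 1 := ⟨t - 1, by ring⟩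
    have hlen : t + 1 - ((w ++ [σ]).length : ℤ) = t - w.length := by simp
    rw [hlen]
    obtain rfl | ⟨w, a, rfl⟩ := List.eq_nil_or_concat' w
    · rw [zvec_append_singleton, zvec_nil, Pi.smul_apply, norm_smul, mul_pow, norm_inv, inv_pow,
        Real.norm_eq_abs, sq_abs, Real.sq_sqrt (H.pos σ).le]
      simp only [List.length_nil, Nat.cast_zero, sub_zero]
      have := pow_le_pow_left₀ (norm_nonneg _) (H.norm_U_le σ t (r t i)) 2
      exact mul_le_mul (hc σ) this (sq_nonneg _) ((inv_nonneg.2 (H.pos σ).le).trans (hc σ))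
    · refine le_trans ?_ (ih t)
      have h1 := congrFun (congrFun (H.gram_zvec_append hr hr w (w ++ [a]) a σ t) i) i
      rw [gram_apply, real_inner_self_eq_norm_sq] at h1
      rw [h1]
      split_ifs
      · rw [gram_apply, real_inner_self_eq_norm_sq]
      · exact sq_nonneg _

theorem gram_zvec_eq_zero_of_length {r : ℤ → Fin k → E} (hr : ∀ t i, r t i ∈ G t)
    {w w' : List α} (hl : w.length = w'.length) (hne : w ≠ w') (t : ℤ) :
    gram (zvec pr U r w t) (zvec pr U r w' t) = 0 := by
  induction w using List.reverseRecOn generalizing t w' with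
  | nil => exact absurd (List.length_eq_zero_iff.1 hl.symm).symm hne
  | append_singleton w σ ih =>
    obtain ⟨t, rfl⟩ : ∃ s, t = s + 1 := ⟨t - 1, by ring⟩
    obtain rfl | ⟨w', τ, rfl⟩ := List.eq_nil_or_concat' w'
    · simp at hl
    by_cases hστ : σ = τ
    · subst hστ
      have hne' : w ≠ w' := fun h => hne (by rw [h])
      have hl' : w.length = w'.length := by simpa using hl
      obtain rfl | ⟨w, a, rfl⟩ := List.eq_nil_or_concat' w
      · exact absurd (List.length_eq_zero_iff.1 hl'.symm).symm hne'
      · rw [H.gram_zvec_append hr hr]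
        split_ifs
        · exact ih hl' hne' t
        · rfl
    · rw [H.gram_zvec_ne _ _ hστ]

variable {y : ℤ → Fin p → E} {x : ℤ → Fin n → E} {F : α → Matrix (Fin n) (Fin n) ℝ}
  {b : α → Matrix (Fin n) (Fin p) ℝ} {C : Matrix (Fin p) (Fin n) ℝ} {e : ℤ → Fin p → E}
  {T : α → Matrix (Fin p) (Fin p) ℝ}
  (hy : ∀ t i, y t i ∈ G t)
  (hT : ∀ σ t, gram (y t) (vmap (U σ t) (y t)) = T σ)
  (hzz : ∀ w w', w ≠ [] → w' ≠ [] → ∀ t s,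
    gram (zvec pr U y w t) (zvec pr U y w' t) = gram (zvec pr U y w s) (zvec pr U y w' s))
  (hxy : ∀ t i, x t i ∈ lagSpan pr U y t)
  (hx : ∀ σ w t, gram (x t) (zvec pr U y (σ :: w) t) = wordMat F w * b σ)
  (hF : ∀ a σ, (a, σ) ∉ S → F σ * F a = 0) (hFb : ∀ a σ, (a, σ) ∉ S → F σ * b a = 0)
  (he : ∀ t, y t = matAct C (x t) + e t)
  (he0 : ∀ w, w ≠ [] → ∀ t, gram (e t) (zvec pr U y w t) = 0)

omit H [Fintype α] in
include hx in
theorem gram_innovState_append {w : List α} (hw : w ≠ []) (σ : α) (t s : ℤ) :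
    gram (x t) (zvec pr U y (w ++ [σ]) t) = F σ * gram (x s) (zvec pr U y w s) := by
  obtain ⟨τ, w, rfl⟩ := List.exists_cons_of_ne_nil hw
  rw [List.cons_append, hx, hx, wordMat_append_singleton, Matrix.mul_assoc]

omit H [Fintype α] in
include hx hF hFb in
theorem mul_gram_innovState_eq_zero {a σ : α} (h : (a, σ) ∉ S) (w : List α) (t : ℤ) :
    F σ * gram (x t) (zvec pr U y (w ++ [a]) t) = 0 := by
  cases w with
  | nil => rw [List.nil_append, hx, wordMat, Matrix.one_mul, hFb a σ h]
  | cons τ w =>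
    rw [List.cons_append, hx, wordMat_append_singleton, ← Matrix.mul_assoc, ← Matrix.mul_assoc,
      hF a σ h, Matrix.zero_mul, Matrix.zero_mul]

include hy hx hF hFb in
theorem mul_gram_innovState_U (σ : α) {w : List α} (hw : w ≠ []) (t : ℤ) (hxt : ∀ i, x t i ∈ G t) :
    F σ * gram (x t) (vmap (U σ t) (zvec pr U y w t)) =
      pr σ • (F σ * gram (x t) (zvec pr U y w t)) := by
  obtain rfl | ⟨w, a, rfl⟩ := List.eq_nil_or_concat' w
  · exact absurd rfl hw
  rw [H.gram_vmap_zvec hy hxt]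
  split_ifs with h
  · rw [Matrix.mul_smul]
  · rw [mul_gram_innovState_eq_zero hx hF hFb h, Matrix.mul_zero, smul_zero]

include hy hzz hxy hx in
theorem gram_innovState_stationary (σ : α) (t s : ℤ) :
    gram (x t) (vmap (U σ t) (x t)) = gram (x s) (vmap (U σ s) (x s)) := by
  have h1 : ∀ w, w ≠ [] → ∀ t s, gram (x t) (zvec pr U y w t) = gram (x s) (zvec pr U y w s) := by
    intro w hw t s
    obtain ⟨τ, w, rfl⟩ := List.exists_cons_of_ne_nil hw
    rw [hx, hx]
  exact H.gram_U_stationary hy hzz hxy hxy h1 h1 σ t s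

variable {P : α → Matrix (Fin n) (Fin n) ℝ} (hP : ∀ σ t, gram (x t) (vmap (U σ t) (x t)) = P σ)

include hy hxy he he0

omit he0 in
theorem innov_mem (t : ℤ) (i : Fin p) : e t i ∈ G t := by
  have h1 : e t i = y t i - matAct C (x t) i := by rw [he t]; simp
  rw [h1]
  exact Submodule.sub_mem _ (hy t i)
    (matAct_mem C (fun i => H.lagSpan_le_G hy t (hxy t i)) i)

theorem gram_state_U_innov (σ : α) (t : ℤ) : gram (x t) (vmap (U σ t) (e t)) = 0 :=
  H.gram_U_eq_zero hy (H.innov_mem hy hxy he t) (fun w hw => he0 w hw t) (hxy t) σ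

theorem gram_innov_U_state (σ : α) (t : ℤ) : gram (e t) (vmap (U σ t) (x t)) = 0 := by
  rw [← H.gram_vmap, ← gram_transpose, H.gram_state_U_innov hy hxy he he0, Matrix.transpose_zero]

include hT hP in
theorem gram_innov_U (σ : α) (t : ℤ) :
    gram (e t) (vmap (U σ t) (e t)) = T σ - C * P σ * C.transpose := by
  rw [← hT σ t, he t, vmap_add, gram_add_left, gram_add_right, gram_add_right, vmap_matAct]
  simp only [gram_matAct_left, gram_matAct_right, H.gram_state_U_innov hy hxy he he0,
    H.gram_innov_U_state hy hxy he he0, hP]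
  simp [Matrix.mul_assoc]

omit hy he he0 in
include hy hx hF hFb in
theorem gram_innovState_succ_U_state (σ : α) (t : ℤ) :
    gram (x (t + 1)) (vmap (U σ t) (x t)) =
      (√(pr σ))⁻¹ • (F σ * gram (x t) (vmap (U σ t) (x t))) := by
  have hxG : ∀ i, x t i ∈ G t := fun i => H.lagSpan_le_G hy t (hxy t i)
  have h1 : ∀ w, w ≠ [] → gram (vmap (U σ t) (x (t + 1)) -
      (√(pr σ))⁻¹ • vmap (U σ t) (matAct (F σ) (x t))) (zvec pr U y w t) = 0 := by
    intro w hw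
    have h2 := gram_innovState_append hx hw σ (t + 1) t
    rw [zvec_append_singleton, gram_smul_right, inv_smul_eq_iff₀ (H.sqrt_ne_zero σ)] at h2
    rw [gram_sub_left, gram_smul_left, H.gram_vmap, H.gram_vmap, h2, gram_matAct_left,
      H.mul_gram_innovState_U hy hx hF hFb σ hw t hxG, smul_smul, ← sub_smul, inv_mul_eq_div,
      Real.div_sqrt, sub_self, zero_smul]
  have h3 : gram (vmap (U σ t) (x (t + 1)) -
      (√(pr σ))⁻¹ • vmap (U σ t) (matAct (F σ) (x t))) (x t) = 0 := by
    ext i j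
    exact inner_lagSpan_eq_zero (fun w hw j => congrFun (congrFun (h1 w hw) i) j) (hxy t j)
  rw [gram_sub_left, gram_smul_left, H.gram_vmap, H.gram_vmap, gram_matAct_left] at h3
  exact sub_eq_zero.1 h3

omit he0 in
include hx hF hFb hP in
theorem gram_innovState_succ_U_innov (σ : α) (t : ℤ) :
    gram (x (t + 1)) (vmap (U σ t) (e t)) =
      √(pr σ) • b σ - (√(pr σ))⁻¹ • (F σ * P σ * C.transpose) := by
  have h1 : gram (x (t + 1)) (vmap (U σ t) (y t)) = √(pr σ) • b σ := by
    have h2 := hx σ [] (t + 1)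
    rw [← List.nil_append [σ], zvec_append_singleton, zvec_nil, gram_smul_right,
      inv_smul_eq_iff₀ (H.sqrt_ne_zero σ)] at h2
    rw [h2, wordMat, Matrix.one_mul]
  have h2 : e t = y t - matAct C (x t) := by rw [he t]; simp
  rw [h2, vmap_sub, gram_sub_right, h1, vmap_matAct, gram_matAct_right,
    H.gram_innovState_succ_U_state hy hxy hx hF hFb, hP, Matrix.smul_mul]

include hT hx hF hFb hP in
theorem exists_gain : ∃ K : α → Matrix (Fin n) (Fin p) ℝ, ∀ σ,
    K σ * (T σ - C * P σ * C.transpose) =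
      √(pr σ) • b σ - (√(pr σ))⁻¹ • (F σ * P σ * C.transpose) := by
  have h : ∀ σ, ∃ K : Matrix (Fin n) (Fin p) ℝ, K * (T σ - C * P σ * C.transpose) =
      √(pr σ) • b σ - (√(pr σ))⁻¹ • (F σ * P σ * C.transpose) := by
    intro σ
    obtain ⟨K, hK⟩ := exists_mul_gram_eq (vmap (U σ 0) (e 0)) (vmap (U σ 0) (x (0 + 1)))
    refine ⟨K, ?_⟩
    rwa [H.gram_vmap_self, H.gram_vmap_self,
      H.gram_innovState_succ_U_innov hy hxy hx hF hFb he hP,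
      H.gram_innov_U hy hT hxy he he0 hP] at hK
  choose K hK using h
  exact ⟨K, hK⟩

variable {K : α → Matrix (Fin n) (Fin p) ℝ}
  (hK : ∀ σ, K σ * (T σ - C * P σ * C.transpose) =
    √(pr σ) • b σ - (√(pr σ))⁻¹ • (F σ * P σ * C.transpose))

omit hy he0 in
theorem U_innov_mem_lagSpan (σ : α) (t : ℤ) (i : Fin p) :
    U σ t (e t i) ∈ lagSpan pr U y (t + 1) := by
  have h1 : e t i = y t i - matAct C (x t) i := by rw [he t]; simp
  rw [h1, map_sub]
  exact Submodule.sub_mem _ (H.U_proc_mem_lagSpan σ t i)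
    (H.U_mem_lagSpan_succ σ (matAct_mem C (hxy t) i))

include hT hx hF hFb hP hK in
theorem innov_state_eq (t : ℤ) :
    x (t + 1) = ∑ σ, vmap (U σ t) (matAct ((√(pr σ))⁻¹ • F σ) (x t) + matAct (K σ) (e t)) := by
  have hxG : ∀ t i, x t i ∈ G t := fun t i => H.lagSpan_le_G hy t (hxy t i)
  have hg : ∀ w, w ≠ [] → gram (x (t + 1)) (zvec pr U y w (t + 1)) =
      gram (∑ σ, vmap (U σ t) (matAct ((√(pr σ))⁻¹ • F σ) (x t) + matAct (K σ) (e t)))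
        (zvec pr U y w (t + 1)) := by
    intro w hw
    obtain rfl | ⟨w, σ, rfl⟩ := List.eq_nil_or_concat' w
    · exact absurd rfl hw
    rw [H.gram_step_zvec, gram_matAct_left, gram_matAct_left]
    by_cases hw' : w = []
    · subst hw'
      rw [zvec_nil, he t, vmap_add, gram_add_right, gram_add_right, vmap_matAct,
        gram_matAct_right, gram_matAct_right, H.gram_state_U_innov hy hxy he he0,
        H.gram_innov_U_state hy hxy he he0, H.gram_innov_U hy hT hxy he he0 hP, hP,
        Matrix.zero_mul, zero_add, hK, add_zero, List.nil_append, hx, wordMat, Matrix.one_mul,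
        Matrix.smul_mul, Matrix.mul_assoc, add_sub_cancel, smul_smul,
        inv_mul_cancel₀ (H.sqrt_ne_zero σ), one_smul]
    · have h2 : gram (e t) (vmap (U σ t) (zvec pr U y w t)) = 0 := by
        obtain rfl | ⟨w, a, rfl⟩ := List.eq_nil_or_concat' w
        · exact absurd rfl hw'
        rw [H.gram_vmap_zvec hy (H.innov_mem hy hxy he t), he0 _ hw']
        simp
      rw [h2, Matrix.mul_zero, add_zero, Matrix.smul_mul,
        H.mul_gram_innovState_U hy hx hF hFb σ hw' t (hxG t), smul_smul, smul_smul,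
        H.sqrt_inv_mul_self, inv_mul_cancel₀ (H.pos σ).ne', one_smul,
        gram_innovState_append hx hw' σ (t + 1) t]
  funext i
  refine eq_of_inner_zvec (hxy _ i) ?_ fun w hw j => congrFun (congrFun (hg w hw) i) j
  rw [Finset.sum_apply]
  refine Submodule.sum_mem _ fun σ _ => ?_
  rw [vmap_add, vmap_matAct, vmap_matAct]
  exact Submodule.add_mem _ (matAct_mem _ (fun i => H.U_mem_lagSpan_succ σ (hxy t i)) i)
    (matAct_mem _ (fun i => H.U_innov_mem_lagSpan hxy he σ t i) i)

omit hy he0 in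
theorem zvec_innov_mem {w : List α} (hw : w ≠ []) (t : ℤ) (i : Fin p) :
    zvec pr U e w t i ∈ lagSpan pr U y t :=
  H.zvec_mem_lagSpan_of (H.U_innov_mem_lagSpan hxy he) hw t i

omit hy in
theorem gram_innov_zvec {w : List α} (hw : w ≠ []) (t : ℤ) :
    gram (e t) (zvec pr U e w t) = 0 := by
  ext i j
  exact inner_lagSpan_eq_zero (fun w hw j => congrFun (congrFun (he0 w hw t) i) j)
    (H.zvec_innov_mem hxy he hw t j)

end SwitchedSpace

/-- The part of the state at time `t` stemming from the state at time `t - N`. -/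
noncomputable def remainder (pr : α → ℝ) (U : α → ℤ → E →L[ℝ] E)
    (F : α → Matrix (Fin n) (Fin n) ℝ) (x : ℤ → Fin n → E) (N : ℕ) (t : ℤ) : Fin n → E :=
  wordSum N fun w => matAct (wordMat F w) (zvec pr U x w t)

namespace SwitchedSpace

variable {pr : α → ℝ} {S : Set (α × α)} {U : α → ℤ → E →L[ℝ] E} {G : ℤ → Submodule ℝ E}
  (H : SwitchedSpace pr S U G) {x : ℤ → Fin n → E} {e : ℤ → Fin p → E}
  {F : α → Matrix (Fin n) (Fin n) ℝ} {K : α → Matrix (Fin n) (Fin p) ℝ}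
  (hst : ∀ t, x (t + 1) =
    ∑ σ, vmap (U σ t) (matAct ((√(pr σ))⁻¹ • F σ) (x t) + matAct (K σ) (e t)))

include H hst

theorem remainder_sub_mem (N : ℕ) (t : ℤ) (i : Fin n) :
    x t i - remainder pr U F x N t i ∈ lagSpan pr U e t := by
  induction N with
  | zero => simp [remainder, wordSum_zero, wordMat, zvec_nil, matAct_one]
  | succ N ih =>
    have key : remainder pr U F x N t = remainder pr U F x (N + 1) t +
        ∑ σ, wordSum N fun w => matAct (wordMat F w * (√(pr σ) • K σ))
          (zvec pr U e (σ :: w) t) := by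
      rw [remainder, remainder, wordSum_succ, ← Finset.sum_add_distrib]
      simp only [wordSum]
      simp only [← Finset.sum_add_distrib]
      rw [Finset.sum_comm]
      refine Finset.sum_congr rfl fun g _ => ?_
      set w := List.ofFn g
      have hs : t - ((w.length : ℤ)) = (t - w.length - 1) + 1 := by ring
      have h1 : zvec pr U x w t = ∑ σ, (matAct (F σ) (zvec pr U x (σ :: w) t) +
          matAct (√(pr σ) • K σ) (zvec pr U e (σ :: w) t)) := by
        have h2 : ∀ {k : ℕ} (q : ℤ → Fin k → E) (σ : α), zvec pr U q (σ :: w) t =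
            (√(pr σ))⁻¹ • vmap (wordOp pr U w t) (vmap (U σ (t - w.length - 1))
              (q (t - w.length - 1))) := by
          intro k q σ
          have h3 : t - ((σ :: w).length : ℤ) = t - w.length - 1 := by
            push_cast [List.length_cons]; ring
          funext i
          simp only [zvec, vmap, h3, wordOp, Pi.smul_apply, ContinuousLinearMap.comp_apply,
            _root_.smul_apply, map_smul]
        have h4 : zvec pr U x w t = vmap (wordOp pr U w t) (x (t - w.length)) := rfl
        rw [h4, hs, hst]
        have h5 : ∀ q : α → Fin n → E, vmap (wordOp pr U w t) (∑ σ, q σ) =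
            ∑ σ, vmap (wordOp pr U w t) (q σ) := by
          intro q
          funext i
          simp [vmap]
        rw [h5]
        refine Finset.sum_congr rfl fun σ _ => ?_
        rw [h2, h2, vmap_add, vmap_add, vmap_matAct, vmap_matAct, vmap_matAct, vmap_matAct,
          matAct_smul_mat, matAct_smul_mat]
        congr 1
        · funext i
          simp [matAct, Finset.smul_sum, smul_smul, mul_comm]
        · funext i
          simp only [matAct, Pi.smul_apply, Finset.smul_sum, smul_smul]
          refine Finset.sum_congr rfl fun j _ => ?_
          congr 1
          field_simp [H.sqrt_ne_zero σ]
      have h6 : ∀ (M : Matrix (Fin n) (Fin n) ℝ) (q : α → Fin n → E),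
          matAct M (∑ σ, q σ) = ∑ σ, matAct M (q σ) := by
        intro M q
        funext i
        simp only [matAct, Finset.sum_apply, Finset.smul_sum]
        exact Finset.sum_comm
      rw [h1, h6]
      refine Finset.sum_congr rfl fun σ _ => ?_
      rw [matAct_add, matAct_matAct, matAct_matAct, wordMat]
    have h7 : x t i - remainder pr U F x (N + 1) t i = (x t i - remainder pr U F x N t i) +
        (∑ σ, wordSum N fun w => matAct (wordMat F w * (√(pr σ) • K σ))
          (zvec pr U e (σ :: w) t)) i := by
      rw [key, Pi.add_apply]
      abel
    rw [h7]
    refine Submodule.add_mem _ ih ?_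
    simp only [wordSum, Finset.sum_apply]
    exact Submodule.sum_mem _ fun σ _ => Submodule.sum_mem _ fun g _ =>
      matAct_mem _ (fun i => zvec_mem_lagSpan _ _ _ _ (by simp) i) i

omit hst in
theorem norm_remainder_sq_le (hx : ∀ t i, x t i ∈ G t) (N : ℕ) (t : ℤ) (i : Fin n) :
    ‖remainder pr U F x N t i‖ ^ 2 ≤ (∑ j, wordSum N fun w => wordMat F w i j ^ 2) *
      ((1 + ∑ σ, (pr σ)⁻¹) * ∑ j, ‖x (t - N) j‖ ^ 2) := by
  rw [remainder, wordSum, Finset.sum_apply, norm_sq_sum_of_pairwise_inner_eq_zero]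
  · simp only [wordSum]
    rw [Finset.sum_comm, Finset.sum_mul]
    refine Finset.sum_le_sum fun g _ => (norm_matAct_sq_le _ _ _).trans ?_
    refine mul_le_mul_of_nonneg_left ?_ (Finset.sum_nonneg fun _ _ => sq_nonneg _)
    rw [Finset.mul_sum]
    refine Finset.sum_le_sum fun j _ => ?_
    have := H.norm_zvec_sq_le hx (List.ofFn g) t j
    rwa [List.length_ofFn] at this
  · intro g g' hgg
    have h0 := H.gram_zvec_eq_zero_of_length hx (w := List.ofFn g) (w' := List.ofFn g')
      (by simp) (fun h => hgg (List.ofFn_injective h)) t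
    have := gram_matAct_left (wordMat F (List.ofFn g)) (zvec pr U x (List.ofFn g) t)
      (matAct (wordMat F (List.ofFn g')) (zvec pr U x (List.ofFn g') t))
    rw [gram_matAct_right _ (zvec pr U x (List.ofFn g) t), h0, Matrix.zero_mul,
      Matrix.mul_zero] at this
    exact congrFun (congrFun this i) i

theorem innovState_mem_lagSpan (hx : ∀ t i, x t i ∈ G t)
    (hP : ∀ σ t s, gram (x t) (vmap (U σ t) (x t)) = gram (x s) (vmap (U σ s) (x s)))
    (hF : ∀ i j, Summable fun w : List α => wordMat F w i j ^ 2) (t : ℤ) (i : Fin n) :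
    x t i ∈ lagSpan pr U e t := by
  have hnorm : ∀ s j, ‖x s j‖ ^ 2 = ‖x 0 j‖ ^ 2 := by
    have h1 : ∀ s j, ‖x s j‖ ^ 2 = ∑ σ, gram (x s) (vmap (U σ s) (x s)) j j := by
      intro s j
      simp only [gram, Matrix.of_apply, vmap]
      rw [← inner_sum, H.sum, real_inner_self_eq_norm_sq]
    intro s j
    rw [h1, h1]
    exact Finset.sum_congr rfl fun σ _ => by rw [hP σ s 0]
  have hlim : Filter.Tendsto (fun N => ‖remainder pr U F x N t i‖ ^ 2) Filter.atTop (nhds 0) := by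
    refine squeeze_zero (fun N => sq_nonneg _) (fun N => H.norm_remainder_sq_le hx N t i) ?_
    simp only [hnorm]
    have : Filter.Tendsto (fun N => ∑ j, wordSum N fun w => wordMat F w i j ^ 2) Filter.atTop
        (nhds (∑ j : Fin n, (0 : ℝ))) :=
      tendsto_finsetSum _ fun j _ => tendsto_wordSum (fun w => sq_nonneg _) (hF i j)
    simpa using this.mul_const ((1 + ∑ σ, (pr σ)⁻¹) * ∑ j, ‖x 0 j‖ ^ 2)
  have hlim' : Filter.Tendsto (fun N => x t i - remainder pr U F x N t i) Filter.atTop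
      (nhds (x t i)) := by
    have h1 : Filter.Tendsto (fun N => remainder pr U F x N t i) Filter.atTop (nhds 0) := by
      rw [tendsto_zero_iff_norm_tendsto_zero]
      have := hlim.sqrt
      simpa [Real.sqrt_sq (norm_nonneg _)] using this
    simpa using h1.const_sub (x t i)
  exact (isClosed_lagSpan _ _ _ _).mem_of_tendsto hlim'
    (Filter.Eventually.of_forall fun N => H.remainder_sub_mem hst N t i)

end SwitchedSpace

end Innovation
end JMLSRS

namespace JMLSRS

section CondIndep

variable {Ω : Type*} {m m' m₁ m₂ : MeasurableSpace Ω} {m0 : MeasurableSpace Ω} {μ : Measure Ω}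

/-- The indicator function of a set. -/
noncomputable def ind (B : Set Ω) : Ω → ℝ := B.indicator fun _ => (1 : ℝ)

theorem integrable_ind [IsFiniteMeasure μ] {B : Set Ω} (hB : MeasurableSet B) :
    Integrable (ind B) μ :=
  (integrable_const (1 : ℝ)).indicator hB

theorem ind_inter (A B : Set Ω) : ind (A ∩ B) = ind A * ind B := by
  funext ω
  by_cases hA : ω ∈ A <;> by_cases hB : ω ∈ B <;> simp [ind, hA, hB]

theorem mul_ind (f : Ω → ℝ) (A : Set Ω) : f * ind A = A.indicator f := by
  funext ω
  by_cases hA : ω ∈ A <;> simp [ind, hA]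

theorem ind_congr {A A' : Set Ω} (h : A =ᵐ[μ] A') : ind A =ᵐ[μ] ind A' :=
  indicator_ae_eq_of_ae_eq_set h

theorem sup_eq_generateFrom (m₁ m₂ : MeasurableSpace Ω) :
    m₁ ⊔ m₂ = MeasurableSpace.generateFrom
      {s | ∃ A D, MeasurableSet[m₁] A ∧ MeasurableSet[m₂] D ∧ s = A ∩ D} := by
  refine le_antisymm (sup_le ?_ ?_) (MeasurableSpace.generateFrom_le ?_)
  · intro A hA
    exact MeasurableSpace.measurableSet_generateFrom
      ⟨A, Set.univ, hA, @MeasurableSet.univ _ m₂, by simp⟩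
  · intro D hD
    exact MeasurableSpace.measurableSet_generateFrom
      ⟨Set.univ, D, @MeasurableSet.univ _ m₁, hD, by simp⟩
  · rintro _ ⟨A, D, hA, hD, rfl⟩
    exact @MeasurableSet.inter _ (m₁ ⊔ m₂) _ _
      ((le_sup_left : m₁ ≤ m₁ ⊔ m₂) A hA) ((le_sup_right : m₂ ≤ m₁ ⊔ m₂) D hD)

/-- Conditional independence allows to enlarge the conditioning σ-algebra. -/
theorem CondIndepSigma.condExp_sup [IsFiniteMeasure μ]
    (h : CondIndepSigma μ m' m₁ m₂) (hm' : m' ≤ m0) (hm₁ : m₁ ≤ m0) (hm₂ : m₂ ≤ m0) {B : Set Ω}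
    (hB : MeasurableSet[m₂] B) : μ[ind B | m₁ ⊔ m'] =ᵐ[μ] μ[ind B | m'] := by
  have hBi : Integrable (ind B) μ := integrable_ind (hm₂ B hB)
  have hle : m₁ ⊔ m' ≤ m0 := sup_le hm₁ hm'
  symm
  refine ae_eq_condExp_of_forall_setIntegral_eq hle hBi
    (fun s _ _ => integrable_condExp.integrableOn) ?_
    ((stronglyMeasurable_condExp.mono (le_sup_right : m' ≤ m₁ ⊔ m')).aestronglyMeasurable)
  intro s hs _
  refine MeasurableSpace.induction_on_inter
    (C := fun s _ => ∫ x in s, (μ[ind B|m']) x ∂μ = ∫ x in s, ind B x ∂μ)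
    (sup_eq_generateFrom m₁ m') ?_ ?_ ?_ ?_ ?_ s hs
  · rintro _ ⟨A, D, hA, hD, rfl⟩ _ ⟨A', D', hA', hD', rfl⟩ _
    exact ⟨A ∩ A', D ∩ D', @MeasurableSet.inter _ m₁ _ _ hA hA',
      @MeasurableSet.inter _ m' _ _ hD hD', Set.inter_inter_inter_comm _ _ _ _⟩
  · simp
  · rintro _ ⟨A, D, hA, hD, rfl⟩
    have hAi : Integrable (ind A) μ := integrable_ind (hm₁ A hA)
    have hABi : Integrable (ind A * ind B) μ := by
      rw [← ind_inter]; exact integrable_ind ((hm₁ A hA).inter (hm₂ B hB))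
    have hAEi : Integrable (ind A * μ[ind B|m']) μ := by
      rw [mul_comm, mul_ind]; exact integrable_condExp.indicator (hm₁ A hA)
    have hrw : ∀ f : Ω → ℝ, ∫ x in A ∩ D, f x ∂μ = ∫ x in D, (ind A * f) x ∂μ := by
      intro f
      rw [mul_comm, mul_ind, setIntegral_indicator (hm₁ A hA), Set.inter_comm]
    rw [hrw, hrw, ← setIntegral_condExp hm' hAEi hD, ← setIntegral_condExp hm' hABi hD]
    refine integral_congr_ae (ae_restrict_of_ae ?_)
    have h1 := condExp_mul_of_stronglyMeasurable_right (m := m') (μ := μ) (f := ind A)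
      stronglyMeasurable_condExp hAEi hAi
    have h2 := h A B hA hB
    rw [← ind_inter]
    exact h1.trans h2.symm
  · intro t ht hC
    have h1 := integral_add_compl (hle t ht) (integrable_condExp (m := m') (f := ind B) (μ := μ))
    have h2 := integral_add_compl (hle t ht) hBi
    rw [integral_condExp hm'] at h1
    linarith
  · intro f hd hf hC
    rw [integral_iUnion (fun i => hle _ (hf i)) hd integrable_condExp.integrableOn,
      integral_iUnion (fun i => hle _ (hf i)) hd hBi.integrableOn]
    simp only [hC]

/-- Sets which agree almost everywhere with sets in `m` are conditionally independent of `m₂` if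
`m` does not contribute to the prediction of events in `m₂`. -/
theorem condIndepSigma_of_condExp [IsFiniteMeasure μ]
    (hle : m' ≤ m) (hm : m ≤ m0) (hm₂ : m₂ ≤ m0)
    (h : ∀ B, MeasurableSet[m₂] B → μ[ind B | m] =ᵐ[μ] μ[ind B | m'])
    (h₁ : ∀ A, MeasurableSet[m₁] A → ∃ A', MeasurableSet[m] A' ∧ A =ᵐ[μ] A') :
    CondIndepSigma μ m' m₁ m₂ := by
  intro A B hA hB
  obtain ⟨A', hA', hAA⟩ := h₁ A hA
  have hBi : Integrable (ind B) μ := integrable_ind (hm₂ B hB)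
  have hAi : Integrable (ind A') μ := integrable_ind (hm A' hA')
  have hABi : Integrable (ind A' * ind B) μ := by
    rw [← ind_inter]; exact integrable_ind ((hm A' hA').inter (hm₂ B hB))
  have hAEi : Integrable (ind A' * μ[ind B|m']) μ := by
    rw [mul_comm, mul_ind]; exact integrable_condExp.indicator (hm A' hA')
  change μ[ind (A ∩ B)|m'] =ᵐ[μ] μ[ind A|m'] * μ[ind B|m']
  have e1 : ind (A ∩ B) =ᵐ[μ] ind A' * ind B := by
    rw [ind_inter]; exact (ind_congr hAA).mul (Filter.EventuallyEq.refl _ _)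
  have e2 : μ[ind A|m'] =ᵐ[μ] μ[ind A'|m'] := condExp_congr_ae (ind_congr hAA)
  have e3 : μ[ind A' * ind B|m] =ᵐ[μ] ind A' * μ[ind B|m] :=
    condExp_mul_of_stronglyMeasurable_left
      (StronglyMeasurable.indicator stronglyMeasurable_const hA') hABi hBi
  have e4 : μ[ind A' * ind B|m] =ᵐ[μ] ind A' * μ[ind B|m'] :=
    e3.trans ((Filter.EventuallyEq.refl _ _).mul (h B hB))
  have e5 : μ[ind A' * μ[ind B|m']|m'] =ᵐ[μ] μ[ind A'|m'] * μ[ind B|m'] :=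
    condExp_mul_of_stronglyMeasurable_right stronglyMeasurable_condExp hAEi hAi
  calc μ[ind (A ∩ B)|m'] =ᵐ[μ] μ[ind A' * ind B|m'] := condExp_congr_ae e1
    _ =ᵐ[μ] μ[μ[ind A' * ind B|m]|m'] := (condExp_condExp_of_le hle hm).symm
    _ =ᵐ[μ] μ[ind A' * μ[ind B|m']|m'] := condExp_congr_ae e4
    _ =ᵐ[μ] μ[ind A'|m'] * μ[ind B|m'] := e5
    _ =ᵐ[μ] μ[ind A|m'] * μ[ind B|m'] := e2.symm.mul (Filter.EventuallyEq.refl _ _)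

theorem CondIndepSigma.symm (h : CondIndepSigma μ m' m₁ m₂) :
    CondIndepSigma μ m' m₂ m₁ := by
  intro A B hA hB
  have := h B A hB hA
  rw [Set.inter_comm] at this
  filter_upwards [this] with ω hω
  rw [hω, mul_comm]

/-- The σ-algebra generated by variables which are a.e. measurable with respect to `m` consists of
sets which agree almost everywhere with sets in `m`. -/
theorem exists_ae_eq_of_sigmaGen {k : ℕ} {q : ℤ → Ω → Fin k → ℝ} {I : Set ℤ}
    (hq : ∀ t ∈ I, ∀ i, AEStronglyMeasurable[m] (fun ω => q t ω i) μ) {A : Set Ω}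
    (hA : MeasurableSet[sigmaGen q I] A) : ∃ A', MeasurableSet[m] A' ∧ A =ᵐ[μ] A' := by
  have hle : sigmaGen q I ≤ @eventuallyMeasurableSpace Ω m (ae μ) _ := by
    refine iSup₂_le fun t ht => ?_
    rintro _ ⟨C, hC, rfl⟩
    choose g hg hqg using hq t ht
    have hgm : @Measurable _ _ m _ fun ω i => g i ω :=
      @measurable_pi_lambda _ _ _ m _ _ fun i => (hg i).measurable
    refine ⟨(fun ω i => g i ω) ⁻¹' C, hgm hC, ?_⟩
    have : ∀ᵐ ω ∂μ, ∀ i, q t ω i = g i ω := ae_all_iff.2 hqg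
    filter_upwards [this] with ω hω
    have h1 : q t ω = fun i => g i ω := funext hω
    have : (ω ∈ q t ⁻¹' C) = (ω ∈ (fun ω i => g i ω) ⁻¹' C) := by
      simp only [Set.mem_preimage, h1]
    exact this
  exact hle A hA

end CondIndep

section Switching

variable {Ω α : Type*} {m : MeasurableSpace Ω} [m0 : MeasurableSpace Ω] {μ : Measure Ω} [IsProbabilityMeasure μ]
  [Fintype α] [MeasurableSpace α] [DiscreteMeasurableSpace α] {pr : α → ℝ} {S : Set (α × α)}
  {θ : ℤ → Ω → α}

theorem sigmaGen_le {X : Type*} [MeasurableSpace X] {r : ℤ → Ω → X} (hr : ∀ t, Measurable (r t))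
    (I : Set ℤ) : sigmaGen r I ≤ m0 :=
  iSup₂_le fun t _ => (hr t).comap_le

theorem measurable_sigmaGen {Ω : Type*} {X : Type*} [MeasurableSpace X] (r : ℤ → Ω → X) {I : Set ℤ} {t : ℤ}
    (ht : t ∈ I) : @Measurable _ _ (sigmaGen r I) _ (r t) :=
  (comap_measurable (r t)).mono (le_iSup₂_of_le t ht le_rfl) le_rfl

theorem sigmaGen_mono {Ω : Type*} {X : Type*} [MeasurableSpace X] (r : ℤ → Ω → X) {I J : Set ℤ} (h : I ⊆ J) :
    sigmaGen r I ≤ sigmaGen r J :=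
  biSup_mono h

omit m0 [IsProbabilityMeasure μ] [Fintype α] [MeasurableSpace α] [DiscreteMeasurableSpace α] in
theorem switchInput_eq_ind (θ : ℤ → Ω → α) (σ : α) (t : ℤ) :
    switchInput θ σ t = ind (θ t ⁻¹' {σ}) := rfl

omit [Fintype α] in
/-- A predictor of the next value of the switching process. -/
theorem IsRestrictedSwitching.exists_condExp_eq (hθ : IsRestrictedSwitching μ pr S θ) (t : ℤ)
    (σ : α) : ∃ h : α → ℝ,
      μ[switchInput θ σ (t + 1) | sigmaGen θ (Set.Iio (t + 1))] =ᵐ[μ] (fun ω => h (θ t ω)) ∧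
      ∀ a, μ (θ t ⁻¹' {a}) ≠ 0 → h a = open Classical in if (a, σ) ∈ S then pr σ else 0 := by
  classical
  have hle : sigmaGen θ {t} ≤ m0 := sigmaGen_le hθ.meas _
  have heq : sigmaGen θ {t} = MeasurableSpace.comap (θ t) inferInstance := by simp [sigmaGen]
  have hsm : StronglyMeasurable[sigmaGen θ {t}] (μ[switchInput θ σ (t + 1)|sigmaGen θ {t}]) :=
    stronglyMeasurable_condExp
  rw [heq] at hsm
  obtain ⟨h, -, hh⟩ := hsm.exists_eq_measurable_comp
  have hIio : Set.Iio (t + 1) = Set.Iic t := by ext s; simp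
  refine ⟨h, ?_, fun a ha => ?_⟩
  · rw [hIio]
    refine (hθ.markov t σ).trans (Filter.EventuallyEq.of_eq ?_)
    have : μ[(θ (t + 1) ⁻¹' {σ}).indicator (fun _ => (1 : ℝ)) | sigmaGen θ {t}] =
        μ[switchInput θ σ (t + 1)|sigmaGen θ {t}] := rfl
    rw [this, heq, hh]
    rfl
  · have hma : MeasurableSet[sigmaGen θ {t}] (θ t ⁻¹' {a}) :=
      measurable_sigmaGen θ (Set.mem_singleton t) (MeasurableSet.of_discrete)
    have hms : MeasurableSet (θ (t + 1) ⁻¹' {σ}) := hθ.meas _ (MeasurableSet.of_discrete)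
    have h1 := setIntegral_condExp hle (integrable_ind (μ := μ) hms) hma
    have h2 : ∫ x in θ t ⁻¹' {a}, (μ[ind (θ (t + 1) ⁻¹' {σ})|sigmaGen θ {t}]) x ∂μ =
        μ.real (θ t ⁻¹' {a}) * h a := by
      have : ∀ x ∈ θ t ⁻¹' {a}, (μ[ind (θ (t + 1) ⁻¹' {σ})|sigmaGen θ {t}]) x = h a := by
        intro x hx
        rw [heq, ← switchInput_eq_ind, hh]
        simp only [Function.comp_apply]
        rw [show θ t x = a from hx]
      rw [setIntegral_congr_fun (hle _ hma) this, setIntegral_const, smul_eq_mul]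
    have h3 : ∫ x in θ t ⁻¹' {a}, ind (θ (t + 1) ⁻¹' {σ}) x ∂μ =
        μ.real (θ t ⁻¹' {a} ∩ θ (t + 1) ⁻¹' {σ}) := by
      rw [ind, setIntegral_indicator hms, setIntegral_const, smul_eq_mul, mul_one]
    have h4 : (ProbabilityTheory.cond μ (θ t ⁻¹' {a})).real (θ (t + 1) ⁻¹' {σ}) =
        (μ.real (θ t ⁻¹' {a}))⁻¹ * μ.real (θ t ⁻¹' {a} ∩ θ (t + 1) ⁻¹' {σ}) :=
      by rw [Measure.real, ProbabilityTheory.cond_apply (hle _ hma), ENNReal.toReal_mul,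
        ENNReal.toReal_inv, Measure.real, Measure.real]
    have h5 : μ.real (θ t ⁻¹' {a}) ≠ 0 := by
      rw [Measure.real, ENNReal.toReal_ne_zero]
      exact ⟨ha, measure_ne_top _ _⟩
    have h6 : h a = (ProbabilityTheory.cond μ (θ t ⁻¹' {a})).real (θ (t + 1) ⁻¹' {σ}) := by
      rw [h4, ← h3, ← h1, h2, inv_mul_cancel_left₀ h5]
    rw [h6]
    split_ifs with hS
    · exact hθ.trans_mem t a σ ha hS
    · exact hθ.trans_not_mem t a σ ha hS

/-- The prediction of the future of `θ` from `m` depends on the past of `θ` only. -/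
def FutureIndep (μ : Measure Ω) (θ : ℤ → Ω → α) (t : ℤ) (m : MeasurableSpace Ω) : Prop :=
  ∀ B, MeasurableSet[sigmaGen θ (Set.Ici t)] B →
    μ[ind B | m] =ᵐ[μ] μ[ind B | sigmaGen θ (Set.Iio t)]

theorem IsRestrictedSwitching.integral_mul_switchInput (hθ : IsRestrictedSwitching μ pr S θ)
    {t : ℤ} (hm : m ≤ m0) (hf : FutureIndep μ θ (t + 1) m) {F : Ω → ℝ}
    (hF : Integrable F μ) (hFm : AEStronglyMeasurable[m] F μ) (σ : α) :
    ∫ ω, F ω * switchInput θ σ (t + 1) ω ∂μ = open Classical in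
      pr σ * ∑ a with (a, σ) ∈ S, ∫ ω, F ω * switchInput θ a t ω ∂μ := by
  classical
  obtain ⟨h, h1, h2⟩ := hθ.exists_condExp_eq t σ
  have hms : ∀ s b, MeasurableSet (θ s ⁻¹' {b}) := fun s b => hθ.meas _ (MeasurableSet.of_discrete)
  have hFi : ∀ s b, Integrable (F * switchInput θ b s) μ := fun s b => by
    rw [switchInput_eq_ind, mul_ind]; exact hF.indicator (hms _ _)
  have h3 : μ[F * switchInput θ σ (t + 1)|m] =ᵐ[μ] F * fun ω => h (θ t ω) :=
    (condExp_mul_of_aestronglyMeasurable_left hFm (hFi _ _) (integrable_ind (hms _ _))).trans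
      ((Filter.EventuallyEq.refl _ _).mul ((hf _ (measurable_sigmaGen θ (by simp)
        MeasurableSet.of_discrete)).trans h1))
  have h4 : (F * fun ω => h (θ t ω)) = fun ω => ∑ a, h a * (F ω * switchInput θ a t ω) := by
    funext ω
    rw [Finset.sum_eq_single (θ t ω)]
    · simp [switchInput, mul_comm]
    · intro b _ hb
      simp [switchInput, hb.symm]
    · simp
  have h5 : ∫ ω, F ω * switchInput θ σ (t + 1) ω ∂μ =
      ∑ a, h a * ∫ ω, F ω * switchInput θ a t ω ∂μ := by
    have h6 := integral_condExp hm (μ := μ) (f := F * switchInput θ σ (t + 1))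
    have h7 : ∫ ω, ∑ a, h a * (F ω * switchInput θ a t ω) ∂μ =
        ∑ a, h a * ∫ ω, F ω * switchInput θ a t ω ∂μ := by
      rw [← Finset.sum_congr rfl fun a _ => integral_const_mul (h a) _]
      exact integral_finsetSum _ fun a _ => (hFi t a).const_mul (h a)
    rw [integral_congr_ae h3, h4, h7] at h6
    exact h6.symm
  rw [h5, Finset.mul_sum, Finset.sum_filter]
  refine Finset.sum_congr rfl fun a _ => ?_
  by_cases ha : μ (θ t ⁻¹' {a}) = 0
  · have : ∫ ω, F ω * switchInput θ a t ω ∂μ = 0 := by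
      refine integral_eq_zero_of_ae ?_
      have hz : ∀ᵐ ω ∂μ, ω ∉ θ t ⁻¹' {a} := measure_eq_zero_iff_ae_notMem.1 ha
      filter_upwards [hz] with ω hω
      simp [switchInput, Set.indicator_of_notMem hω]
    simp [this]
  · rw [h2 a ha]
    split_ifs <;> simp

/-- A conditional expectation with respect to finitely many values of `θ` vanishes if the integrals
over the cylinder sets do. -/
theorem condExp_switch_eq_zero (hθ : ∀ t, Measurable (θ t)) {F : Ω → ℝ} (hF : Integrable F μ)
    {l t : ℤ} (hlt : l < t)
    (h0 : ∀ w : List α, (w.length : ℤ) = t - l →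
      ∫ ω, F ω * wordInput (switchInput θ) w (t - 1) ω ∂μ = 0) :
    μ[F | sigmaGen θ (Set.Ico l t)] =ᵐ[μ] 0 := by
  classical
  obtain ⟨N, hN⟩ : ∃ N : ℕ, t = l + N := ⟨(t - l).toNat, by omega⟩
  let φ : Ω → Fin N → α := fun ω i => θ (l + i) ω
  have hφ : Measurable φ := measurable_pi_lambda _ fun i => hθ _
  have hle : sigmaGen θ (Set.Ico l t) ≤ MeasurableSpace.comap φ inferInstance := by
    refine iSup₂_le fun s hs => ?_
    obtain ⟨i, hi⟩ : ∃ i : Fin N, s = l + (i : ℕ) :=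
      ⟨⟨(s - l).toNat, by have := hs.2; have := hs.1; omega⟩, by
        have := hs.1; simp; omega⟩
    rw [← measurable_iff_comap_le, hi]
    exact (measurable_pi_apply i).comp (comap_measurable φ)
  have hm := sigmaGen_le hθ (Set.Ico l t)
  have hatom : ∀ g : Fin N → α, ∫ ω in φ ⁻¹' {g}, F ω ∂μ = 0 := by
    intro g
    have h1 := h0 (List.ofFn g) (by rw [List.length_ofFn]; omega)
    have h2 : (fun ω => F ω * wordInput (switchInput θ) (List.ofFn g) (t - 1) ω) =
        (φ ⁻¹' {g}).indicator F := by
      funext ω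
      have h3 : wordInput (switchInput θ) (List.ofFn g) (t - 1) ω =
          ∏ i : Fin N, if θ (l + i) ω = g i then (1 : ℝ) else 0 := by
        rw [wordInput]
        refine Fintype.prod_equiv (finCongr (by simp)) _ _ fun i => ?_
        have h4 : ((List.ofFn g).length : ℤ) = N := by rw [List.length_ofFn]
        have : t - 1 - ((List.ofFn g).length : ℤ) + 1 + (i : ℕ) = l + (i : ℕ) := by omega
        rw [this]
        simp [switchInput, Set.indicator_apply]
        rfl
      rw [h3]
      by_cases hω : φ ω = g
      · have hone : ∏ i : Fin N, (if θ (l + i) ω = g i then (1 : ℝ) else 0) = 1 :=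
          Finset.prod_eq_one fun i _ => if_pos (congrFun hω i)
        rw [hone, mul_one, Set.indicator_of_mem (show ω ∈ φ ⁻¹' {g} from hω)]
      · obtain ⟨i, hi⟩ := Function.ne_iff.1 hω
        rw [Finset.prod_eq_zero (Finset.mem_univ i) (if_neg hi), mul_zero,
          Set.indicator_of_notMem (show ω ∉ φ ⁻¹' {g} from hω)]
    rwa [h2, integral_indicator (hφ (MeasurableSet.singleton g))] at h1
  symm
  refine ae_eq_condExp_of_forall_setIntegral_eq hm hF (fun s _ _ => integrableOn_zero) ?_
    aestronglyMeasurable_zero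
  intro s hs _
  obtain ⟨T, hT, rfl⟩ := hle s hs
  have hU : φ ⁻¹' T = ⋃ g ∈ T.toFinset, φ ⁻¹' {g} := by ext ω; simp
  have hsum : ∫ ω in ⋃ g ∈ T.toFinset, φ ⁻¹' {g}, F ω ∂μ = 0 := by
    rw [integral_biUnion_finset _ (fun g _ => hφ (MeasurableSet.singleton g)) ?_
      (fun g _ => hF.integrableOn)]
    · simp [hatom]
    · intro g _ g' _ hgg
      refine Set.disjoint_left.2 fun ω h1 h2 => hgg ?_
      rw [← show φ ω = g from h1, ← show φ ω = g' from h2]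
  rw [hU, hsum]
  simp

end Switching
end JMLSRS

namespace JMLSRS

section Lift

variable {Ω α : Type*} [m0 : MeasurableSpace Ω] {μ : Measure Ω}

/-- The product of an element of `L²` with the indicator function of a set. -/
noncomputable def indFun {s : Set Ω} (hs : MeasurableSet s) (f : Lp ℝ 2 μ) : Lp ℝ 2 μ :=
  ((Lp.memLp f).indicator hs).toLp (s.indicator f)

theorem coeFn_indFun {s : Set Ω} (hs : MeasurableSet s) (f : Lp ℝ 2 μ) :
    indFun hs f =ᵐ[μ] s.indicator f :=
  MemLp.coeFn_toLp _

theorem indFun_add {s : Set Ω} (hs : MeasurableSet s) (f g : Lp ℝ 2 μ) :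
    indFun hs (f + g) = indFun hs f + indFun hs g := by
  refine Lp.ext ?_
  filter_upwards [coeFn_indFun hs (f + g), coeFn_indFun hs f, coeFn_indFun hs g,
    Lp.coeFn_add f g, Lp.coeFn_add (indFun hs f) (indFun hs g)] with ω h1 h2 h3 h4 h5
  rw [h1, h5, Pi.add_apply, h2, h3]
  by_cases hω : ω ∈ s
  · simp only [Set.indicator_of_mem hω, h4, Pi.add_apply]
  · simp only [Set.indicator_of_notMem hω, add_zero]

theorem indFun_smul {s : Set Ω} (hs : MeasurableSet s) (c : ℝ) (f : Lp ℝ 2 μ) :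
    indFun hs (c • f) = c • indFun hs f := by
  refine Lp.ext ?_
  filter_upwards [coeFn_indFun hs (c • f), coeFn_indFun hs f,
    Lp.coeFn_smul c f, Lp.coeFn_smul c (indFun hs f)] with ω h1 h2 h3 h4
  rw [h1, h4, Pi.smul_apply, h2]
  by_cases hω : ω ∈ s
  · simp only [Set.indicator_of_mem hω, h3, Pi.smul_apply]
  · simp only [Set.indicator_of_notMem hω, smul_zero]

theorem norm_indFun_le {s : Set Ω} (hs : MeasurableSet s) (f : Lp ℝ 2 μ) :
    ‖indFun hs f‖ ≤ 1 * ‖f‖ := by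
  rw [one_mul, indFun, Lp.norm_toLp, Lp.norm_def]
  exact ENNReal.toReal_mono (Lp.eLpNorm_ne_top f) (eLpNorm_indicator_le _)

/-- Multiplication by the indicator function of a set, as an operator on `L²`. -/
noncomputable def indMul (μ : Measure Ω) {s : Set Ω} (hs : MeasurableSet s) :
    Lp ℝ 2 μ →L[ℝ] Lp ℝ 2 μ :=
  LinearMap.mkContinuous
    { toFun := indFun hs
      map_add' := indFun_add hs
      map_smul' := indFun_smul hs } 1 (norm_indFun_le hs)

theorem coeFn_indMul {s : Set Ω} (hs : MeasurableSet s) (f : Lp ℝ 2 μ) :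
    indMul μ hs f =ᵐ[μ] s.indicator f :=
  coeFn_indFun hs f

/-- `F` consists of the classes of the entries of `f`. -/
def IsLift (μ : Measure Ω) {k : ℕ} (F : Fin k → Lp ℝ 2 μ) (f : Ω → Fin k → ℝ) : Prop :=
  ∀ i, F i =ᵐ[μ] fun ω => f ω i

theorem exists_isLift {k : ℕ} {f : Ω → Fin k → ℝ} (hf : ∀ i, MemLp (fun ω => f ω i) 2 μ) :
    ∃ F : Fin k → Lp ℝ 2 μ, IsLift μ F f :=
  ⟨fun i => (hf i).toLp _, fun i => (hf i).coeFn_toLp⟩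

theorem integral_eq_inner {F G : Lp ℝ 2 μ} {f g : Ω → ℝ} (hF : F =ᵐ[μ] f) (hG : G =ᵐ[μ] g) :
    ∫ ω, f ω * g ω ∂μ = inner ℝ F G := by
  rw [L2.inner_def]
  refine integral_congr_ae ?_
  filter_upwards [hF, hG] with ω h1 h2
  rw [h1, h2]
  simp [mul_comm]

namespace IsLift

variable {k l : ℕ} {F F' : Fin k → Lp ℝ 2 μ} {f f' : Ω → Fin k → ℝ} {G : Fin l → Lp ℝ 2 μ}
  {g : Ω → Fin l → ℝ}

theorem cov_eq (hF : IsLift μ F f) (hG : IsLift μ G g) : cov μ f g = gram F G := by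
  ext i j
  exact integral_eq_inner (hF i) (hG j)

theorem memLp (hF : IsLift μ F f) (i : Fin k) : MemLp (fun ω => f ω i) 2 μ :=
  (memLp_congr_ae (hF i)).1 (Lp.memLp (F i))

theorem eq_of_ae (hF : IsLift μ F f) (hF' : IsLift μ F' f') (h : ∀ᵐ ω ∂μ, f ω = f' ω) :
    F = F' := by
  funext i
  refine Lp.ext ?_
  filter_upwards [hF i, hF' i, h] with ω h1 h2 h3
  rw [h1, h2, h3]

theorem ae_eq (hF : IsLift μ F f) (hF' : IsLift μ F f') : ∀ᵐ ω ∂μ, f ω = f' ω := by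
  have : ∀ᵐ ω ∂μ, ∀ i, f ω i = f' ω i := ae_all_iff.2 fun i => (hF i).symm.trans (hF' i)
  filter_upwards [this] with ω hω
  exact funext hω

theorem add (hF : IsLift μ F f) (hF' : IsLift μ F' f') : IsLift μ (F + F') fun ω => f ω + f' ω := by
  intro i
  filter_upwards [hF i, hF' i, Lp.coeFn_add (F i) (F' i)] with ω h1 h2 h3
  rw [Pi.add_apply, h3, Pi.add_apply, h1, h2, Pi.add_apply]

theorem sub (hF : IsLift μ F f) (hF' : IsLift μ F' f') : IsLift μ (F - F') fun ω => f ω - f' ω := by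
  intro i
  filter_upwards [hF i, hF' i, Lp.coeFn_sub (F i) (F' i)] with ω h1 h2 h3
  rw [Pi.sub_apply, h3, Pi.sub_apply, h1, h2, Pi.sub_apply]

theorem sum {ι : Type*} (s : Finset ι) {F : ι → Fin k → Lp ℝ 2 μ} {f : ι → Ω → Fin k → ℝ}
    (hF : ∀ a, IsLift μ (F a) (f a)) : IsLift μ (∑ a ∈ s, F a) fun ω => ∑ a ∈ s, f a ω := by
  classical
  induction s using Finset.induction_on with
  | empty =>
    intro i
    simp only [Finset.sum_empty, Pi.zero_apply]
    exact Lp.coeFn_zero ℝ 2 μ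
  | insert a s ha ih =>
    simp only [Finset.sum_insert ha]
    exact (hF a).add ih

theorem matAct (A : Matrix (Fin l) (Fin k) ℝ) (hF : IsLift μ F f) :
    IsLift μ (matAct A F) fun ω => A.mulVec (f ω) := by
  have h1 : ∀ j, IsLift μ (fun i => A i j • F j) fun ω i => A i j * f ω j := by
    intro j i
    filter_upwards [hF j, Lp.coeFn_smul (A i j) (F j)] with ω h1 h2
    rw [h2, Pi.smul_apply, h1, smul_eq_mul]
  have h2 := sum Finset.univ h1
  intro i
  have h3 := h2 i
  simp only [Finset.sum_apply] at h3
  exact h3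

end IsLift

end Lift

section SwitchLift

variable {Ω α : Type*} {m : ℤ → MeasurableSpace Ω} [m0 : MeasurableSpace Ω] {μ : Measure Ω}
  [MeasurableSpace α] [DiscreteMeasurableSpace α] {θ : ℤ → Ω → α}

/-- Multiplication by the input `u_σ(t)`, as an operator on `L²`. -/
noncomputable def mulInput (μ : Measure Ω) (hθ : ∀ t, Measurable (θ t)) (σ : α) (t : ℤ) :
    Lp ℝ 2 μ →L[ℝ] Lp ℝ 2 μ :=
  indMul μ (hθ t (MeasurableSet.of_discrete (s := {σ})))

theorem coeFn_mulInput (hθ : ∀ t, Measurable (θ t)) (σ : α) (t : ℤ) (f : Lp ℝ 2 μ) :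
    mulInput μ hθ σ t f =ᵐ[μ] fun ω => switchInput θ σ t ω * f ω := by
  filter_upwards [coeFn_indMul (hθ t (MeasurableSet.of_discrete (s := {σ}))) f] with ω h
  rw [mulInput, h]
  by_cases hω : ω ∈ θ t ⁻¹' {σ}
  · rw [switchInput, Set.indicator_of_mem hω, Set.indicator_of_mem hω, one_mul]
  · rw [switchInput, Set.indicator_of_notMem hω, Set.indicator_of_notMem hω, zero_mul]

omit m0 [MeasurableSpace α] [DiscreteMeasurableSpace α] in
theorem switchInput_mul_self (θ : ℤ → Ω → α) (σ : α) (t : ℤ) (ω : Ω) :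
    switchInput θ σ t ω * switchInput θ σ t ω = switchInput θ σ t ω := by
  by_cases h : θ t ω = σ <;> simp [switchInput, h]

omit m0 [MeasurableSpace α] [DiscreteMeasurableSpace α] in
theorem switchInput_mul_ne (θ : ℤ → Ω → α) {σ τ : α} (h : σ ≠ τ) (t : ℤ) (ω : Ω) :
    switchInput θ σ t ω * switchInput θ τ t ω = 0 := by
  by_cases h1 : θ t ω = σ
  · have : θ t ω ≠ τ := fun h2 => h (h1.symm.trans h2)
    simp [switchInput, this]
  · simp [switchInput, h1]

omit m0 [MeasurableSpace α] [DiscreteMeasurableSpace α] in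
theorem sum_switchInput [Fintype α] (θ : ℤ → Ω → α) (t : ℤ) (ω : Ω) :
    ∑ σ, switchInput θ σ t ω = 1 := by
  rw [Finset.sum_eq_single (θ t ω)]
  · simp [switchInput]
  · intro b _ hb
    simp [switchInput, hb.symm]
  · simp

theorem switchedSpace [IsProbabilityMeasure μ] [Fintype α] {pr : α → ℝ} {S : Set (α × α)}
    (hθ : IsRestrictedSwitching μ pr S θ) (hmono : Monotone m) (hle : ∀ t, m t ≤ m0)
    (hθm : ∀ t, sigmaGen θ (Set.Iio t) ≤ m t) (hf : ∀ t, FutureIndep μ θ t (m t)) :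
    SwitchedSpace pr S (mulInput μ hθ.meas) fun t => lpMeas ℝ ℝ (m t) 2 μ where
  pos := hθ.pos
  idem σ t f := by
    refine Lp.ext ?_
    filter_upwards [coeFn_mulInput hθ.meas σ t (mulInput μ hθ.meas σ t f),
      coeFn_mulInput hθ.meas σ t f] with ω h1 h2
    rw [h1, h2, ← mul_assoc, switchInput_mul_self]
  orth σ τ t f h := by
    refine Lp.ext ?_
    filter_upwards [coeFn_mulInput hθ.meas σ t (mulInput μ hθ.meas τ t f),
      coeFn_mulInput hθ.meas τ t f, Lp.coeFn_zero ℝ 2 μ] with ω h1 h2 h3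
    rw [h1, h2, h3, ← mul_assoc, switchInput_mul_ne θ h, zero_mul, Pi.zero_apply]
  sum t f := by
    have h1 : ∀ σ, IsLift μ (fun _ : Fin 1 => mulInput μ hθ.meas σ t f)
        fun ω _ => switchInput θ σ t ω * f ω := fun σ _ => coeFn_mulInput hθ.meas σ t f
    have h2 : IsLift μ (fun _ : Fin 1 => f) fun ω _ => f ω := fun _ => Filter.EventuallyEq.refl _ _
    have h3 := (IsLift.sum Finset.univ h1).eq_of_ae h2 (Filter.Eventually.of_forall fun ω => by
      funext i
      rw [Finset.sum_apply, ← Finset.sum_mul, sum_switchInput, one_mul])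
    simpa using congrFun h3 0
  symm σ t f g := by
    rw [L2.inner_def, L2.inner_def]
    refine integral_congr_ae ?_
    filter_upwards [coeFn_mulInput hθ.meas σ t f, coeFn_mulInput hθ.meas σ t g] with ω h1 h2
    rw [h1, h2]
    simp only [RCLike.inner_apply, conj_trivial]
    ring
  comm σ τ s t f := by
    refine Lp.ext ?_
    filter_upwards [coeFn_mulInput hθ.meas σ s (mulInput μ hθ.meas τ t f),
      coeFn_mulInput hθ.meas τ t f, coeFn_mulInput hθ.meas τ t (mulInput μ hθ.meas σ s f),
      coeFn_mulInput hθ.meas σ s f] with ω h1 h2 h3 h4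
    rw [h1, h2, h3, h4]
    ring
  mono s t hst f hf' := by
    rw [mem_lpMeas_iff_aestronglyMeasurable] at hf' ⊢
    exact hf'.mono (hmono hst)
  closed t := isClosed_aestronglyMeasurable (hle t)
  mem σ s t f hst hf' := by
    rw [mem_lpMeas_iff_aestronglyMeasurable] at hf' ⊢
    refine AEStronglyMeasurable.congr ?_ (coeFn_indMul _ f).symm
    obtain ⟨g, hg, hfg⟩ := hf'
    refine ⟨(θ s ⁻¹' {σ}).indicator g, hg.indicator
      (hθm t _ (measurable_sigmaGen θ (Set.mem_Iio.2 hst) MeasurableSet.of_discrete)), ?_⟩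
    filter_upwards [hfg] with ω h
    by_cases hω : ω ∈ θ s ⁻¹' {σ}
    · rw [Set.indicator_of_mem hω, Set.indicator_of_mem hω, h]
    · rw [Set.indicator_of_notMem hω, Set.indicator_of_notMem hω]
  key σ t f g hf' hg := by
    classical
    rw [mem_lpMeas_iff_aestronglyMeasurable] at hf' hg
    have h1 : ∀ τ s, (inner ℝ f (mulInput μ hθ.meas τ s g) : ℝ) =
        ∫ ω, (f ω * g ω) * switchInput θ τ s ω ∂μ := by
      intro τ s
      rw [← integral_eq_inner (Filter.EventuallyEq.refl _ _) (coeFn_mulInput hθ.meas τ s g)]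
      exact integral_congr_ae (Filter.Eventually.of_forall fun ω => by ring)
    simp only [h1]
    exact hθ.integral_mul_switchInput (hle _) (hf _)
      ((Lp.memLp f).integrable_mul (Lp.memLp g)) (hf'.mul hg) σ

omit m0 [MeasurableSpace α] [DiscreteMeasurableSpace α] in
theorem wordInput_cons (u : α → ℤ → Ω → ℝ) (σ : α) (w : List α) (t : ℤ) (ω : Ω) :
    wordInput u (σ :: w) t ω = u σ (t - w.length) ω * wordInput u w t ω := by
  have h : wordInput u (σ :: w) t ω = ∏ i : Fin (w.length + 1),
      u ((σ :: w).get i) (t - (σ :: w).length + 1 + (i : ℕ)) ω := rfl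
  rw [h, Fin.prod_univ_succ, wordInput]
  congr 1
  · have h1 : t - ((σ :: w).length : ℤ) + 1 + ((0 : Fin (w.length + 1)) : ℕ) = t - w.length := by
      simp only [List.length_cons, Fin.val_zero]
      push_cast
      ring
    rw [h1]
    rfl
  · refine Finset.prod_congr rfl fun i _ => ?_
    have h1 : t - ((σ :: w).length : ℤ) + 1 + (i.succ : ℕ) = t - w.length + 1 + (i : ℕ) := by
      simp only [List.length_cons, Fin.val_succ]
      push_cast
      ring
    rw [h1]
    rfl

omit [MeasurableSpace α] [DiscreteMeasurableSpace α] in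
theorem wordWeight_pos {pr : α → ℝ} (hpr : ∀ σ, 0 < pr σ) (w : List α) : 0 < wordWeight pr w := by
  induction w with
  | nil => simp [wordWeight]
  | cons σ w ih =>
    simp only [wordWeight, List.map_cons, List.prod_cons] at ih ⊢
    exact mul_pos (hpr σ) ih

theorem coeFn_wordOp {pr : α → ℝ} (hpr : ∀ σ, 0 < pr σ) (hθ : ∀ t, Measurable (θ t)) (w : List α)
    (t : ℤ) (f : Lp ℝ 2 μ) : wordOp pr (mulInput μ hθ) w t f =ᵐ[μ]
      fun ω => f ω * wordInput (switchInput θ) w (t - 1) ω / √(wordWeight pr w) := by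
  induction w generalizing f with
  | nil => simp [wordOp, wordInput, wordWeight]
  | cons σ w ih =>
    have h1 : wordOp pr (mulInput μ hθ) (σ :: w) t f = wordOp pr (mulInput μ hθ) w t
        ((√(pr σ))⁻¹ • mulInput μ hθ σ (t - w.length - 1) f) := rfl
    rw [h1]
    filter_upwards [ih ((√(pr σ))⁻¹ • mulInput μ hθ σ (t - w.length - 1) f),
      Lp.coeFn_smul (√(pr σ))⁻¹ (mulInput μ hθ σ (t - w.length - 1) f),
      coeFn_mulInput hθ σ (t - w.length - 1) f] with ω h2 h3 h4
    have h5 : wordWeight pr (σ :: w) = pr σ * wordWeight pr w := by simp [wordWeight]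
    have h6 : t - 1 - (w.length : ℤ) = t - w.length - 1 := by ring
    rw [h2, h3, Pi.smul_apply, h4, wordInput_cons, h5, Real.sqrt_mul (hpr σ).le, h6, smul_eq_mul,
      div_eq_mul_inv, div_eq_mul_inv, mul_inv]
    ring

variable {pr : α → ℝ} {k l n : ℕ} {R : ℤ → Fin k → Lp ℝ 2 μ} {r : ℤ → Ω → Fin k → ℝ}

theorem isLift_vmap_mulInput (hθ : ∀ t, Measurable (θ t)) {F : Fin k → Lp ℝ 2 μ}
    {f : Ω → Fin k → ℝ} (hF : IsLift μ F f) (σ : α) (t : ℤ) :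
    IsLift μ (vmap (mulInput μ hθ σ t) F) fun ω => switchInput θ σ t ω • f ω := by
  intro i
  filter_upwards [hF i, coeFn_mulInput hθ σ t (F i)] with ω h1 h2
  rw [vmap, h2, h1, Pi.smul_apply, smul_eq_mul]

theorem isLift_zProc (hpr : ∀ σ, 0 < pr σ) (hθ : ∀ t, Measurable (θ t))
    (hR : ∀ t, IsLift μ (R t) (r t)) (w : List α) (t : ℤ) :
    IsLift μ (zvec pr (mulInput μ hθ) R w t) (zProc pr (switchInput θ) r w t) := by
  intro i
  filter_upwards [hR (t - w.length) i, coeFn_wordOp hpr hθ w t (R (t - w.length) i)] with ω h1 h2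
  rw [zvec, vmap, h2, h1, zProc]

theorem isLift_zFuture (hpr : ∀ σ, 0 < pr σ) (hθ : ∀ t, Measurable (θ t))
    (hR : ∀ t, IsLift μ (R t) (r t)) (w : List α) (t : ℤ) :
    IsLift μ (vmap (wordOp pr (mulInput μ hθ) w (t + w.length)) (R (t + w.length)))
      (zFuture pr (switchInput θ) r w t) := by
  intro i
  filter_upwards [hR (t + w.length) i,
    coeFn_wordOp hpr hθ w (t + w.length) (R (t + w.length) i)] with ω h1 h2
  rw [vmap, h2, h1, zFuture]

theorem hilbertSpan_zEntries (hpr : ∀ σ, 0 < pr σ) (hθ : ∀ t, Measurable (θ t))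
    (hR : ∀ t, IsLift μ (R t) (r t)) (t : ℤ) :
    hilbertSpan μ (zEntries pr (switchInput θ) r t) = lagSpan pr (mulInput μ hθ) R t := by
  unfold hilbertSpan lagSpan
  congr 2
  ext g
  constructor
  · rintro ⟨_, ⟨w, i, hw, rfl⟩, hg⟩
    refine ⟨(⟨w, hw⟩, i), Lp.ext ?_⟩
    exact (isLift_zProc hpr hθ hR w t i).trans hg.symm
  · rintro ⟨⟨⟨w, hw⟩, i⟩, rfl⟩
    exact ⟨_, ⟨w, i, hw, rfl⟩, isLift_zProc hpr hθ hR w t i⟩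

theorem covU_eq (hθ : ∀ t, Measurable (θ t)) (hR : ∀ t, IsLift μ (R t) (r t)) (σ : α) :
    covU μ (switchInput θ) r σ = gram (R 0) (vmap (mulInput μ hθ σ 0) (R 0)) := by
  rw [← (hR 0).cov_eq (isLift_vmap_mulInput hθ (hR 0) σ 0)]
  ext i j
  refine integral_congr_ae (Filter.Eventually.of_forall fun ω => ?_)
  simp only [Pi.smul_apply, smul_eq_mul]
  rw [sq, switchInput_mul_self]
  ring

theorem covT_eq (hpr : ∀ σ, 0 < pr σ) (hθ : ∀ t, Measurable (θ t))
    (hR : ∀ t, IsLift μ (R t) (r t)) (w v : List α) :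
    covT μ pr (switchInput θ) r w v =
      gram (zvec pr (mulInput μ hθ) R w 0) (zvec pr (mulInput μ hθ) R v 0) :=
  (isLift_zProc hpr hθ hR w 0).cov_eq (isLift_zProc hpr hθ hR v 0)

theorem covLam_eq (hpr : ∀ σ, 0 < pr σ) (hθ : ∀ t, Measurable (θ t))
    (hR : ∀ t, IsLift μ (R t) (r t)) (w : List α) :
    covLam μ pr (switchInput θ) r w = gram (R 0) (zvec pr (mulInput μ hθ) R w 0) :=
  (hR 0).cov_eq (isLift_zProc hpr hθ hR w 0)

namespace JointWSS

theorem gram_z (h : JointWSS μ pr (switchInput θ) r) (hpr : ∀ σ, 0 < pr σ)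
    (hθ : ∀ t, Measurable (θ t)) (hR : ∀ t, IsLift μ (R t) (r t)) {w : List α} (hw : w ≠ [])
    (t s : ℤ) : gram (R t) (zvec pr (mulInput μ hθ) R w t) =
      gram (R s) (zvec pr (mulInput μ hθ) R w s) := by
  have h1 := h.cov_z w hw s (t - s)
  rw [add_sub_cancel] at h1
  rwa [(hR t).cov_eq (isLift_zProc hpr hθ hR w t), (hR s).cov_eq (isLift_zProc hpr hθ hR w s)] at h1

theorem gram_zz (h : JointWSS μ pr (switchInput θ) r) (hpr : ∀ σ, 0 < pr σ)
    (hθ : ∀ t, Measurable (θ t)) (hR : ∀ t, IsLift μ (R t) (r t)) {w v : List α} (hw : w ≠ [])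
    (hv : v ≠ []) (t s : ℤ) :
    gram (zvec pr (mulInput μ hθ) R w t) (zvec pr (mulInput μ hθ) R v t) =
      gram (zvec pr (mulInput μ hθ) R w s) (zvec pr (mulInput μ hθ) R v s) := by
  have h1 := h.cov_zz w v hw hv s (t - s)
  rw [add_sub_cancel] at h1
  rwa [(isLift_zProc hpr hθ hR w t).cov_eq (isLift_zProc hpr hθ hR v t),
    (isLift_zProc hpr hθ hR w s).cov_eq (isLift_zProc hpr hθ hR v s)] at h1

end JointWSS

/-- The constant function `1`, as an element of `L²`. -/
noncomputable def oneLp (μ : Measure Ω) [IsProbabilityMeasure μ] : Lp ℝ 2 μ :=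
  (memLp_const (1 : ℝ)).toLp _

omit [MeasurableSpace α] [DiscreteMeasurableSpace α] in
theorem integral_eq_inner_one [IsProbabilityMeasure μ] {F : Fin k → Lp ℝ 2 μ} {f : Ω → Fin k → ℝ}
    (hF : IsLift μ F f) (i : Fin k) : ∫ ω, f ω i ∂μ = inner ℝ (oneLp μ) (F i) := by
  have h : oneLp μ =ᵐ[μ] fun _ => (1 : ℝ) := MemLp.coeFn_toLp _
  rw [← integral_eq_inner h (hF i)]
  simp

theorem jointWSS_of_gram [IsProbabilityMeasure μ] [Fintype α] {S : Set (α × α)}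
    {G : ℤ → Submodule ℝ (Lp ℝ 2 μ)} (hθ : ∀ t, Measurable (θ t))
    (H : SwitchedSpace pr S (mulInput μ hθ) G) (hR : ∀ t, IsLift μ (R t) (r t))
    (hRG : ∀ t i, R t i ∈ G t) (hmean : ∀ t i, (inner ℝ (oneLp μ) (R t i) : ℝ) = 0)
    (hmean_z : ∀ w, w ≠ [] → ∀ t i,
      (inner ℝ (oneLp μ) (zvec pr (mulInput μ hθ) R w t i) : ℝ) = 0)
    (h1 : ∀ w, w ≠ [] → ∀ t s, gram (R t) (zvec pr (mulInput μ hθ) R w t) =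
      gram (R s) (zvec pr (mulInput μ hθ) R w s))
    (h2 : ∀ σ t s, gram (R t) (vmap (mulInput μ hθ σ t) (R t)) =
      gram (R s) (vmap (mulInput μ hθ σ s) (R s))) :
    JointWSS μ pr (switchInput θ) r where
  memLp t i := (hR t).memLp i
  memLp_z w _ t i := (isLift_zProc H.pos hθ hR w t).memLp i
  mean t i := by rw [integral_eq_inner_one (hR t), hmean]
  mean_z w hw t i := by rw [integral_eq_inner_one (isLift_zProc H.pos hθ hR w t), hmean_z w hw]
  cov_z w hw t s := by
    rw [(hR _).cov_eq (isLift_zProc H.pos hθ hR w _), (hR _).cov_eq (isLift_zProc H.pos hθ hR w _)]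
    exact h1 w hw _ _
  cov_zz w v hw hv t s := by
    rw [(isLift_zProc H.pos hθ hR w _).cov_eq (isLift_zProc H.pos hθ hR v _),
      (isLift_zProc H.pos hθ hR w _).cov_eq (isLift_zProc H.pos hθ hR v _)]
    exact H.gram_zvec_stationary hRG h1 h2 hw hv _ _

omit m0 [MeasurableSpace α] [DiscreteMeasurableSpace α] in
theorem append_mem_admissible {S : Set (α × α)} {w : List α} {a σ : α} :
    w ++ [a] ++ [σ] ∈ admissible S ↔ w ++ [a] ∈ admissible S ∧ (a, σ) ∈ S := by
  simp only [admissible, Set.mem_ofPred_eq, List.isChain_append (l₁ := w ++ [a])]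
  simp

omit m0 [MeasurableSpace α] [DiscreteMeasurableSpace α] in
theorem pair_mem_admissible {S : Set (α × α)} {a σ : α} :
    [a, σ] ∈ admissible S ↔ (a, σ) ∈ S := by
  simp [admissible]

theorem isRC_of_jointWSS [Fintype α] {S : Set (α × α)}
    {G : ℤ → Submodule ℝ (Lp ℝ 2 μ)} (hθ : ∀ t, Measurable (θ t))
    (H : SwitchedSpace pr S (mulInput μ hθ) G) (hR : ∀ t, IsLift μ (R t) (r t))
    (hRG : ∀ t i, R t i ∈ G t) (hj : JointWSS μ pr (switchInput θ) r) :
    IsRC μ pr S (switchInput θ) r := by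
  have hT := covT_eq H.pos hθ hR
  have htr : ∀ w v, covT μ pr (switchInput θ) r w v =
      (covT μ pr (switchInput θ) r v w).transpose := fun w v => by
    rw [hT, hT, gram_transpose]
  have hshift : ∀ (w v : List α) (σ : α), w ≠ [] → v ≠ [] → w ++ [σ] ∈ admissible S →
      covT μ pr (switchInput θ) r (w ++ [σ]) (v ++ [σ]) = covT μ pr (switchInput θ) r w v := by
    intro w v σ hw hv h
    obtain rfl | ⟨w, a, rfl⟩ := List.eq_nil_or_concat' w
    · exact absurd rfl hw
    rw [hT, hT, hj.gram_zz H.pos hθ hR (by simp) (by simp) 0 (0 + 1),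
      H.gram_zvec_append hRG hRG, if_pos (append_mem_admissible.1 h).2]
  have hleft : ∀ (w v : List α) (σ : α), w ≠ [] → v ≠ [] →
      w ++ [σ] ∈ admissible S → v ++ [σ] ∉ admissible S → covT μ pr (switchInput θ) r v w = 0 := by
    intro w v σ hw hv h h'
    obtain rfl | ⟨w, a, rfl⟩ := List.eq_nil_or_concat' w
    · exact absurd rfl hw
    obtain rfl | ⟨v, b, rfl⟩ := List.eq_nil_or_concat' v
    · exact absurd rfl hv
    rw [append_mem_admissible] at h h'
    rw [hT]
    by_cases hvS : v ++ [b] ∈ admissible S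
    · refine H.gram_zvec_ne _ _ (fun hba => h' ⟨hvS, ?_⟩) 0
      rw [hba]
      exact h.2
    · rw [H.zvec_eq_zero hRG (by simp) hvS, gram_zero_left]
  refine ⟨hj, ?_, ?_, ?_, ?_, ?_, ?_, hleft, ?_⟩
  · intro σ σ' h
    rw [hT]
    exact H.gram_zvec_ne [] [] h 0
  · rintro w v σ hw hv (h | h)
    · exact hshift w v σ hw hv h
    · rw [htr, hshift v w σ hv hw h, ← htr]
  · intro w v σ σ' _ _ h
    rw [hT]
    exact H.gram_zvec_ne w v h 0
  · intro w σ hw h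
    obtain rfl | ⟨w, a, rfl⟩ := List.eq_nil_or_concat' w
    · exact absurd rfl hw
    rw [hT, covLam_eq H.pos hθ hR, hj.gram_zz H.pos hθ hR (by simp) (by simp) 0 (0 + 1),
      gram_transpose]
    have h1 := H.gram_zvec_append hRG hRG w [] a σ 0
    rwa [if_pos (append_mem_admissible.1 h).2, zvec_nil] at h1
  · intro w σ σ' _ h
    rw [hT]
    exact H.gram_zvec_ne w [] h 0
  · rintro w v hw hv (h | h)
    · rw [hT, H.zvec_eq_zero hRG hw h, gram_zero_left]
    · rw [hT, H.zvec_eq_zero hRG hv h, gram_zero_right]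
  · intro w v σ hw hv h h'
    rw [htr, hleft v w σ hv hw h h', Matrix.transpose_zero]

end SwitchLift
end JMLSRS

namespace JMLSRS

section Past

variable {Ω α : Type*} [m0 : MeasurableSpace Ω] {μ : Measure Ω}
  [MeasurableSpace α] {θ : ℤ → Ω → α} {k l : ℕ}

/-- The σ-algebra generated by `r(s)`, `s ≤ t`, and `θ(s)`, `s < t`. -/
abbrev pastSigma (r : ℤ → Ω → Fin k → ℝ) (θ : ℤ → Ω → α) (t : ℤ) : MeasurableSpace Ω :=
  sigmaGen r (Set.Iic t) ⊔ sigmaGen θ (Set.Iio t)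

/-- The square integrable variables which are determined by `r(s)`, `s ≤ t`, and `θ(s)`,
`s < t`. -/
noncomputable def pastSpace (μ : Measure Ω) (r : ℤ → Ω → Fin k → ℝ) (θ : ℤ → Ω → α) (t : ℤ) :
    Submodule ℝ (Lp ℝ 2 μ) :=
  lpMeas ℝ ℝ (pastSigma r θ t) 2 μ

theorem pastSigma_le {r : ℤ → Ω → Fin k → ℝ} (hr : ∀ t, Measurable (r t))
    (hθ : ∀ t, Measurable (θ t)) (t : ℤ) : pastSigma r θ t ≤ m0 :=
  sup_le (sigmaGen_le hr _) (sigmaGen_le hθ _)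

theorem mem_pastSpace {r : ℤ → Ω → Fin k → ℝ} {R : ℤ → Fin k → Lp ℝ 2 μ}
    (hR : ∀ t, IsLift μ (R t) (r t)) (t : ℤ) (i : Fin k) : R t i ∈ pastSpace μ r θ t := by
  have h : Measurable[pastSigma r θ t] fun ω => r t ω i :=
    Measurable.comp (measurable_pi_apply i)
      ((measurable_sigmaGen r Set.self_mem_Iic).mono le_sup_left le_rfl)
  exact mem_lpMeas_iff_aestronglyMeasurable.2 ⟨_, h.stronglyMeasurable, hR t i⟩

variable [IsProbabilityMeasure μ] [Fintype α] [DiscreteMeasurableSpace α] {pr : α → ℝ}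
  {S : Set (α × α)} (hθ : IsRestrictedSwitching μ pr S θ) {r : ℤ → Ω → Fin k → ℝ}
  (hr : ∀ t, Measurable (r t))
  (hc : ∀ t : ℤ, CondIndepSigma μ (sigmaGen θ (Set.Iio t)) (sigmaGen r (Set.Iic t))
    (sigmaGen θ (Set.Ici t)))

include hθ hr hc

omit [Fintype α] [DiscreteMeasurableSpace α] in
theorem futureIndep_pastSigma (t : ℤ) : FutureIndep μ θ t (pastSigma r θ t) := fun _ hB =>
  (hc t).condExp_sup (sigmaGen_le hθ.meas _) (sigmaGen_le hr _) (sigmaGen_le hθ.meas _) hB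

theorem switchedSpace_pastSpace :
    SwitchedSpace pr S (mulInput μ hθ.meas) (pastSpace μ r θ) :=
  switchedSpace hθ
    (fun _ _ h => sup_le_sup (sigmaGen_mono _ (Set.Iic_subset_Iic.2 h))
      (sigmaGen_mono _ (Set.Iio_subset_Iio h)))
    (pastSigma_le hr hθ.meas) (fun _ => le_sup_right) (futureIndep_pastSigma hθ hr hc)

theorem condIndepSigma_of_mem_pastSpace {q : ℤ → Ω → Fin l → ℝ} {Q : ℤ → Fin l → Lp ℝ 2 μ}
    (hQ : ∀ t, IsLift μ (Q t) (q t)) (hQm : ∀ t i, Q t i ∈ pastSpace μ r θ t) (t : ℤ) :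
    CondIndepSigma μ (sigmaGen θ (Set.Iio t)) (sigmaGen q (Set.Iic t))
      (sigmaGen θ (Set.Ici t)) := by
  refine condIndepSigma_of_condExp (m := pastSigma r θ t) le_sup_right (pastSigma_le hr hθ.meas t)
    (sigmaGen_le hθ.meas _) (futureIndep_pastSigma hθ hr hc t) fun A hA =>
      exists_ae_eq_of_sigmaGen (fun s hs i => ?_) hA
  have h1 := (switchedSpace_pastSpace hθ hr hc).mono hs (hQm s i)
  exact (mem_lpMeas_iff_aestronglyMeasurable.1 h1).congr (hQ s i)

end Past

section Realization

variable {Ω α : Type*} [m0 : MeasurableSpace Ω] {μ : Measure Ω} [IsProbabilityMeasure μ]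
  [Fintype α] [MeasurableSpace α] [DiscreteMeasurableSpace α] {pr : α → ℝ} {S : Set (α × α)}
  {θ : ℤ → Ω → α} (hθ : IsRestrictedSwitching μ pr S θ) {n m p : ℕ} {B : GBS Ω α n m p}
  {y : ℤ → Ω → Fin p → ℝ}

omit [IsProbabilityMeasure μ] [Fintype α] m0 in
theorem stronglyMeasurable_wordInput (θ : ℤ → Ω → α) (w : List α) (t : ℤ) :
    StronglyMeasurable[sigmaGen θ (Set.Ico (t - w.length) t)]
      (wordInput (switchInput θ) w (t - 1)) := by
  have : wordInput (switchInput θ) w (t - 1) = fun ω => ∏ i : Fin w.length,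
      switchInput θ (w.get i) (t - 1 - w.length + 1 + (i : ℕ)) ω := rfl
  rw [this]
  refine Finset.stronglyMeasurable_fun_prod _ fun i _ => ?_
  refine stronglyMeasurable_const.indicator ?_
  refine measurable_sigmaGen θ ?_ MeasurableSet.of_discrete
  constructor <;> omega

omit [Fintype α] [DiscreteMeasurableSpace α] in
theorem integral_mul_eq_zero_of_condExp {F W : Ω → ℝ} {m' : MeasurableSpace Ω} (hm : m' ≤ m0)
    (hW : StronglyMeasurable[m'] W) (hF : Integrable F μ) (hFW : Integrable (F * W) μ)
    (h : μ[F | m'] =ᵐ[μ] 0) : ∫ ω, F ω * W ω ∂μ = 0 := by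
  have h1 := condExp_mul_of_stronglyMeasurable_right hW hFW hF
  have h2 : ∫ ω, (F * W) ω ∂μ = ∫ ω, (μ[F | m'] * W) ω ∂μ := by
    rw [← integral_condExp hm]
    exact integral_congr_ae h1
  rw [show ∫ ω, F ω * W ω ∂μ = ∫ ω, (F * W) ω ∂μ from rfl, h2]
  have h3 : μ[F | m'] * W =ᵐ[μ] 0 := by
    filter_upwards [h] with ω hω
    simp [hω]
  rw [integral_congr_ae h3]
  simp

omit [Fintype α] in
include hθ in
theorem gram_zvec_eq_zero_of_uncorr {r : ℤ → Ω → Fin m → ℝ} {R : ℤ → Fin m → Lp ℝ 2 μ}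
    (hR : ∀ t, IsLift μ (R t) (r t))
    (h : ∀ l t : ℤ, l < t → ∀ i j,
      μ[fun ω => r t ω i * r l ω j | sigmaGen θ (Set.Ico l t)] =ᵐ[μ] 0)
    {w : List α} (hw : w ≠ []) (t : ℤ) :
    gram (R t) (zvec pr (mulInput μ hθ.meas) R w t) = 0 := by
  have hz := isLift_zProc hθ.pos hθ.meas hR w t
  rw [← (hR t).cov_eq hz]
  have hlen : 0 < w.length := List.length_pos_iff.2 hw
  ext i j
  have h1 := integral_mul_eq_zero_of_condExp (F := fun ω => r t ω i * r (t - w.length) ω j)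
    (sigmaGen_le hθ.meas _) (stronglyMeasurable_wordInput θ w t)
    (((hR t).memLp i).integrable_mul ((hR (t - w.length)).memLp j)) ?_
    (h (t - w.length) t (by omega) i j)
  · have h2 : (fun ω => r t ω i * zProc pr (switchInput θ) r w t ω j) = fun ω =>
        r t ω i * r (t - w.length) ω j * wordInput (switchInput θ) w (t - 1) ω *
          (√(wordWeight pr w))⁻¹ := by
      funext ω
      rw [zProc]
      ring
    rw [cov, Matrix.of_apply, h2, integral_mul_const, h1, zero_mul, Matrix.zero_apply]
  · have h2 : ((fun ω => r t ω i * r (t - w.length) ω j) *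
        wordInput (switchInput θ) w (t - 1)) = fun ω =>
        √(wordWeight pr w) * (r t ω i * zProc pr (switchInput θ) r w t ω j) := by
      funext ω
      have := (Real.sqrt_pos.2 (wordWeight_pos hθ.pos w)).ne'
      rw [zProc, Pi.mul_apply]
      field_simp
    have h3 := (((hR t).memLp i).integrable_mul (hz.memLp j)).const_mul √(wordWeight pr w)
    rw [h2]
    exact h3

/-- The data of a realization, transferred to `L²`. -/
structure GBS.Lifted (B : GBS Ω α n m p) (hθ : IsRestrictedSwitching μ pr S θ)
    (y : ℤ → Ω → Fin p → ℝ) (X : ℤ → Fin n → Lp ℝ 2 μ)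
    (V : ℤ → Fin m → Lp ℝ 2 μ) (Y : ℤ → Fin p → Lp ℝ 2 μ) : Prop where
  liftX : ∀ t, IsLift μ (X t) (B.x t)
  liftV : ∀ t, IsLift μ (V t) (B.v t)
  liftY : ∀ t, IsLift μ (Y t) (y t)
  noise : ∀ w, w ≠ [] → ∀ t, gram (V t) (zvec pr (mulInput μ hθ.meas) V w t) = 0
  noiseU : ∀ σ t, gram (V t) (vmap (mulInput μ hθ.meas σ t) (V t)) = covU μ (switchInput θ) B.v σ
  driven : ∀ t i, X t i ∈ lagSpan pr (mulInput μ hθ.meas) V t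
  state : ∀ t, X (t + 1) =
    ∑ σ, vmap (mulInput μ hθ.meas σ t) (matAct (B.A σ) (X t) + matAct (B.K σ) (V t))
  compatA : ∀ a σ, (a, σ) ∉ S → B.A σ * B.A a = 0
  compatK : ∀ a σ, (a, σ) ∉ S → B.A σ * B.K a * covU μ (switchInput θ) B.v a = 0
  output : ∀ t, Y t = matAct B.C (X t) + matAct B.D (V t)

omit [IsProbabilityMeasure μ] in
include hθ in
theorem JointWSS.gram_U_eq_covU {k : ℕ} {r : ℤ → Ω → Fin k → ℝ} {R : ℤ → Fin k → Lp ℝ 2 μ}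
    {G : ℤ → Submodule ℝ (Lp ℝ 2 μ)} (H : SwitchedSpace pr S (mulInput μ hθ.meas) G)
    (h : JointWSS μ pr (switchInput θ) r) (hR : ∀ t, IsLift μ (R t) (r t)) (σ : α) (t : ℤ) :
    gram (R t) (vmap (mulInput μ hθ.meas σ t) (R t)) = covU μ (switchInput θ) r σ := by
  have h1 := h.gram_zz hθ.pos hθ.meas hR (w := [σ]) (v := [σ]) (by simp) (by simp) (t + 1) (0 + 1)
  rw [H.gram_zvec_singleton, H.gram_zvec_singleton] at h1
  rw [covU_eq hθ.meas hR]
  exact smul_right_injective _ (inv_ne_zero (hθ.pos σ).ne') h1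

omit [IsProbabilityMeasure μ] in
include hθ in
theorem JointWSS.covT_singleton {k : ℕ} {r : ℤ → Ω → Fin k → ℝ} {R : ℤ → Fin k → Lp ℝ 2 μ}
    {G : ℤ → Submodule ℝ (Lp ℝ 2 μ)} (H : SwitchedSpace pr S (mulInput μ hθ.meas) G)
    (h : JointWSS μ pr (switchInput θ) r) (hR : ∀ t, IsLift μ (R t) (r t)) (σ : α) :
    covT μ pr (switchInput θ) r [σ] [σ] = (pr σ)⁻¹ • covU μ (switchInput θ) r σ := by
  rw [covT_eq hθ.pos hθ.meas hR, h.gram_zz hθ.pos hθ.meas hR (by simp) (by simp) 0 (0 + 1),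
    H.gram_zvec_singleton, h.gram_U_eq_covU hθ H hR]

theorem GBS.IsJMLSRS.switchedSpace (h : B.IsJMLSRS μ pr S θ) :
    SwitchedSpace pr S (mulInput μ hθ.meas) (pastSpace μ B.v θ) :=
  switchedSpace_pastSpace hθ h.system.meas_v fun t => (h.noise_condIndep t).symm

theorem GBS.IsJMLSRS.exists_lifted (h : B.IsJMLSRS μ pr S θ) (hy : B.Realizes μ y) :
    ∃ X V Y, B.Lifted hθ y X V Y := by
  have hV : ∀ t, ∃ V : Fin m → Lp ℝ 2 μ, IsLift μ V (B.v t) :=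
    fun t => exists_isLift (h.noise_wss.memLp t)
  choose V hV using hV
  have H := h.switchedSpace hθ
  have hX : ∀ t i, ∃ f : Lp ℝ 2 μ, f ∈ lagSpan pr (mulInput μ hθ.meas) V t ∧
      f =ᵐ[μ] fun ω => B.x t ω i := by
    intro t i
    obtain ⟨g, hg, hge⟩ := h.noise_driven t i
    rw [hilbertSpan_zEntries hθ.pos hθ.meas hV] at hg
    exact ⟨g, hg, hge⟩
  choose X hX hXl using hX
  have hXl : ∀ t, IsLift μ (X t) (B.x t) := hXl
  have hcomp := fun (a σ : α) (hS : (a, σ) ∉ S) =>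
    h.compatible a σ (fun h' => hS (pair_mem_admissible.1 h'))
  refine ⟨X, V, fun t => matAct B.C (X t) + matAct B.D (V t), ⟨hXl, hV, fun t => ?_,
    fun w hw t => gram_zvec_eq_zero_of_uncorr hθ hV h.noise_uncorr hw t,
    h.noise_wss.gram_U_eq_covU hθ H hV, hX, fun t => ?_, fun a σ hS => (hcomp a σ hS).1,
    fun a σ hS => ?_, fun t => rfl⟩⟩
  · intro i
    filter_upwards [((hXl t).matAct B.C).add ((hV t).matAct B.D) i, hy t] with ω h1 h2
    rw [h1, h2]
  · refine (hXl (t + 1)).eq_of_ae (IsLift.sum Finset.univ fun σ =>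
      isLift_vmap_mulInput hθ.meas (((hXl t).matAct (B.A σ)).add ((hV t).matAct (B.K σ))) σ t) ?_
    exact h.system.state_eq t
  · have h1 := (hcomp a σ hS).2
    rw [h.noise_wss.covT_singleton hθ H hV, Matrix.mul_smul] at h1
    exact (smul_eq_zero.1 h1).resolve_left (inv_ne_zero (hθ.pos a).ne')

omit [IsProbabilityMeasure μ] [MeasurableSpace α] [DiscreteMeasurableSpace α] m0 in
theorem kronSum_sqrt_smul (hpr : ∀ σ, 0 < pr σ) (A : α → Matrix (Fin n) (Fin n) ℝ) :
    kronSum (fun σ => √(pr σ) • A σ) = ∑ σ, pr σ • ((A σ).transpose ⊗ₖ (A σ).transpose) := by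
  refine Finset.sum_congr rfl fun σ _ => ?_
  rw [Matrix.transpose_smul, Matrix.smul_kronecker, Matrix.kronecker_smul, smul_smul,
    Real.mul_self_sqrt (hpr σ).le]

omit [IsProbabilityMeasure μ] [MeasurableSpace α] [DiscreteMeasurableSpace α] m0 in
theorem GBS.stable_iff (hpr : ∀ σ, 0 < pr σ) :
    B.Stable pr ↔ KronStable fun σ => √(pr σ) • B.A σ := by
  unfold GBS.Stable KronStable
  rw [kronSum_sqrt_smul hpr]

omit [IsProbabilityMeasure μ] in
theorem GBS.Lifted.mul_eq_zero {X : ℤ → Fin n → Lp ℝ 2 μ} {V : ℤ → Fin m → Lp ℝ 2 μ}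
    {Y : ℤ → Fin p → Lp ℝ 2 μ} (hL : B.Lifted hθ y X V Y) (a σ : α)
    (h : [a, σ] ∉ admissible S) : B.A σ * B.A a = 0 :=
  hL.compatA a σ fun h' => h (pair_mem_admissible.2 h')

include hθ in
theorem GBS.IsJMLSRS.covEq_unique (h : B.IsJMLSRS μ pr S θ) (hy : B.Realizes μ y)
    {P P' : α → Matrix (Fin n) (Fin n) ℝ} (hP : B.SolvesCovEq μ pr S (switchInput θ) P)
    (hP' : B.SolvesCovEq μ pr S (switchInput θ) P') : P = P' := by
  classical
  obtain ⟨X, V, Y, hL⟩ := h.exists_lifted hθ hy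
  refine JMLSRS.covEq_unique pr hθ.pos B.A (fun a σ => [a, σ] ∈ admissible S)
    (hL.mul_eq_zero hθ) ((GBS.stable_iff hθ.pos).1 h.stable)
    (fun a => B.K a * covU μ (switchInput θ) B.v a * (B.K a).transpose) ?_ ?_
  · exact fun σ => by convert hP σ
  · exact fun σ => by convert hP' σ

theorem GBS.Lifted.solvesCovEq {X : ℤ → Fin n → Lp ℝ 2 μ} {V : ℤ → Fin m → Lp ℝ 2 μ}
    {Y : ℤ → Fin p → Lp ℝ 2 μ} (hL : B.Lifted hθ y X V Y) (h : B.IsJMLSRS μ pr S θ) (t : ℤ) :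
    B.SolvesCovEq μ pr S (switchInput θ)
      fun σ => gram (X t) (vmap (mulInput μ hθ.meas σ t) (X t)) := by
  intro σ
  have h1 := (h.switchedSpace hθ).gram_state_U_eq (mem_pastSpace hL.liftV) hL.noise hL.noiseU
    hL.driven hL.state hL.compatA hL.compatK σ t
  convert h1
  exact pair_mem_admissible

theorem GBS.Lifted.gram_state_U {X : ℤ → Fin n → Lp ℝ 2 μ} {V : ℤ → Fin m → Lp ℝ 2 μ}
    {Y : ℤ → Fin p → Lp ℝ 2 μ} (hL : B.Lifted hθ y X V Y) (h : B.IsJMLSRS μ pr S θ)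
    (hy : B.Realizes μ y) {P : α → Matrix (Fin n) (Fin n) ℝ}
    (hP : B.SolvesCovEq μ pr S (switchInput θ) P) (σ : α) (t : ℤ) :
    gram (X t) (vmap (mulInput μ hθ.meas σ t) (X t)) = P σ :=
  congrFun (h.covEq_unique hθ hy (hL.solvesCovEq hθ h t) hP) σ

include hθ in
theorem GBS.IsJMLSRS.existsUnique_solvesCovEq (h : B.IsJMLSRS μ pr S θ) (hy : B.Realizes μ y) :
    ∃! P : α → Matrix (Fin n) (Fin n) ℝ, B.SolvesCovEq μ pr S (switchInput θ) P := by
  obtain ⟨X, V, Y, hL⟩ := h.exists_lifted hθ hy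
  exact ⟨_, hL.solvesCovEq hθ h 0, fun P hP => h.covEq_unique hθ hy hP (hL.solvesCovEq hθ h 0)⟩

include hθ in
theorem GBS.IsJMLSRS.represents (h : B.IsJMLSRS μ pr S θ) (hy : B.Realizes μ y)
    {P : α → Matrix (Fin n) (Fin n) ℝ} (hP : B.SolvesCovEq μ pr S (switchInput θ) P) :
    (B.assocRep μ pr (switchInput θ) P).Represents (PsiFamily μ pr (switchInput θ) y) := by
  obtain ⟨X, V, Y, hL⟩ := h.exists_lifted hθ hy
  rintro ⟨j, σ⟩ w
  funext i
  have h1 := (h.switchedSpace hθ).gram_output_zvec (mem_pastSpace hL.liftV) hL.noise hL.noiseU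
    hL.driven hL.state hL.compatA hL.compatK (hL.gram_state_U hθ h hy hP) hL.output σ w 0
  rw [← covLam_eq hθ.pos hθ.meas hL.liftY] at h1
  exact congrFun (congrFun h1 i) j

include hθ in
theorem GBS.IsJMLSRS.exists_represents (h : B.IsJMLSRS μ pr S θ) (hy : B.Realizes μ y) :
    ∃ R : Rep α (Fin p × α) n p, R.Represents (PsiFamily μ pr (switchInput θ) y) :=
  ⟨_, h.represents hθ hy (h.existsUnique_solvesCovEq hθ hy).exists.choose_spec⟩

include hθ in
theorem GBS.IsJMLSRS.outputAssumption (h : B.IsJMLSRS μ pr S θ) (hy : B.Realizes μ y) :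
    OutputAssumption μ pr θ y := by
  obtain ⟨X, V, Y, hL⟩ := h.exists_lifted hθ hy
  obtain ⟨P, hP, -⟩ := h.existsUnique_solvesCovEq hθ hy
  have H := h.switchedSpace hθ
  have hPt := hL.gram_state_U hθ h hy hP
  have hYm := H.output_mem (mem_pastSpace hL.liftV) hL.driven hL.output
  have hV1 : ∀ t {f : Lp ℝ 2 μ}, f ∈ lagSpan pr (mulInput μ hθ.meas) V t →
      (inner ℝ (oneLp μ) f : ℝ) = 0 := fun t f hf =>
    inner_lagSpan_eq_zero (fun w hw i => by
      rw [← integral_eq_inner_one (isLift_zProc hθ.pos hθ.meas hL.liftV w t),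
        h.noise_wss.mean_z w hw]) hf
  have hV0 : ∀ t i, (inner ℝ (oneLp μ) (V t i) : ℝ) = 0 := fun t i => by
    rw [← integral_eq_inner_one (hL.liftV t), h.noise_wss.mean]
  have hrep := h.represents hθ hy hP
  refine ⟨jointWSS_of_gram hθ.meas H hL.liftY hYm (fun t i => ?_) (fun w hw t i => ?_)
    (fun w hw t s => ?_) (fun σ t s => ?_), ?_, ?_, ⟨_, _, hrep⟩⟩
  · rw [hL.output, Pi.add_apply, inner_add_right]
    simp [matAct, inner_sum, inner_smul_right, hV0, hV1 t (hL.driven t _)]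
  · exact hV1 t (H.zvec_output_mem hL.driven hL.output hw t i)
  · obtain ⟨σ, w, rfl⟩ := List.exists_cons_of_ne_nil hw
    have h1 := H.gram_output_zvec (mem_pastSpace hL.liftV) hL.noise hL.noiseU
      hL.driven hL.state hL.compatA hL.compatK hPt hL.output σ w
    rw [h1, h1]
  · have h1 := H.gram_output_U (mem_pastSpace hL.liftV) hL.noise hL.noiseU hL.driven hPt
      hL.output σ
    rw [h1, h1]
  · exact condIndepSigma_of_mem_pastSpace hθ h.system.meas_v
      (fun t => (h.noise_condIndep t).symm) hL.liftY hYm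
  · exact hrep.isSquareSummable ((GBS.stable_iff hθ.pos).1 h.stable)

end Realization
end JMLSRS

namespace JMLSRS

section WordOp

variable {E : Type*} [NormedAddCommGroup E] [InnerProductSpace ℝ E] {α : Type*} {k l : ℕ}
  {pr : α → ℝ} {U : α → ℤ → E →L[ℝ] E}

theorem wordOp_append (v w : List α) (t : ℤ) (f : E) :
    wordOp pr U (v ++ w) t f = wordOp pr U w t (wordOp pr U v (t - w.length) f) := by
  induction v generalizing f with
  | nil => simp [wordOp]
  | cons σ v ih =>
    have : t - ((v ++ w).length : ℤ) - 1 = t - w.length - v.length - 1 := by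
      rw [List.length_append]
      push_cast
      ring
    rw [List.cons_append, wordOp, wordOp, ContinuousLinearMap.comp_apply, ih, this,
      ContinuousLinearMap.comp_apply]

theorem zvec_append (r : ℤ → Fin k → E) (v w : List α) (t : ℤ) :
    zvec pr U r (v ++ w) (t + w.length) =
      vmap (wordOp pr U w (t + w.length)) (zvec pr U r v t) := by
  have : t + w.length - ((v ++ w).length : ℤ) = t - v.length := by
    rw [List.length_append]
    push_cast
    ring
  funext i
  rw [zvec, vmap, vmap, zvec, vmap, wordOp_append, this, add_sub_cancel_right]

namespace SwitchedSpace

variable [Fintype α] {S : Set (α × α)} {G : ℤ → Submodule ℝ E} (H : SwitchedSpace pr S U G)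

include H

theorem wordOp_comm (w : List α) (t : ℤ) (σ : α) (s : ℤ) (f : E) :
    wordOp pr U w t (U σ s f) = U σ s (wordOp pr U w t f) := by
  induction w generalizing f with
  | nil => simp [wordOp]
  | cons τ w ih => simp [wordOp, H.comm, ih]

theorem wordOp_symm (w : List α) (t : ℤ) (f g : E) :
    (inner ℝ (wordOp pr U w t f) g : ℝ) = inner ℝ f (wordOp pr U w t g) := by
  induction w generalizing f with
  | nil => simp [wordOp]
  | cons τ w ih =>
    simp only [wordOp, ContinuousLinearMap.comp_apply, smul_apply, map_smul,
      real_inner_smul_left, real_inner_smul_right]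
    rw [ih, H.symm, H.wordOp_comm]

theorem gram_wordOp_zvec (r : ℤ → Fin k → E) (r' : ℤ → Fin l → E) (v w : List α) (t : ℤ) :
    gram (vmap (wordOp pr U w (t + w.length)) (r (t + w.length))) (zvec pr U r' v t) =
      gram (r (t + w.length)) (zvec pr U r' (v ++ w) (t + w.length)) := by
  rw [zvec_append]
  ext i j
  exact H.wordOp_symm _ _ _ _

end SwitchedSpace

end WordOp

section Innovation

variable {Ω α : Type*} [m0 : MeasurableSpace Ω] {μ : Measure Ω} [IsProbabilityMeasure μ]
  [Fintype α] [MeasurableSpace α] [DiscreteMeasurableSpace α] {pr : α → ℝ} {S : Set (α × α)}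
  {θ : ℤ → Ω → α} (hθ : IsRestrictedSwitching μ pr S θ) {n p : ℕ}
  {y : ℤ → Ω → Fin p → ℝ}

/-- The matrix with the columns `B_{(1,σ)}, …, B_{(p,σ)}`. -/
def Rep.inputMatrix {p : ℕ} {α : Type*} (R : Rep α (Fin p × α) n p) (σ : α) :
    Matrix (Fin n) (Fin p) ℝ :=
  Matrix.of fun i j => R.B (j, σ) i

theorem Rep.mul_inputMatrix {k p : ℕ} {α : Type*} (R : Rep α (Fin p × α) n p)
    (M : Matrix (Fin k) (Fin n) ℝ) (σ : α) (i : Fin k) (j : Fin p) :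
    (M * R.inputMatrix σ) i j = M.mulVec (R.B (j, σ)) i := rfl

/-- The data of the innovation representation associated with the representation `R`,
transferred to `L²`. -/
structure InnovationLift (hθ : IsRestrictedSwitching μ pr S θ) (R : Rep α (Fin p × α) n p)
    (y : ℤ → Ω → Fin p → ℝ) (x : ℤ → Ω → Fin n → ℝ) (e : ℤ → Ω → Fin p → ℝ)
    (X : ℤ → Fin n → Lp ℝ 2 μ) (Y E : ℤ → Fin p → Lp ℝ 2 μ) : Prop where
  liftX : ∀ t, IsLift μ (X t) (x t)
  liftY : ∀ t, IsLift μ (Y t) (y t)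
  liftE : ∀ t, IsLift μ (E t) (e t)
  meas_x : ∀ t, Measurable (x t)
  meas_e : ∀ t, Measurable (e t)
  mem : ∀ t i, X t i ∈ lagSpan pr (mulInput μ hθ.meas) Y t
  moments : ∀ σ w t,
    gram (X t) (zvec pr (mulInput μ hθ.meas) Y (σ :: w) t) = wordMat R.A w * R.inputMatrix σ
  output : ∀ t, Y t = matAct R.C (X t) + E t
  orth : ∀ w, w ≠ [] → ∀ t, gram (E t) (zvec pr (mulInput μ hθ.meas) Y w t) = 0

omit [IsProbabilityMeasure μ] [Fintype α] in
theorem OutputAssumption.gram_zvec (hO : OutputAssumption μ pr θ y)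
    {Y : ℤ → Fin p → Lp ℝ 2 μ} (hY : ∀ t, IsLift μ (Y t) (y t)) (σ : α) (w : List α) (t : ℤ)
    (i j : Fin p) : gram (Y t) (zvec pr (mulInput μ hθ.meas) Y (σ :: w) t) i j =
      PsiFamily μ pr (switchInput θ) y (j, σ) w i := by
  rw [hO.wss.gram_z hθ.pos hθ.meas hY (by simp) t 0, ← covLam_eq hθ.pos hθ.meas hY]
  rfl

theorem exists_innovationLift (hy : ∀ t, Measurable (y t)) (hO : OutputAssumption μ pr θ y)
    {R : Rep α (Fin p × α) n p} (hR : R.Represents (PsiFamily μ pr (switchInput θ) y))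
    {G : Matrix (Fin n) (ShortWord α n × Fin p) ℝ} (hG : G * R.obsMatrix = 1) :
    ∃ x e X Y E, IsInnovationState μ pr (switchInput θ) y G x ∧
      IsForwardInnovation μ pr (switchInput θ) y e ∧ InnovationLift hθ R y x e X Y E := by
  have hY : ∀ t, ∃ Y : Fin p → Lp ℝ 2 μ, IsLift μ Y (y t) := fun t => exists_isLift (hO.wss.memLp t)
  choose Y hY using hY
  have H := switchedSpace_pastSpace hθ hy hO.condIndep
  have hspan := hilbertSpan_zEntries hθ.pos hθ.meas hY
  let Z : ℤ → ShortWord α n × Fin p → Lp ℝ 2 μ := fun t s =>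
    vmap (wordOp pr (mulInput μ hθ.meas) s.1.toList (t + s.1.toList.length))
      (Y (t + s.1.toList.length)) s.2
  let ξ : ℤ → Fin n → Lp ℝ 2 μ := fun t i => ∑ s, G i s • Z t s
  have hξ : ∀ t, IsLift μ (ξ t)
      fun ω => G.mulVec fun s => zFuture pr (switchInput θ) y s.1.toList t ω s.2 := by
    intro t
    have h1 : ∀ s, IsLift μ (fun i => G i s • Z t s) fun ω i =>
        G i s * zFuture pr (switchInput θ) y s.1.toList t ω s.2 := by
      intro s i
      filter_upwards [isLift_zFuture hθ.pos hθ.meas hY s.1.toList t s.2,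
        Lp.coeFn_smul (G i s) (Z t s)] with ω h1 h2
      rw [h2, Pi.smul_apply, h1, smul_eq_mul]
    intro i
    have h3 := IsLift.sum Finset.univ h1 i
    simp only [Finset.sum_apply] at h3
    exact h3
  let X : ℤ → Fin n → Lp ℝ 2 μ := fun t i =>
    (hilbertSpan μ (zEntries pr (switchInput θ) y t)).starProjection (ξ t i)
  have hXm : ∀ t i, X t i ∈ lagSpan pr (mulInput μ hθ.meas) Y t := fun t i => by
    rw [← hspan]
    exact Submodule.starProjection_apply_mem _ _
  have hξZ : ∀ σ v t, gram (ξ t) (zvec pr (mulInput μ hθ.meas) Y (σ :: v) t) =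
      wordMat R.A v * R.inputMatrix σ := by
    intro σ v t
    ext i j
    have h1 : ∀ s : ShortWord α n × Fin p,
        (inner ℝ (Z t s) (zvec pr (mulInput μ hθ.meas) Y (σ :: v) t j) : ℝ) =
          R.obsMatrix.mulVec ((wordMat R.A v).mulVec (R.B (j, σ))) s := by
      intro s
      have h2 := congrFun (congrFun (H.gram_wordOp_zvec Y Y (σ :: v) s.1.toList t) s.2) j
      rw [List.cons_append, hO.gram_zvec hθ hY, hR, wordMat_append, ← Matrix.mul_assoc,
        ← Matrix.mulVec_mulVec] at h2
      exact h2
    rw [gram_apply, sum_inner, R.mul_inputMatrix]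
    simp only [real_inner_smul_left, h1]
    have h3 : G.mulVec (R.obsMatrix.mulVec ((wordMat R.A v).mulVec (R.B (j, σ)))) i =
        (wordMat R.A v).mulVec (R.B (j, σ)) i := by
      rw [Matrix.mulVec_mulVec, hG, Matrix.one_mulVec]
    exact h3
  have hXZ : ∀ σ v t, gram (X t) (zvec pr (mulInput μ hθ.meas) Y (σ :: v) t) =
      wordMat R.A v * R.inputMatrix σ := by
    intro σ v t
    rw [← hξZ]
    ext i j
    have h1 : zvec pr (mulInput μ hθ.meas) Y (σ :: v) t j ∈
        hilbertSpan μ (zEntries pr (switchInput θ) y t) := by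
      rw [hspan]
      exact zvec_mem_lagSpan _ _ _ _ (by simp) _
    have h2 := Submodule.starProjection_inner_eq_zero (ξ t i) _ h1
    rw [inner_sub_left, sub_eq_zero] at h2
    exact h2.symm
  let x : ℤ → Ω → Fin n → ℝ := fun t ω i => X t i ω
  have hx : ∀ t, IsLift μ (X t) (x t) := fun t i => Filter.EventuallyEq.refl _ _
  have hxm : ∀ t, Measurable (x t) := fun t =>
    measurable_pi_lambda _ fun i => (Lp.stronglyMeasurable (X t i)).measurable
  have horth : ∀ w, w ≠ [] → ∀ t,
      gram (Y t - matAct R.C (X t)) (zvec pr (mulInput μ hθ.meas) Y w t) = 0 := by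
    intro w hw t
    obtain ⟨σ, w, rfl⟩ := List.exists_cons_of_ne_nil hw
    rw [gram_sub_left, gram_matAct_left, hXZ, sub_eq_zero]
    ext i j
    rw [hO.gram_zvec hθ hY, hR, ← Matrix.mul_assoc, R.mul_inputMatrix]
  refine ⟨x, fun t ω => y t ω - R.C.mulVec (x t ω), X, Y, fun t => Y t - matAct R.C (X t), ?_, ?_,
    ⟨hx, hY, fun t => (hY t).sub ((hx t).matAct R.C), hxm, fun t => (hy t).sub
      ((continuous_const.matrix_mulVec continuous_id).measurable.comp (hxm t)), hXm, hXZ,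
      fun t => by simp, horth⟩⟩
  · intro t i
    refine ⟨(hξ t).memLp i, ?_⟩
    have h1 : ((hξ t).memLp i).toLp _ = ξ t i :=
      Lp.ext ((MemLp.coeFn_toLp _).trans (hξ t i).symm)
    rw [h1]
  · intro t i
    refine ⟨(hY t).memLp i, ?_⟩
    have h1 : ((hY t).memLp i).toLp _ = Y t i :=
      Lp.ext ((MemLp.coeFn_toLp _).trans (hY t i).symm)
    have h2 : (hilbertSpan μ (zEntries pr (switchInput θ) y t)).starProjection (Y t i) =
        matAct R.C (X t) i := by
      refine Submodule.eq_starProjection_of_mem_orthogonal ?_ ?_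
      · exact Submodule.sum_mem _ fun j _ => Submodule.smul_mem _ _ (by rw [hspan]; exact hXm t j)
      · rw [Submodule.mem_orthogonal']
        intro f hf
        rw [hspan] at hf
        exact inner_lagSpan_eq_zero
          (fun w hw j => congrFun (congrFun (horth w hw t) i) j) hf
    rw [h1, h2]
    filter_upwards [(hx t).matAct R.C i] with ω h3
    rw [h3]
    simp

end Innovation
end JMLSRS

namespace JMLSRS

section InnovationSystem

variable {Ω α : Type*} [m0 : MeasurableSpace Ω] {μ : Measure Ω} [IsProbabilityMeasure μ]
  [Fintype α] [MeasurableSpace α] [DiscreteMeasurableSpace α] {pr : α → ℝ} {S : Set (α × α)}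
  {θ : ℤ → Ω → α} (hθ : IsRestrictedSwitching μ pr S θ) {n p : ℕ}
  {y : ℤ → Ω → Fin p → ℝ} (hy : ∀ t, Measurable (y t)) (hO : OutputAssumption μ pr θ y)
  {R : Rep α (Fin p × α) n p} (hR : R.IsMinimal (PsiFamily μ pr (switchInput θ) y))

include hθ hy hO

theorem OutputAssumption.psiFamily_eq_zero {j : Fin p} {σ : α} {w : List α}
    (hw : σ :: w ∉ admissible S) : PsiFamily μ pr (switchInput θ) y (j, σ) w = 0 := by
  have hY : ∀ t, ∃ Y : Fin p → Lp ℝ 2 μ, IsLift μ Y (y t) := fun t => exists_isLift (hO.wss.memLp t)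
  choose Y hY using hY
  have H := switchedSpace_pastSpace hθ hy hO.condIndep
  funext i
  rw [← hO.gram_zvec hθ hY σ w 0, H.zvec_eq_zero (mem_pastSpace hY) (by simp) hw, gram_zero_right]
  rfl

include hR

theorem OutputAssumption.mul_eq_zero {a σ : α} (h : (a, σ) ∉ S) : R.A σ * R.A a = 0 :=
  hR.mul_eq_zero fun ⟨j, τ⟩ v w => hO.psiFamily_eq_zero hθ hy fun h' => by
    have h1 : [a, σ] <:+: τ :: (v ++ a :: σ :: w) := ⟨τ :: v, w, by simp⟩
    have h2 := h'.2.infix h1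
    simp at h2
    exact h h2

theorem OutputAssumption.mul_inputMatrix_eq_zero {a σ : α} (h : (a, σ) ∉ S) :
    R.A σ * R.inputMatrix a = 0 := by
  ext i j
  rw [R.mul_inputMatrix, hR.mulVec_eq_zero fun w => hO.psiFamily_eq_zero hθ hy fun h' => ?_]
  · rfl
  · have h1 := h'.2
    simp at h1
    exact h h1.1

variable {x : ℤ → Ω → Fin n → ℝ} {e : ℤ → Ω → Fin p → ℝ}
    {X : ℤ → Fin n → Lp ℝ 2 μ} {Y E : ℤ → Fin p → Lp ℝ 2 μ}

namespace InnovationLift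

omit hR in
theorem gram_state (hI : InnovationLift hθ R y x e X Y E) (σ : α) (t : ℤ) :
    gram (X t) (vmap (mulInput μ hθ.meas σ t) (X t)) = covU μ (switchInput θ) x σ := by
  rw [covU_eq hθ.meas hI.liftX]
  exact (switchedSpace_pastSpace hθ hy hO.condIndep).gram_innovState_stationary
    (mem_pastSpace hI.liftY)
    (fun w w' hw hw' t s => hO.wss.gram_zz hθ.pos hθ.meas hI.liftY hw hw' t s)
    hI.mem hI.moments σ t 0

omit hR in
theorem gram_innov (hI : InnovationLift hθ R y x e X Y E) (σ : α) (t : ℤ) :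
    gram (E t) (vmap (mulInput μ hθ.meas σ t) (E t)) =
      covU μ (switchInput θ) y σ - R.C * covU μ (switchInput θ) x σ * R.C.transpose :=
  have H := switchedSpace_pastSpace hθ hy hO.condIndep
  H.gram_innov_U (mem_pastSpace hI.liftY) (hO.wss.gram_U_eq_covU hθ H hI.liftY) hI.mem hI.output
    hI.orth (hI.gram_state hθ hy hO) σ t

omit hR in
theorem gainDenom_eq (hI : InnovationLift hθ R y x e X Y E) (σ : α) :
    gainDenom μ pr (switchInput θ) y R x σ =
      covU μ (switchInput θ) y σ - R.C * covU μ (switchInput θ) x σ * R.C.transpose := by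
  rw [gainDenom, hO.wss.covT_singleton hθ (switchedSpace_pastSpace hθ hy hO.condIndep) hI.liftY,
    smul_smul, mul_inv_cancel₀ (hθ.pos σ).ne', one_smul]

omit hR in
theorem covU_innov (hI : InnovationLift hθ R y x e X Y E) (σ : α) :
    covU μ (switchInput θ) e σ = gainDenom μ pr (switchInput θ) y R x σ := by
  rw [covU_eq hθ.meas hI.liftE, hI.gram_innov hθ hy hO, hI.gainDenom_eq hθ hy hO]

theorem exists_gain (hI : InnovationLift hθ R y x e X Y E) :
    ∃ K : α → Matrix (Fin n) (Fin p) ℝ, ∀ σ,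
      K σ * gainDenom μ pr (switchInput θ) y R x σ = gainNum μ pr (switchInput θ) R x σ := by
  have H := switchedSpace_pastSpace hθ hy hO.condIndep
  obtain ⟨K, hK⟩ := H.exists_gain (mem_pastSpace hI.liftY)
    (hO.wss.gram_U_eq_covU hθ H hI.liftY) hI.mem hI.moments
    (fun _ _ => hO.mul_eq_zero hθ hy hR) (fun _ _ => hO.mul_inputMatrix_eq_zero hθ hy hR)
    hI.output hI.orth (hI.gram_state hθ hy hO)
  refine ⟨K, fun σ => ?_⟩
  rw [hI.gainDenom_eq hθ hy hO, hK]
  rfl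

omit hR hy [Fintype α] in
theorem inner_one_eq_zero (hI : InnovationLift hθ R y x e X Y E) {t : ℤ} {f : Lp ℝ 2 μ}
    (hf : f ∈ lagSpan pr (mulInput μ hθ.meas) Y t) : (inner ℝ (oneLp μ) f : ℝ) = 0 :=
  inner_lagSpan_eq_zero (fun w hw i => by
    rw [← integral_eq_inner_one (isLift_zProc hθ.pos hθ.meas hI.liftY w t),
      hO.wss.mean_z w hw]) hf

omit hR in
theorem innov_mem (hI : InnovationLift hθ R y x e X Y E) (t : ℤ) (i : Fin p) :
    E t i ∈ pastSpace μ y θ t :=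
  (switchedSpace_pastSpace hθ hy hO.condIndep).innov_mem (mem_pastSpace hI.liftY) hI.mem
    hI.output t i

omit hR in
theorem gram_innov_zvec (hI : InnovationLift hθ R y x e X Y E) {w : List α} (hw : w ≠ [])
    (t : ℤ) : gram (E t) (zvec pr (mulInput μ hθ.meas) E w t) = 0 :=
  (switchedSpace_pastSpace hθ hy hO.condIndep).gram_innov_zvec hI.mem hI.output hI.orth hw t

omit hR in
theorem jointWSS_innov (hI : InnovationLift hθ R y x e X Y E) :
    JointWSS μ pr (switchInput θ) e := by
  have H := switchedSpace_pastSpace hθ hy hO.condIndep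
  refine jointWSS_of_gram hθ.meas H hI.liftE (hI.innov_mem hθ hy hO) (fun t i => ?_)
    (fun w hw t i => ?_) (fun w hw t s => ?_) (fun σ t s => ?_)
  · have h1 : E t i = Y t i - matAct R.C (X t) i := by rw [hI.output t]; simp
    have h2 : (inner ℝ (oneLp μ) (Y t i) : ℝ) = 0 := by
      rw [← integral_eq_inner_one (hI.liftY t), hO.wss.mean]
    rw [h1, inner_sub_right, h2]
    simp [matAct, inner_sum, inner_smul_right, hI.inner_one_eq_zero hθ hO (hI.mem t _)]
  · exact hI.inner_one_eq_zero hθ hO (H.zvec_innov_mem hI.mem hI.output hw t i)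
  · rw [hI.gram_innov_zvec hθ hy hO hw, hI.gram_innov_zvec hθ hy hO hw]
  · rw [hI.gram_innov hθ hy hO, hI.gram_innov hθ hy hO]

omit hR in
theorem innov_uncorr (hI : InnovationLift hθ R y x e X Y E) {l t : ℤ} (h : l < t) (i j : Fin p) :
    μ[fun ω => e t ω i * e l ω j | sigmaGen θ (Set.Ico l t)] =ᵐ[μ] 0 := by
  refine condExp_switch_eq_zero hθ.meas (((hI.liftE t).memLp i).integrable_mul
    ((hI.liftE l).memLp j)) h fun w hw => ?_
  obtain rfl : l = t - w.length := by omega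
  have hne : w ≠ [] := by
    rintro rfl
    simp at h
  have h1 := congrFun (congrFun (hI.gram_innov_zvec hθ hy hO hne t) i) j
  rw [← (hI.liftE t).cov_eq (isLift_zProc hθ.pos hθ.meas hI.liftE w t)] at h1
  have h2 : (fun ω => e t ω i * e (t - w.length) ω j * wordInput (switchInput θ) w (t - 1) ω) =
      fun ω => √(wordWeight pr w) * (e t ω i * zProc pr (switchInput θ) e w t ω j) := by
    funext ω
    have := (Real.sqrt_pos.2 (wordWeight_pos hθ.pos w)).ne'
    rw [zProc]
    field_simp
  have h3 : ∫ ω, e t ω i * zProc pr (switchInput θ) e w t ω j ∂μ = 0 := h1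
  have h4 : ∫ ω, e t ω i * e (t - w.length) ω j * wordInput (switchInput θ) w (t - 1) ω ∂μ = 0 := by
    rw [h2, integral_const_mul, h3, mul_zero]
  exact h4

variable {K : α → Matrix (Fin n) (Fin p) ℝ}
  (hK : ∀ σ, K σ * gainDenom μ pr (switchInput θ) y R x σ = gainNum μ pr (switchInput θ) R x σ)

include hK

theorem state_eq (hI : InnovationLift hθ R y x e X Y E) (t : ℤ) :
    X (t + 1) = ∑ σ, vmap (mulInput μ hθ.meas σ t)
      (matAct ((√(pr σ))⁻¹ • R.A σ) (X t) + matAct (K σ) (E t)) := by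
  have H := switchedSpace_pastSpace hθ hy hO.condIndep
  refine H.innov_state_eq (mem_pastSpace hI.liftY)
    (hO.wss.gram_U_eq_covU hθ H hI.liftY) hI.mem hI.moments
    (fun _ _ => hO.mul_eq_zero hθ hy hR) (fun _ _ => hO.mul_inputMatrix_eq_zero hθ hy hR)
    hI.output hI.orth (hI.gram_state hθ hy hO) (fun σ => ?_) t
  rw [← hI.gainDenom_eq hθ hy hO, hK]
  rfl

theorem isSystem (hI : InnovationLift hθ R y x e X Y E) :
    (innovationSystem pr R K x e).IsSystem μ (switchInput θ) where
  meas_x := hI.meas_x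
  meas_v := hI.meas_e
  state_eq t := by
    have h1 := IsLift.sum Finset.univ fun σ => isLift_vmap_mulInput hθ.meas
      (((hI.liftX t).matAct ((√(pr σ))⁻¹ • R.A σ)).add ((hI.liftE t).matAct (K σ))) σ t
    rw [← hI.state_eq hθ hy hO hR hK] at h1
    exact (hI.liftX (t + 1)).ae_eq h1

omit hK hO hy hR [Fintype α] [IsProbabilityMeasure μ] in
theorem realizes (hI : InnovationLift hθ R y x e X Y E) :
    (innovationSystem pr R K x e).Realizes μ y := by
  intro t
  have h1 := ((hI.liftX t).matAct R.C).add (hI.liftE t)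
  rw [← hI.output] at h1
  filter_upwards [(hI.liftY t).ae_eq h1] with ω hω
  rw [hω]
  simp [innovationSystem]

theorem noiseDriven (hI : InnovationLift hθ R y x e X Y E) :
    (innovationSystem pr R K x e).NoiseDriven μ pr (switchInput θ) := by
  have H := switchedSpace_pastSpace hθ hy hO.condIndep
  intro t i
  refine ⟨X t i, ?_, hI.liftX t i⟩
  change _ ∈ hilbertSpan μ (zEntries pr (switchInput θ) e t)
  rw [hilbertSpan_zEntries hθ.pos hθ.meas hI.liftE]
  exact H.innovState_mem_lagSpan (hI.state_eq hθ hy hO hR hK)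
    (fun t i => H.lagSpan_le_G (mem_pastSpace hI.liftY) t (hI.mem t i))
    (fun σ t s => by rw [hI.gram_state hθ hy hO, hI.gram_state hθ hy hO])
    (hR.summable_wordMat hO.squareSummable) t i

omit hK [IsProbabilityMeasure μ] [DiscreteMeasurableSpace α] hy in
theorem stable : (innovationSystem pr R K x e).Stable pr := by
  rw [GBS.stable_iff hθ.pos]
  have h1 : (fun σ => √(pr σ) • (innovationSystem pr R K x e).A σ) = R.A := by
    funext σ
    rw [innovationSystem, smul_smul, mul_inv_cancel₀ (Real.sqrt_pos.2 (hθ.pos σ)).ne', one_smul]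
  rw [h1]
  exact hR.kronStable hO.squareSummable

theorem switchCompatible (hI : InnovationLift hθ R y x e X Y E) :
    (innovationSystem pr R K x e).SwitchCompatible μ pr S (switchInput θ) := by
  intro a σ h
  have hS : (a, σ) ∉ S := fun h' => h (pair_mem_admissible.2 h')
  have hA := hO.mul_eq_zero hθ hy hR hS
  have hB := hO.mul_inputMatrix_eq_zero hθ hy hR hS
  refine ⟨?_, ?_⟩
  · simp only [innovationSystem, Matrix.smul_mul, Matrix.mul_smul, hA, smul_zero]
  · have h1 : covT μ pr (switchInput θ) e [a] [a] =
        (pr a)⁻¹ • gainDenom μ pr (switchInput θ) y R x a := by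
      rw [(hI.jointWSS_innov hθ hy hO).covT_singleton hθ
        (switchedSpace_pastSpace hθ hy hO.condIndep) hI.liftE, hI.covU_innov hθ hy hO]
    change (√(pr σ))⁻¹ • R.A σ * K a * covT μ pr (switchInput θ) e [a] [a] = 0
    have h2 : R.A σ * gainNum μ pr (switchInput θ) R x a = 0 := by
      change R.A σ * (√(pr a) • R.inputMatrix a - _) = 0
      rw [Matrix.mul_sub, Matrix.mul_smul, hB, Matrix.mul_smul, ← Matrix.mul_assoc,
        ← Matrix.mul_assoc, hA]
      simp
    rw [h1, Matrix.mul_smul, Matrix.smul_mul, Matrix.smul_mul, Matrix.mul_assoc, hK, h2]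
    simp

theorem isJMLSRS (hI : InnovationLift hθ R y x e X Y E) :
    (innovationSystem pr R K x e).IsJMLSRS μ pr S θ where
  system := hI.isSystem hθ hy hO hR hK
  noise_wss := hI.jointWSS_innov hθ hy hO
  noise_uncorr _ _ h := hI.innov_uncorr hθ hy hO h
  noise_condIndep t := (condIndepSigma_of_mem_pastSpace hθ hy hO.condIndep hI.liftE
    (hI.innov_mem hθ hy hO) t).symm
  noise_driven := hI.noiseDriven hθ hy hO hR hK
  stable := stable hθ hO hR
  compatible := hI.switchCompatible hθ hy hO hR hK

theorem isMinimalJMLSRS (hI : InnovationLift hθ R y x e X Y E) :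
    (innovationSystem pr R K x e).IsMinimalJMLSRS μ pr S θ y := by
  refine ⟨hI.isJMLSRS hθ hy hO hR hK, hI.realizes hθ, fun n' m' B' hB' hyB' => ?_⟩
  obtain ⟨R', hR'⟩ := hB'.exists_represents hθ hyB'
  exact hR.2 n' R' hR'

theorem forwardInnovationForm (hI : InnovationLift hθ R y x e X Y E)
    (he : IsForwardInnovation μ pr (switchInput θ) y e) :
    (innovationSystem pr R K x e).ForwardInnovationForm μ pr S (switchInput θ) y where
  D_eq := rfl
  noise_eq := he
  standing :=
    have H := switchedSpace_pastSpace hθ hy hO.condIndep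
    { system := hI.isSystem hθ hy hO hR hK
      noise_rc := isRC_of_jointWSS hθ.meas H hI.liftE (hI.innov_mem hθ hy hO)
        (hI.jointWSS_innov hθ hy hO)
      noise_orth := fun w v _ _ h t => by
        have h1 := isLift_zProc hθ.pos hθ.meas hI.liftE
        change cov μ (zProc pr (switchInput θ) e w t) (zProc pr (switchInput θ) e v t) = 0
        rw [(h1 w t).cov_eq (h1 v t)]
        exact H.gram_zvec_eq_zero (hI.innov_mem hθ hy hO)
          (fun w hw => hI.gram_innov_zvec hθ hy hO hw) h t
      noise_driven := hI.noiseDriven hθ hy hO hR hK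
      stable := stable hθ hO hR
      compatible := hI.switchCompatible hθ hy hO hR hK }

omit hK hR in
theorem isUnit_gainDenom_det (hI : InnovationLift hθ R y x e X Y E) {σ : α}
    (hpos : (covU μ (switchInput θ) e σ).PosDef) :
    IsUnit (gainDenom μ pr (switchInput θ) y R x σ).det := by
  rw [← hI.covU_innov hθ hy hO]
  exact hpos.det_pos.ne'.isUnit

end InnovationLift

end InnovationSystem
end JMLSRS

theorem mainTheorem10 {Ω α : Type*} [MeasurableSpace Ω] (μ : MeasureTheory.Measure Ω)
    [MeasureTheory.IsProbabilityMeasure μ]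
    [Fintype α] [MeasurableSpace α] [DiscreteMeasurableSpace α]
    (pr : α → ℝ) (S : Set (α × α)) (θ : ℤ → Ω → α)
    (hθ : JMLSRS.IsRestrictedSwitching μ pr S θ)
    (p : ℕ) (y : ℤ → Ω → Fin p → ℝ) (hy : ∀ t, Measurable (y t)) :
    -- existence of a realization
    ((∃ (n m : ℕ) (B : JMLSRS.GBS Ω α n m p), B.IsJMLSRS μ pr S θ ∧ B.Realizes μ y) ↔
      JMLSRS.OutputAssumption μ pr θ y) ∧
    -- existence and construction of minimal realizations in forward innovation form
    (JMLSRS.OutputAssumption μ pr θ y →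
      (∃ (n : ℕ) (B : JMLSRS.GBS Ω α n p p), B.IsMinimalJMLSRS μ pr S θ y ∧
        B.ForwardInnovationForm μ pr S (JMLSRS.switchInput θ) y) ∧
      ∀ (n : ℕ) (R : JMLSRS.Rep α (Fin p × α) n p),
        R.IsMinimal (JMLSRS.PsiFamily μ pr (JMLSRS.switchInput θ) y) →
        (∃ G : Matrix (Fin n) (JMLSRS.ShortWord α n × Fin p) ℝ, G * R.obsMatrix = 1) ∧
        ∀ G : Matrix (Fin n) (JMLSRS.ShortWord α n × Fin p) ℝ, G * R.obsMatrix = 1 →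
          ∃ (x : ℤ → Ω → Fin n → ℝ) (e : ℤ → Ω → Fin p → ℝ),
            JMLSRS.IsInnovationState μ pr (JMLSRS.switchInput θ) y G x ∧
            JMLSRS.IsForwardInnovation μ pr (JMLSRS.switchInput θ) y e ∧
            (∃ K : α → Matrix (Fin n) (Fin p) ℝ, ∀ σ,
              K σ * JMLSRS.gainDenom μ pr (JMLSRS.switchInput θ) y R x σ =
                JMLSRS.gainNum μ pr (JMLSRS.switchInput θ) R x σ) ∧
            (∀ K : α → Matrix (Fin n) (Fin p) ℝ,
              (∀ σ, K σ * JMLSRS.gainDenom μ pr (JMLSRS.switchInput θ) y R x σ =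
                JMLSRS.gainNum μ pr (JMLSRS.switchInput θ) R x σ) →
              (JMLSRS.innovationSystem pr R K x e).IsMinimalJMLSRS μ pr S θ y ∧
              (JMLSRS.innovationSystem pr R K x e).ForwardInnovationForm μ pr S
                (JMLSRS.switchInput θ) y) ∧
            ((∀ σ, (JMLSRS.covU μ (JMLSRS.switchInput θ) e σ).PosDef) →
              (∀ σ, IsUnit (JMLSRS.gainDenom μ pr (JMLSRS.switchInput θ) y R x σ).det) ∧
              ∀ K : α → Matrix (Fin n) (Fin p) ℝ,
                (∀ σ, K σ * JMLSRS.gainDenom μ pr (JMLSRS.switchInput θ) y R x σ =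
                  JMLSRS.gainNum μ pr (JMLSRS.switchInput θ) R x σ) →
                ∀ σ, K σ = JMLSRS.gainNum μ pr (JMLSRS.switchInput θ) R x σ *
                  (JMLSRS.gainDenom μ pr (JMLSRS.switchInput θ) y R x σ)⁻¹)) ∧
    -- characterization of minimality
    (∀ (n m : ℕ) (B : JMLSRS.GBS Ω α n m p), B.IsJMLSRS μ pr S θ → B.Realizes μ y →
      (∃! P : α → Matrix (Fin n) (Fin n) ℝ,
        B.SolvesCovEq μ pr S (JMLSRS.switchInput θ) P) ∧
      ∀ P : α → Matrix (Fin n) (Fin n) ℝ, B.SolvesCovEq μ pr S (JMLSRS.switchInput θ) P →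
        (B.IsMinimalJMLSRS μ pr S θ y ↔
          (B.assocRep μ pr (JMLSRS.switchInput θ) P).IsMinimal
            (JMLSRS.PsiFamily μ pr (JMLSRS.switchInput θ) y))) ∧
    -- uniqueness of minimal realizations up to isomorphism of the associated representations
    (∀ (n₁ m₁ n₂ m₂ : ℕ) (B₁ : JMLSRS.GBS Ω α n₁ m₁ p) (B₂ : JMLSRS.GBS Ω α n₂ m₂ p),
      B₁.IsMinimalJMLSRS μ pr S θ y → B₂.IsMinimalJMLSRS μ pr S θ y →
      ∀ (P₁ : α → Matrix (Fin n₁) (Fin n₁) ℝ) (P₂ : α → Matrix (Fin n₂) (Fin n₂) ℝ),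
        B₁.SolvesCovEq μ pr S (JMLSRS.switchInput θ) P₁ →
        B₂.SolvesCovEq μ pr S (JMLSRS.switchInput θ) P₂ →
        (B₁.assocRep μ pr (JMLSRS.switchInput θ) P₁).Isomorphic
          (B₂.assocRep μ pr (JMLSRS.switchInput θ) P₂)) := by
  classical
  have construct : JMLSRS.OutputAssumption μ pr θ y →
      ∀ (n : ℕ) (R : JMLSRS.Rep α (Fin p × α) n p),
        R.IsMinimal (JMLSRS.PsiFamily μ pr (JMLSRS.switchInput θ) y) →
        ∃ B : JMLSRS.GBS Ω α n p p, B.IsMinimalJMLSRS μ pr S θ y ∧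
          B.ForwardInnovationForm μ pr S (JMLSRS.switchInput θ) y := by
    intro hO n R hR
    obtain ⟨G, hG⟩ := JMLSRS.Rep.exists_leftInverse_obsMatrix hR.obs_injective
    obtain ⟨x, e, X, Y, E, -, he, hI⟩ := JMLSRS.exists_innovationLift hθ hy hO hR.1 hG
    obtain ⟨K, hK⟩ := hI.exists_gain hθ hy hO hR
    exact ⟨_, hI.isMinimalJMLSRS hθ hy hO hR hK, hI.forwardInnovationForm hθ hy hO hR hK he⟩
  have minimal : ∀ (n m : ℕ) (B : JMLSRS.GBS Ω α n m p), B.IsJMLSRS μ pr S θ → B.Realizes μ y →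
      ∀ P : α → Matrix (Fin n) (Fin n) ℝ, B.SolvesCovEq μ pr S (JMLSRS.switchInput θ) P →
        (B.IsMinimalJMLSRS μ pr S θ y ↔ (B.assocRep μ pr (JMLSRS.switchInput θ) P).IsMinimal
          (JMLSRS.PsiFamily μ pr (JMLSRS.switchInput θ) y)) := by
    intro n m B hB hyB P hP
    refine ⟨fun h => ⟨hB.represents hθ hyB hP, fun n' R' hR' => ?_⟩,
      fun h => ⟨hB, hyB, fun n' m' B' hB' hyB' => ?_⟩⟩
    · have hO := hB.outputAssumption hθ hyB
      obtain ⟨n₀, R₀, hR₀⟩ := hO.rational.exists_isMinimal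
      obtain ⟨B₀, hB₀, -⟩ := construct hO n₀ R₀ hR₀
      exact (h.2.2 n₀ p B₀ hB₀.1 hB₀.2.1).trans (hR₀.2 n' R' hR')
    · obtain ⟨R', hR'⟩ := hB'.exists_represents hθ hyB'
      exact h.2 n' R' hR'
  refine ⟨⟨?_, fun hO => ?_⟩, fun hO => ⟨?_, fun n R hR => ⟨?_, fun G hG => ?_⟩⟩,
    fun n m B hB hyB => ⟨hB.existsUnique_solvesCovEq hθ hyB, minimal n m B hB hyB⟩, ?_⟩
  · rintro ⟨n, m, B, hB, hyB⟩
    exact hB.outputAssumption hθ hyB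
  · obtain ⟨n, R, hR⟩ := hO.rational.exists_isMinimal
    obtain ⟨B, hB, -⟩ := construct hO n R hR
    exact ⟨n, p, B, hB.1, hB.2.1⟩
  · obtain ⟨n, R, hR⟩ := hO.rational.exists_isMinimal
    obtain ⟨B, hB⟩ := construct hO n R hR
    exact ⟨n, B, hB⟩
  · exact JMLSRS.Rep.exists_leftInverse_obsMatrix hR.obs_injective
  · obtain ⟨x, e, X, Y, E, hx, he, hI⟩ := JMLSRS.exists_innovationLift hθ hy hO hR.1 hG
    refine ⟨x, e, hx, he, hI.exists_gain hθ hy hO hR,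
      fun K hK => ⟨hI.isMinimalJMLSRS hθ hy hO hR hK, hI.forwardInnovationForm hθ hy hO hR hK he⟩,
      fun hpos => ?_⟩
    have hdet := fun σ => hI.isUnit_gainDenom_det hθ hy hO (hpos σ)
    refine ⟨hdet, fun K hK σ => ?_⟩
    rw [← hK σ, Matrix.mul_nonsing_inv_cancel_right _ _ (hdet σ)]
  · intro n₁ m₁ n₂ m₂ B₁ B₂ h₁ h₂ P₁ P₂ hP₁ hP₂
    exact ((minimal n₁ m₁ B₁ h₁.1 h₁.2.1 P₁ hP₁).1 h₁).isomorphic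
      ((minimal n₂ m₂ B₂ h₂.1 h₂.2.1 P₂ hP₂).1 h₂)
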